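/- **Conventions.** A *Banach ring* is a commutative ring $R$ with $1$, complete for a norm $|\cdot|:R\to\mathbb R_{\ge 0}$ (so $|a|=0$ iff $a=0$, $|-a|=|a|$, $|a+b|\le|a|+|b|$) such that $|ab|\le C|a||b|$ for some constant $C>0$; it is *non-Archimedean* if $|a+b|\le\max(|a|,|b|)$. $\mathrm{Ban}^A_R$ is the category of Banach $R$-modules (complete normed $R$-modules with $\|am\|\le C|a|\|m\|$ for some constant $C$ depending on the module) and bounded $R$-linear maps, and $\mathrm{Ban}^{nA}_R$ is its full subcategory of modules whose norm satisfies the strong triangle inequality. Their symmetric monoidal structures $\overline\otimes$ are the separated completions of $M\otimes_R N$ for the seminorms $\inf\sum_i\|m_i\|\|n_i\|$ (case $A$) and $\inf\max_i\|m_i\|\|n_i\|$ (case $nA$), the infimum being over all finite expressions $x=\sum_i m_i\otimes n_i$; the unit is $R$. The ind-categories carry the extended tensor product $(``\mathrm{colim}"_i X_i)\,\overline\otimes\,(``\mathrm{colim}"_j Y_j)=``\mathrm{colim}"_{i,j}\,X_i\overline\otimes Y_j$, and $\iota$ is the functor of ind-categories induced by the inclusion $\mathrm{Ban}^{nA}_R\subset\mathrm{Ban}^A_R$.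 For a Banach module $M$, let $M^\times=M\setminus\{0\}$ and let $P^A(M)$, resp. $P^{nA}(M)$, be the completion of $\bigoplus_{m\in M^\times}R$ for the norm $\sum_m|c_m|\|m\|$, resp. $\max_m|c_m|\|m\|$; let $\kappa_M:P^A(M)\to M$ be $(c_m)\mapsto\sum c_m m$, and let $P^A(M)\to\iota P^{nA}(M)$ be the map induced by the identity of $\bigoplus_m R$. For a small filtered system $(V_i)_{i\in I}$ in $\mathrm{Ban}^A_R$ and $\mathcal E=``\mathrm{colim}"_i V_i$ put $P^A(\mathcal E)=\coprod_i P^A(V_i)$ and $P^{nA}(\mathcal E)=\coprod_i P^{nA}(V_i)$ (coproducts in the respective ind-categories), with the induced maps $\kappa_{\mathcal E}:P^A(\mathcal E)\to\coprod_iV_i\to\mathcal E$ and $c_{\mathcal E}:P^A(\mathcal E)\to\iota P^{nA}(\mathcal E)$ (they depend on the presentation). **Theorem.** Let $R$ be a non-Archimedean Banach ring (for instance a complete non-Archimedean valuation ring). The symmetric monoidal categories $\mathrm{Ind}(\mathrm{Ban}^A_R)$ and $\mathrm{Ind}(\mathrm{Ban}^{nA}_R)$ are closed, and the functor $$\iota:\mathrm{Ind}(\mathrm{Ban}^{nA}_R)\to\mathrm{Ind}(\mathrm{Ban}^A_R)$$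 has a left adjoint $\pi$ such that: 1. *(monoidal)* $\pi$ is a strong symmetric monoidal functor: there are natural isomorphisms $\pi(U)\overline\otimes\pi(V)\cong\pi(U\overline\otimes V)$ and $\pi(R)\cong R$, compatible with the associativity, unit and symmetry constraints, and they correspond under the adjunction to the canonical maps $\iota(M)\overline\otimes\iota(N)\to\iota(M\overline\otimes N)$ (for $M,N\in\mathrm{Ban}^{nA}_R$ induced by $m\otimes n\mapsto m\otimes n$) and $R\to\iota(R)$. 2. *(closed)* For all $\mathcal E\in\mathrm{Ind}(\mathrm{Ban}^A_R)$ and $F\in\mathrm{Ind}(\mathrm{Ban}^{nA}_R)$ the canonical map $\iota\,\underline{\mathrm{Hom}}(\pi(\mathcal E),F)\to\underline{\mathrm{Hom}}(\mathcal E,\iota(F))$ is an isomorphism. 3. *(explicit construction)* Let $\mathcal E=``\mathrm{colim}"_{i\in I}V_i$ be given by a small filtered system in $\mathrm{Ban}^A_R$. Then $\kappa_{\mathcal E}$ has a kernel $j:\mathcal K\to P^A(\mathcal E)$, and for every presentation of $\mathcal K$ by a small filtered system: $\kappa_{\mathcal E}$ is a cokernel of $j\circ\kappa_{\mathcal K}:P^A(\mathcal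 K)\to P^A(\mathcal E)$; there is a unique $d:P^{nA}(\mathcal K)\to P^{nA}(\mathcal E)$ with $\iota(d)\circ c_{\mathcal K}=c_{\mathcal E}\circ j\circ\kappa_{\mathcal K}$; and there is a morphism $q:P^{nA}(\mathcal E)\to\pi(\mathcal E)$ with $\iota(q)\circ c_{\mathcal E}=\eta_{\mathcal E}\circ\kappa_{\mathcal E}$ ($\eta$ the unit of the adjunction) which is a cokernel of $d$. Thus $$\mathcal E\cong\mathrm{coker}[P^A(\ker\kappa_{\mathcal E})\to P^A(\mathcal E)],\qquad \pi(\mathcal E)\cong\mathrm{coker}[P^{nA}(\ker\kappa_{\mathcal E})\to P^{nA}(\mathcal E)].$$ -/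

import Mathlib

universe v u w

set_option linter.unusedSectionVars false

noncomputable section

namespace IndTensor
open CategoryTheory Limits MonoidalCategory Opposite

variable {C : Type u} [Category.{v} C]

variable {X Y Z : Cᵒᵖ ⥤ Type v} (P : IndObjectPresentation X) (Q : IndObjectPresentation Y)

lemma exists_rep (a : Cᵒᵖ) (x : X.obj a) : ∃ (i : P.I) (f : a.unop ⟶ P.F.obj i),
    (P.ι.app i).app a f = x := by
  obtain ⟨i, f, hf⟩ := Types.jointly_surjective_of_isColimit
    (isColimitOfPreserves ((evaluation Cᵒᵖ (Type v)).obj a) P.isColimit) x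
  exact ⟨i, f, hf⟩

lemma rep_eq {a : Cᵒᵖ} {i j : P.I} (f : a.unop ⟶ P.F.obj i) (g : a.unop ⟶ P.F.obj j)
    (h : (P.ι.app i).app a f = (P.ι.app j).app a g) :
    ∃ (k : P.I) (s : i ⟶ k) (t : j ⟶ k), f ≫ P.F.map s = g ≫ P.F.map t := by
  obtain ⟨k, s, t, hh⟩ := (Types.FilteredColimit.isColimit_eq_iff _
    (isColimitOfPreserves ((evaluation Cᵒᵖ (Type v)).obj a) P.isColimit)
    (xi := f) (xj := g)).1 h
  exact ⟨k, s, t, hh⟩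

lemma rep_map {a : Cᵒᵖ} {i j : P.I} (f : a.unop ⟶ P.F.obj i) (s : i ⟶ j) :
    (P.ι.app j).app a (f ≫ P.F.map s) = (P.ι.app i).app a f :=
  congrArg (fun t => t.app a f) (P.ι.naturality s)

lemma rep_pre {a b : Cᵒᵖ} {i : P.I} (f : a.unop ⟶ P.F.obj i) (s : a ⟶ b) :
    (P.ι.app i).app b (s.unop ≫ f) = X.map s ((P.ι.app i).app a f) :=
  congrArg (fun t => t f) ((P.ι.app i).naturality s)

variable [MonoidalCategory C]

/-- The filtered system `(i, j) ↦ X_i ⊗ Y_j` attached to filtered systems `X` and `Y`. -/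
abbrev system : P.I × Q.I ⥤ C := P.F.prod Q.F ⋙ tensor C

variable (ζ : system P Q ⋙ yoneda ⟶ (Functor.const _).obj Z)

/-- The presentation of `Z` by the system `(i, j) ↦ X_i ⊗ Y_j`. -/
abbrev pres (hζ : IsColimit (Cocone.mk Z ζ)) : IndObjectPresentation Z where
  I := P.I × Q.I
  F := system P Q
  ι := ζ
  isColimit := hζ

/-- The pairing `X(a) × Y(b) → Z(a ⊗ b)` induced by tensoring representatives. -/
def pair (a b : Cᵒᵖ) (x : X.obj a) (y : Y.obj b) : Z.obj (a ⊗ b) :=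
  (ζ.app ((exists_rep P a x).choose, (exists_rep Q b y).choose)).app (a ⊗ b)
    ((exists_rep P a x).choose_spec.choose ⊗ₘ (exists_rep Q b y).choose_spec.choose)

lemma pair_rep (hζ : IsColimit (Cocone.mk Z ζ)) (a b : Cᵒᵖ) {i : P.I} {j : Q.I} (f : a.unop ⟶ P.F.obj i) (g : b.unop ⟶ Q.F.obj j) :
    pair P Q ζ a b ((P.ι.app i).app a f) ((Q.ι.app j).app b g) =
      (ζ.app (i, j)).app (a ⊗ b) (f ⊗ₘ g) := by
  unfold pair
  obtain ⟨k, s, t, h⟩ := rep_eq P _ _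
    (exists_rep P a ((P.ι.app i).app a f)).choose_spec.choose_spec
  obtain ⟨k', s', t', h'⟩ := rep_eq Q _ _
    (exists_rep Q b ((Q.ι.app j).app b g)).choose_spec.choose_spec
  have e1 := rep_map (pres P Q ζ hζ) (a := a ⊗ b)
    (i := ((exists_rep P a ((P.ι.app i).app a f)).choose,
      (exists_rep Q b ((Q.ι.app j).app b g)).choose)) (j := (k, k'))
    ((exists_rep P a ((P.ι.app i).app a f)).choose_spec.choose ⊗ₘ
      (exists_rep Q b ((Q.ι.app j).app b g)).choose_spec.choose) (s, s')
  have e2 := rep_map (pres P Q ζ hζ) (a := a ⊗ b) (i := (i, j)) (j := (k, k'))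
    (f ⊗ₘ g) (t, t')
  refine e1.symm.trans (Eq.trans ?_ e2)
  congr 1
  dsimp
  rw [MonoidalCategory.tensorHom_comp_tensorHom, MonoidalCategory.tensorHom_comp_tensorHom, h, h']

open scoped ExternalProduct


lemma pair_map (hζ : IsColimit (Cocone.mk Z ζ)) {a b a' b' : Cᵒᵖ} (s : a ⟶ a') (t : b ⟶ b')
    (x : X.obj a) (y : Y.obj b) :
    pair P Q ζ a' b' (X.map s x) (Y.map t y) = Z.map (s ⊗ₘ t) (pair P Q ζ a b x y) := by
  obtain ⟨i, f, rfl⟩ := exists_rep P a x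
  obtain ⟨j, g, rfl⟩ := exists_rep Q b y
  rw [← rep_pre, ← rep_pre, pair_rep P Q ζ hζ, pair_rep P Q ζ hζ]
  refine Eq.trans ?_ (rep_pre (pres P Q ζ hζ) (i := (i, j)) (f ⊗ₘ g) (s ⊗ₘ t))
  congr 1
  simp [MonoidalCategory.tensorHom_comp_tensorHom]

/-- The pairing as a natural transformation. -/
def unit (hζ : IsColimit (Cocone.mk Z ζ)) : X ⊠ Y ⟶ tensor Cᵒᵖ ⋙ Z where
  app p := ↾(fun xy => pair P Q ζ p.1 p.2 xy.1 xy.2)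
  naturality := by
    rintro ⟨a, b⟩ ⟨a', b'⟩ ⟨s, t⟩
    ext ⟨x, y⟩
    exact pair_map P Q ζ hζ s t x y

section desc
variable (hζ : IsColimit (Cocone.mk Z ζ)) (c : Cᵒᵖ)
    (s : Cocone (CostructuredArrow.proj (tensor Cᵒᵖ) c ⋙ (X ⊠ Y)))

/-- The value of the induced map on an element of `Z(c)`. -/
def descFun (hζ : IsColimit (Cocone.mk Z ζ)) (z : Z.obj c) : s.pt :=
  s.ι.app (CostructuredArrow.mk (S := tensor Cᵒᵖ) (Y := (op (P.F.obj (exists_rep (pres P Q ζ hζ) c z).choose.1),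
    op (Q.F.obj (exists_rep (pres P Q ζ hζ) c z).choose.2)))
    (exists_rep (pres P Q ζ hζ) c z).choose_spec.choose.op)
    ((P.ι.app (exists_rep (pres P Q ζ hζ) c z).choose.1).app _ (𝟙 (P.F.obj _)),
     (Q.ι.app (exists_rep (pres P Q ζ hζ) c z).choose.2).app _ (𝟙 (Q.F.obj _)))

lemma cocone_map {a b a' b' : Cᵒᵖ} (f : a ⟶ a') (g : b ⟶ b') (h : a' ⊗ b' ⟶ c)
    (x : X.obj a) (y : Y.obj b) :
    s.ι.app (CostructuredArrow.mk (S := tensor Cᵒᵖ) (Y := (a', b')) h) (X.map f x, Y.map g y) =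
    s.ι.app (CostructuredArrow.mk (S := tensor Cᵒᵖ) (Y := (a, b)) ((f ⊗ₘ g) ≫ h)) (x, y) :=
  congrArg (fun t => t (x, y)) (s.ι.naturality
    (CostructuredArrow.homMk' (CostructuredArrow.mk (S := tensor Cᵒᵖ) (Y := (a', b')) h)
      (show (a, b) ⟶ (a', b') from Prod.mkHom f g)))

/-- The universal element of `X` at the stage `i`. -/
abbrev elt (i : P.I) : X.obj (op (P.F.obj i)) := (P.ι.app i).app (op (P.F.obj i)) (𝟙 (P.F.obj i))

lemma map_elt {a : Cᵒᵖ} {i : P.I} (f : a.unop ⟶ P.F.obj i) :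
    X.map (Quiver.Hom.op f) (elt P i) = (P.ι.app i).app a f := by
  refine (rep_pre P (a := op (P.F.obj i)) (b := a) (𝟙 (P.F.obj i)) f.op).symm.trans ?_
  congr 1
  exact Category.comp_id f

lemma map_elt' {i k : P.I} (f : i ⟶ k) :
    X.map (P.F.map f).op (elt P k) = elt P i := by
  refine (map_elt P (a := op (P.F.obj i)) (P.F.map f)).trans ?_
  refine Eq.trans ?_ (rep_map P (a := op (P.F.obj i)) (𝟙 (P.F.obj i)) f)
  congr 1
  exact (Category.id_comp _).symm

lemma descFun_rep (hζ : IsColimit (Cocone.mk Z ζ)) {i : P.I} {j : Q.I}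
    (h : c.unop ⟶ P.F.obj i ⊗ Q.F.obj j) :
    descFun P Q ζ c s hζ ((ζ.app (i, j)).app c h) =
      s.ι.app (CostructuredArrow.mk (S := tensor Cᵒᵖ)
        (Y := (op (P.F.obj i), op (Q.F.obj j))) h.op) (elt P i, elt Q j) := by
  obtain ⟨⟨k, k'⟩, ⟨u, u'⟩, ⟨t, t'⟩, e⟩ := rep_eq (pres P Q ζ hζ) _ _
    (exists_rep (pres P Q ζ hζ) c ((ζ.app (i, j)).app c h)).choose_spec.choose_spec
  have key : ∀ {i k : P.I} {j k' : Q.I} (t : i ⟶ k) (t' : j ⟶ k')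
      (h : c.unop ⟶ P.F.obj i ⊗ Q.F.obj j),
      s.ι.app (CostructuredArrow.mk (S := tensor Cᵒᵖ)
        (Y := (op (P.F.obj i), op (Q.F.obj j))) h.op) (elt P i, elt Q j) =
      s.ι.app (CostructuredArrow.mk (S := tensor Cᵒᵖ)
        (Y := (op (P.F.obj k), op (Q.F.obj k'))) (h ≫ (P.F.map t ⊗ₘ Q.F.map t')).op)
          (elt P k, elt Q k') := by
    intro i k j k' t t' h
    rw [← map_elt' P t, ← map_elt' Q t']
    exact cocone_map c s (P.F.map t).op (Q.F.map t').op h.op (elt P k) (elt Q k')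
  unfold descFun
  refine (key u u' _).trans (Eq.trans ?_ (key t t' h).symm)
  exact congrArg (fun q => s.ι.app (CostructuredArrow.mk (S := tensor Cᵒᵖ)
    (Y := (op (P.F.obj k), op (Q.F.obj k'))) (Quiver.Hom.op q)) (elt P k, elt Q k')) e

/-- The natural pairing exhibits `Z` as the Day convolution of `X` and `Y`. -/
def isPointwise (hζ : IsColimit (Cocone.mk Z ζ)) :
    (Functor.LeftExtension.mk Z (unit P Q ζ hζ)).IsPointwiseLeftKanExtension := fun c =>
  { desc := fun s => ↾(descFun P Q ζ c s hζ)
    fac := by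
      rintro s ⟨⟨a, b⟩, ⟨⟩, h⟩
      ext ⟨x, y⟩
      obtain ⟨i, f, rfl⟩ := exists_rep P a x
      obtain ⟨j, g, rfl⟩ := exists_rep Q b y
      refine (congrArg (descFun P Q ζ c s hζ) ((congrArg (Z.map h) (pair_rep P Q ζ hζ a b f g)).trans
        (rep_pre (pres P Q ζ hζ) (i := (i, j)) (f ⊗ₘ g) h).symm)).trans ?_
      refine (descFun_rep P Q ζ c s hζ _).trans ?_
      refine (cocone_map c s f.op g.op h _ _).symm.trans ?_
      rw [map_elt, map_elt]
      rfl
    uniq := by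
      intro s m hm
      ext z
      obtain ⟨⟨i, j⟩, h, rfl⟩ := exists_rep (pres P Q ζ hζ) c z
      refine Eq.trans ?_ (descFun_rep P Q ζ c s hζ h).symm
      rw [← hm]
      refine congrArg m ?_
      refine Eq.trans ?_ (congrArg (Z.map (Quiver.Hom.op h)) (pair_rep P Q ζ hζ _ _ (𝟙 _) (𝟙 _)).symm)
      refine Eq.trans ?_ (rep_pre (pres P Q ζ hζ) (i := (i, j)) (a := op _) _ (Quiver.Hom.op h))
      congr 1
      simp }
end desc
end IndTensor

namespace IndTensor
open CategoryTheory Limits MonoidalCategory Opposite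
open scoped ExternalProduct
variable {C : Type u} [Category.{v} C] [MonoidalCategory C]

/-- The tensor product of ind-objects: the formal colimit of the system `X_i ⊗ Y_j`, for the chosen
presentations of `X` and `Y` as formal filtered colimits. -/
def tensorObj (X Y : Ind C) : Ind C :=
  (Ind.lim (X.presentation.I × Y.presentation.I)).obj (system X.presentation Y.presentation)

/-- The tensor product of ind-objects as a colimit of representable presheaves. -/
def tensorCocone (X Y : Ind C) : system X.presentation Y.presentation ⋙ yoneda ⟶
    (Functor.const _).obj ((Ind.inclusion C).obj (tensorObj X Y)) :=
  ((colimit.cocone (system X.presentation Y.presentation ⋙ yoneda)).extend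
    (Ind.limCompInclusion.symm.app (system X.presentation Y.presentation)).hom).ι

def tensorCoconeIsColimit (X Y : Ind C) : IsColimit (Cocone.mk _ (tensorCocone X Y)) :=
  (colimit.isColimit (system X.presentation Y.presentation ⋙ yoneda)).extendIso
    (Ind.limCompInclusion.symm.app (system X.presentation Y.presentation)).hom

/-- The tensor product of ind-objects is the Day convolution of the underlying presheaves. -/
@[reducible]
def dayConvolution (X Y : Ind C) :
    DayConvolution ((Ind.inclusion C).obj X) ((Ind.inclusion C).obj Y) where
  convolution := (Ind.inclusion C).obj (tensorObj X Y)
  unit := unit X.presentation Y.presentation (tensorCocone X Y) (tensorCoconeIsColimit X Y)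
  isPointwiseLeftKanExtensionUnit := isPointwise _ _ _ _


lemma inv_unit_eq {c : Cᵒᵖ} (f : c.unop ⟶ MonoidalCategoryStruct.tensorUnit C) :
    ((Ind.inclusion C).obj (Ind.yoneda.obj (MonoidalCategoryStruct.tensorUnit C))).map (Quiver.Hom.op f)
      ((Ind.yonedaCompInclusion.inv.app (MonoidalCategoryStruct.tensorUnit C)).app (op (MonoidalCategoryStruct.tensorUnit C)) (𝟙 (MonoidalCategoryStruct.tensorUnit C))) =
    (Ind.yonedaCompInclusion.inv.app (MonoidalCategoryStruct.tensorUnit C)).app c f := by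
  refine (congrArg (fun t => t (𝟙 (MonoidalCategoryStruct.tensorUnit C)))
    ((Ind.yonedaCompInclusion.inv.app (MonoidalCategoryStruct.tensorUnit C)).naturality (Quiver.Hom.op f))).symm.trans ?_
  exact congrArg ((Ind.yonedaCompInclusion.inv.app (MonoidalCategoryStruct.tensorUnit C)).app c) (Category.comp_id f)

lemma hom_inv_apply {c : Cᵒᵖ} (z : ((Ind.inclusion C).obj (Ind.yoneda.obj (MonoidalCategoryStruct.tensorUnit C))).obj c) :
    (Ind.yonedaCompInclusion.inv.app (MonoidalCategoryStruct.tensorUnit C)).app c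
      ((Ind.yonedaCompInclusion.hom.app (MonoidalCategoryStruct.tensorUnit C)).app c z) = z :=
  congrArg (fun t => t.app c z) (Ind.yonedaCompInclusion.hom_inv_id_app (MonoidalCategoryStruct.tensorUnit C))

lemma inv_hom_apply {c : Cᵒᵖ} (f : c.unop ⟶ MonoidalCategoryStruct.tensorUnit C) :
    (Ind.yonedaCompInclusion.hom.app (MonoidalCategoryStruct.tensorUnit C)).app c
      ((Ind.yonedaCompInclusion.inv.app (MonoidalCategoryStruct.tensorUnit C)).app c f) = f :=
  congrArg (fun t => t.app c f) (Ind.yonedaCompInclusion.inv_hom_id_app (MonoidalCategoryStruct.tensorUnit C))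

/-- The unit of the tensor product of ind-objects is the image of the unit of `C`. -/
@[reducible]
def dayConvolutionUnit : DayConvolutionUnit ((Ind.inclusion C).obj (Ind.yoneda.obj (MonoidalCategoryStruct.tensorUnit C))) where
  can := ↾(fun _ => (Ind.yonedaCompInclusion.inv.app (MonoidalCategoryStruct.tensorUnit C)).app (op (MonoidalCategoryStruct.tensorUnit C)) (𝟙 (MonoidalCategoryStruct.tensorUnit C)))
  isPointwiseLeftKanExtensionCan := fun c =>
    { desc := fun s => ↾(fun z => s.ι.app (CostructuredArrow.mk
        (S := Functor.fromPUnit.{0} (MonoidalCategoryStruct.tensorUnit Cᵒᵖ)) (Y := ⟨⟨⟩⟩)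
          (((Ind.yonedaCompInclusion.hom.app (MonoidalCategoryStruct.tensorUnit C)).app c z : c.unop ⟶ MonoidalCategoryStruct.tensorUnit C).op)) PUnit.unit)
      fac := by
        rintro s ⟨⟨⟨⟩⟩, ⟨⟩, h⟩
        ext ⟨⟩
        have e := (congrArg ((Ind.yonedaCompInclusion.hom.app (MonoidalCategoryStruct.tensorUnit C)).app c)
          (inv_unit_eq h.unop)).trans (inv_hom_apply h.unop)
        exact congrArg (fun q => s.ι.app (CostructuredArrow.mk
          (S := Functor.fromPUnit.{0} (MonoidalCategoryStruct.tensorUnit Cᵒᵖ)) (Y := ⟨⟨⟩⟩) (Quiver.Hom.op q)) PUnit.unit) e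
      uniq := by
        intro s m hm
        ext z
        have e := congrArg (fun t => t PUnit.unit) (hm (CostructuredArrow.mk
          (S := Functor.fromPUnit.{0} (MonoidalCategoryStruct.tensorUnit Cᵒᵖ)) (Y := ⟨⟨⟩⟩)
            (((Ind.yonedaCompInclusion.hom.app (MonoidalCategoryStruct.tensorUnit C)).app c z : c.unop ⟶ MonoidalCategoryStruct.tensorUnit C).op)))
        exact (congrArg m ((inv_unit_eq _).trans (hom_inv_apply z))).symm.trans e }

/-- The data defining the monoidal structure on ind-objects. -/
@[reducible]
def core : InducedLawfulDayConvolutionMonoidalCategoryStructCore Cᵒᵖ (Type v) (Ind C) where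
  ι := Ind.inclusion C
  fullyFaithulι := Ind.inclusion.fullyFaithful
  tensorObj := tensorObj
  convolutions' := dayConvolution
  tensorObjIsoConvolution _ _ := Iso.refl _
  tensorUnit := Ind.yoneda.obj (MonoidalCategoryStruct.tensorUnit C)
  tensorUnitConvolutionUnit := dayConvolutionUnit

@[reducible]
def monoidalStruct : MonoidalCategoryStruct (Ind C) :=
  letI := core (C := C)
  InducedLawfulDayConvolutionMonoidalCategoryStructCore.mkMonoidalCategoryStruct Cᵒᵖ (Type v) (Ind C)

@[reducible]
def lawful : letI := monoidalStruct (C := C)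
    LawfulDayConvolutionMonoidalCategoryStruct Cᵒᵖ (Type v) (Ind C) :=
  letI := core (C := C)
  InducedLawfulDayConvolutionMonoidalCategoryStructCore.mkLawfulDayConvolutionMonoidalCategoryStruct
    Cᵒᵖ (Type v) (Ind C)

instance monoidal : MonoidalCategory (Ind C) :=
  letI := monoidalStruct (C := C)
  letI := lawful (C := C)
  monoidalOfLawfulDayConvolutionMonoidalCategoryStruct Cᵒᵖ (Type v) (Ind C)

instance lawfulDay : LawfulDayConvolutionMonoidalCategoryStruct Cᵒᵖ (Type v) (Ind C) :=
  lawful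

end IndTensor

namespace IndTensor
open CategoryTheory Limits MonoidalCategory Opposite
open LawfulDayConvolutionMonoidalCategoryStruct
section
variable {C : Type*} [Category* C] [MonoidalCategory C] [SymmetricCategory C]
  {V : Type*} [Category* V] [MonoidalCategory V] [SymmetricCategory V]
  {D : Type*} [Category* D] [MonoidalCategory D]
  [LawfulDayConvolutionMonoidalCategoryStruct C V D] (ff : (ι C V D).FullyFaithful)
  [∀ (v : V) (d : C),
    PreservesColimitsOfShape (CostructuredArrow (tensor C) d) (tensorLeft v)]
  [∀ (v : V) (d : C),
    PreservesColimitsOfShape (CostructuredArrow (tensor C) d) (tensorRight v)]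
attribute [local instance] convolution convolution₂' convolution₂

/-- The braiding of Day convolutions. -/
def braid (X Y : D) : X ⊗ Y ≅ Y ⊗ X :=
  ff.preimageIso (DayConvolution.braiding ((ι C V D).obj X) ((ι C V D).obj Y))

lemma map_braid (X Y : D) : (ι C V D).map (braid ff X Y).hom =
   (DayConvolution.braiding ((ι C V D).obj X) ((ι C V D).obj Y)).hom :=
  ff.map_preimage _

lemma map_whiskerLeft (X : D) {Y Z : D} (f : Y ⟶ Z) : (ι C V D).map (X ◁ f) =
    DayConvolution.map (𝟙 ((ι C V D).obj X)) ((ι C V D).map f) := by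
  rw [← id_tensorHom, ι_map_tensorHom_hom_eq_tensorHom, CategoryTheory.Functor.map_id]

lemma map_whiskerRight {Y Z : D} (f : Y ⟶ Z) (X : D) : (ι C V D).map (f ▷ X) =
    DayConvolution.map ((ι C V D).map f) (𝟙 ((ι C V D).obj X)) := by
  rw [← tensorHom_id, ι_map_tensorHom_hom_eq_tensorHom, CategoryTheory.Functor.map_id]

lemma map_associator_inv (X Y Z : D) : (ι C V D).map (α_ X Y Z).inv = (DayConvolution.associator
      ((ι C V D).obj X) ((ι C V D).obj Y) ((ι C V D).obj Z)).inv := by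
  rw [← cancel_epi ((ι C V D).map (α_ X Y Z).hom), ← Functor.map_comp, Iso.hom_inv_id,
    ι_map_associator_hom_eq_associator_hom, CategoryTheory.Functor.map_id]
  exact (Iso.hom_inv_id _).symm

/-- A symmetric monoidal structure from Day convolution. -/
@[reducible]
def symmetricOfLawful : SymmetricCategory D where
  braiding := braid ff
  braiding_naturality_right X Y Z f := by
    apply Functor.Faithful.map_injective (F := ι C V D)
    rw [Functor.map_comp, Functor.map_comp, map_braid, map_braid, map_whiskerLeft,
      map_whiskerRight]
    exact DayConvolution.braiding_naturality_right ((ι C V D).obj X) ((ι C V D).map f)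
  braiding_naturality_left {X Y} f Z := by
    apply Functor.Faithful.map_injective (F := ι C V D)
    rw [Functor.map_comp, Functor.map_comp, map_braid, map_braid, map_whiskerLeft,
      map_whiskerRight]
    exact DayConvolution.braiding_naturality_left ((ι C V D).map f) ((ι C V D).obj Z)
  hexagon_forward X Y Z := by
    apply Functor.Faithful.map_injective (F := ι C V D)
    simp only [Functor.map_comp]
    rw [map_braid ff X (Y ⊗ Z), map_whiskerRight, map_braid, map_whiskerLeft, map_braid,
      ι_map_associator_hom_eq_associator_hom, ι_map_associator_hom_eq_associator_hom,
      ι_map_associator_hom_eq_associator_hom]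
    exact DayConvolution.hexagon_forward ((ι C V D).obj X) ((ι C V D).obj Y) ((ι C V D).obj Z)
  hexagon_reverse X Y Z := by
    apply Functor.Faithful.map_injective (F := ι C V D)
    simp only [Functor.map_comp]
    rw [map_braid ff (X ⊗ Y) Z, map_whiskerLeft, map_braid, map_whiskerRight, map_braid,
      map_associator_inv, map_associator_inv, map_associator_inv]
    exact DayConvolution.hexagon_reverse ((ι C V D).obj X) ((ι C V D).obj Y) ((ι C V D).obj Z)
  symmetry X Y := by
    apply Functor.Faithful.map_injective (F := ι C V D)
    rw [Functor.map_comp, map_braid, map_braid, CategoryTheory.Functor.map_id]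
    exact DayConvolution.symmetry _ _
end

instance {C : Type u} [Category.{v} C] [MonoidalCategory C] [SymmetricCategory C] :
    SymmetricCategory Cᵒᵖ where
  symmetry _ _ := Quiver.Hom.unop_inj (SymmetricCategory.symmetry _ _)

instance symmetric {C : Type u} [Category.{v} C] [MonoidalCategory C] [SymmetricCategory C] :
    SymmetricCategory (Ind C) :=
  symmetricOfLawful (C := Cᵒᵖ) (V := Type v) Ind.inclusion.fullyFaithful
end IndTensor

section
open scoped NNReal TensorProduct


/-- A Banach ring: a commutative ring, complete for a norm which is submultiplicative up to a
constant. -/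
class BanachRing (R : Type u) extends CommRing R, NormedAddCommGroup R, CompleteSpace R where
  exists_nnnorm_mul_le : ∃ C : ℝ≥0, ∀ a b : R, ‖a * b‖₊ ≤ C * (‖a‖₊ * ‖b‖₊)

/-- The two flavours of Banach modules: Archimedean and non-Archimedean. -/
inductive Flavour
  | arch
  | nonArch

namespace Flavour

/-- The binary operation in the triangle inequality: `a + b` or `max a b`. -/
def join : Flavour → ℝ≥0 → ℝ≥0 → ℝ≥0
  | arch, a, b => a + b
  | nonArch, a, b => max a b

/-- The aggregate of a finite family of non-negative reals: its sum or its supremum. -/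
def agg : Flavour → Multiset ℝ≥0 → ℝ≥0
  | arch, s => s.sum
  | nonArch, s => s.sup

variable (k : Flavour)

lemma join_le_add (a b : ℝ≥0) : k.join a b ≤ a + b := by
  cases k <;> simp [join]

lemma join_mono {a b c d : ℝ≥0} (h : a ≤ c) (h' : b ≤ d) : k.join a b ≤ k.join c d := by
  cases k
  · exact add_le_add h h'
  · exact max_le_max h h'

lemma continuous_join : Continuous fun p : ℝ≥0 × ℝ≥0 => k.join p.1 p.2 := by
  cases k
  · exact continuous_add
  · exact continuous_fst.max continuous_snd

lemma mul_join (a b c : ℝ≥0) : a * k.join b c = k.join (a * b) (a * c) := by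
  cases k
  · exact mul_add a b c
  · exact mul_max_of_nonneg b c (zero_le (a := a))

@[simp] lemma agg_zero : k.agg 0 = 0 := by
  cases k <;> simp [agg]

@[simp] lemma agg_cons (a : ℝ≥0) (s : Multiset ℝ≥0) :
    k.agg (a ::ₘ s) = k.join a (k.agg s) := by
  cases k <;> simp [agg, join]

lemma agg_add (s t : Multiset ℝ≥0) : k.agg (s + t) = k.join (k.agg s) (k.agg t) := by
  cases k <;> simp [agg, join]

@[simp] lemma join_zero (a : ℝ≥0) : k.join a 0 = a := by
  cases k <;> simp [join]

lemma agg_singleton (a : ℝ≥0) : k.agg {a} = a := by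
  cases k <;> simp [agg]

lemma agg_mul {ι : Type*} (s : Multiset ι) (c : ℝ≥0) (f : ι → ℝ≥0) :
    k.agg (s.map fun i => c * f i) = c * k.agg (s.map f) := by
  induction s using Multiset.induction with
  | empty => simp
  | cons a s ih => simp [ih, mul_join]

lemma agg_mono {ι : Type*} (s : Multiset ι) (f g : ι → ℝ≥0) (h : ∀ i, f i ≤ g i) :
    k.agg (s.map f) ≤ k.agg (s.map g) := by
  induction s using Multiset.induction with
  | empty => simp
  | cons a s ih => simpa using k.join_mono (h a) ih

end Flavour

/-- The triangle inequality of the given flavour. -/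
class FlavouredNorm (k : Flavour) (V : Type u) [SeminormedAddCommGroup V] : Prop where
  nnnorm_add_le_join (k) : ∀ x y : V, ‖x + y‖₊ ≤ k.join ‖x‖₊ ‖y‖₊

/-- The scalar multiplication is bounded: `‖a m‖ ≤ C |a| ‖m‖` for some constant `C`. -/
class BoundedScalars (R : Type u) [BanachRing R] (V : Type u) [SeminormedAddCommGroup V]
    [Module R V] : Prop where
  exists_nnnorm_smul_le (R V) : ∃ C : ℝ≥0, ∀ (a : R) (m : V), ‖a • m‖₊ ≤ C * (‖a‖₊ * ‖m‖₊)

lemma nnnorm_sum_le_agg (k : Flavour) {V : Type u} [SeminormedAddCommGroup V] [FlavouredNorm k V]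
    (s : Multiset V) : ‖s.sum‖₊ ≤ k.agg (s.map fun m => ‖m‖₊) := by
  induction s using Multiset.induction with
  | empty => simp
  | cons a s ih =>
    simpa using (FlavouredNorm.nnnorm_add_le_join k a s.sum).trans (k.join_mono le_rfl ih)

instance {R : Type u} [BanachRing R] (V : Type u) [SeminormedAddCommGroup V] [Module R V]
    [BoundedScalars R V] : UniformContinuousConstSMul R V where
  uniformContinuous_const_smul a := by
    obtain ⟨C, hC⟩ := BoundedScalars.exists_nnnorm_smul_le R V
    refine (LipschitzWith.of_dist_le_mul (K := C * ‖a‖₊) fun x y => ?_).uniformContinuous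
    rw [dist_eq_norm, dist_eq_norm, ← smul_sub]
    have := hC a (x - y)
    rw [← mul_assoc] at this
    exact_mod_cast this

instance {R : Type u} [BanachRing R] : BoundedScalars R R where
  exists_nnnorm_smul_le := BanachRing.exists_nnnorm_mul_le

instance {R : Type u} [BanachRing R] [IsUltrametricDist R] (k : Flavour) :
    FlavouredNorm k R where
  nnnorm_add_le_join x y := by
    cases k
    · exact nnnorm_add_le x y
    · exact IsUltrametricDist.nnnorm_add_le_max x y

section completion
open UniformSpace
variable {R : Type u} [BanachRing R] (V : Type u) [SeminormedAddCommGroup V] [Module R V]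
    [BoundedScalars R V]

instance : BoundedScalars R (Completion V) where
  exists_nnnorm_smul_le := by
    obtain ⟨C, hC⟩ := BoundedScalars.exists_nnnorm_smul_le R V
    refine ⟨C, fun a m => ?_⟩
    refine Completion.induction_on m ?_ fun m => ?_
    · exact isClosed_le (continuous_nnnorm.comp (continuous_const_smul a))
        (continuous_const.mul (continuous_const.mul continuous_nnnorm))
    · rw [← Completion.coe_smul, Completion.nnnorm_coe, Completion.nnnorm_coe]
      exact hC a m

instance (k : Flavour) [FlavouredNorm k V] : FlavouredNorm k (Completion V) where
  nnnorm_add_le_join x y := by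
    refine Completion.induction_on₂ x y ?_ fun x y => ?_
    · exact isClosed_le (continuous_nnnorm.comp continuous_add) (k.continuous_join.comp
        ((continuous_nnnorm.comp continuous_fst).prodMk (continuous_nnnorm.comp continuous_snd)))
    · rw [← Completion.coe_add]
      simp only [Completion.nnnorm_coe]
      exact FlavouredNorm.nnnorm_add_le_join k x y
end completion

/-- Banach modules over `R` of the given flavour. -/
structure Ban (R : Type u) [BanachRing R] (k : Flavour) : Type (u + 1) where
  carrier : Type u
  [group : NormedAddCommGroup carrier]
  [module : Module R carrier]
  [complete : CompleteSpace carrier]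
  [scalars : BoundedScalars R carrier]
  [flavour : FlavouredNorm k carrier]


namespace Ban
open CategoryTheory UniformSpace
variable {R : Type u} [BanachRing R] {k : Flavour}

instance : CoeSort (Ban R k) (Type u) := ⟨Ban.carrier⟩
instance (M : Ban R k) : NormedAddCommGroup M := M.group
instance (M : Ban R k) : Module R M := M.module
instance (M : Ban R k) : CompleteSpace M := M.complete
instance (M : Ban R k) : BoundedScalars R M := M.scalars
instance (M : Ban R k) : FlavouredNorm k M := M.flavour

/-- Bounded `R`-linear maps. -/
@[ext]
structure Hom (M N : Ban R k) where
  lin : M →ₗ[R] N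
  bounded : ∃ C : ℝ≥0, ∀ m : M, ‖lin m‖₊ ≤ C * ‖m‖₊

instance : Category (Ban R k) where
  Hom := Hom
  id M := ⟨LinearMap.id, 1, fun m => by simp⟩
  comp f g := ⟨g.lin.comp f.lin, by
    obtain ⟨C, hC⟩ := f.bounded
    obtain ⟨D, hD⟩ := g.bounded
    refine ⟨D * C, fun m => (hD _).trans ?_⟩
    rw [mul_assoc]
    gcongr
    exact hC m⟩

lemma hom_ext {M N : Ban R k} {f g : M ⟶ N} (h : ∀ m, f.lin m = g.lin m) : f = g :=
  Hom.ext (LinearMap.ext h)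

@[simp] lemma id_lin {M : Ban R k} (m : M) : Hom.lin (𝟙 M) m = m := rfl

@[simp] lemma comp_lin {M N P : Ban R k} (f : M ⟶ N) (g : N ⟶ P) (m : M) :
    (f ≫ g).lin m = g.lin (f.lin m) := rfl

lemma Hom.continuous {M N : Ban R k} (f : M ⟶ N) : Continuous f.lin := by
  obtain ⟨C, hC⟩ := f.bounded
  exact AddMonoidHomClass.continuous_of_bound f.lin C fun m => by exact_mod_cast hC m

section extend
variable {V : Type u} [SeminormedAddCommGroup V] [Module R V] [BoundedScalars R V]

/-- The completion of a seminormed module. -/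

def completion (k : Flavour) (V : Type u) [SeminormedAddCommGroup V] [Module R V]
    [BoundedScalars R V] [FlavouredNorm k V] : Ban R k where
  carrier := Completion V

variable (k V) in
/-- The canonical map from a seminormed module to its completion. -/
def toCompletion [FlavouredNorm k V] : V →ₗ[R] (completion k V : Ban R k) where
  toFun v := (v : Completion V)
  map_add' := Completion.coe_add
  map_smul' := Completion.coe_smul

lemma uniformContinuous_of_bound {N : Ban R k} (f : V →ₗ[R] N)
    (h : ∃ C : ℝ≥0, ∀ v, ‖f v‖₊ ≤ C * ‖v‖₊) : UniformContinuous f := by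
  obtain ⟨C, hC⟩ := h
  exact AddMonoidHomClass.uniformContinuous_of_bound f C fun m => by exact_mod_cast hC m

lemma extension_add {N : Ban R k} (f : V →ₗ[R] N) (h : ∃ C : ℝ≥0, ∀ v, ‖f v‖₊ ≤ C * ‖v‖₊)
    (x y : Completion V) : Completion.extension f (x + y) =
      Completion.extension f x + Completion.extension f y := by
  refine Completion.induction_on₂ x y (isClosed_eq
    (Completion.continuous_extension.comp continuous_add)
    ((Completion.continuous_extension.comp continuous_fst).add
      (Completion.continuous_extension.comp continuous_snd))) fun x y => ?_
  have hu := uniformContinuous_of_bound f h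
  rw [← Completion.coe_add, Completion.extension_coe hu, Completion.extension_coe hu,
    Completion.extension_coe hu, map_add]

lemma extension_smul {N : Ban R k} (f : V →ₗ[R] N) (h : ∃ C : ℝ≥0, ∀ v, ‖f v‖₊ ≤ C * ‖v‖₊)
    (c : R) (x : Completion V) :
    Completion.extension f (c • x) = c • Completion.extension f x := by
  refine Completion.induction_on x (isClosed_eq
    (Completion.continuous_extension.comp (continuous_const_smul c))
    ((continuous_const_smul c).comp Completion.continuous_extension)) fun x => ?_
  have hu := uniformContinuous_of_bound f h
  rw [← Completion.coe_smul, Completion.extension_coe hu, Completion.extension_coe hu, map_smul]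

/-- The extension of a bounded linear map to the completion. -/
def extend [FlavouredNorm k V] (N : Ban R k) (f : V →ₗ[R] N)
    (h : ∃ C : ℝ≥0, ∀ v, ‖f v‖₊ ≤ C * ‖v‖₊) : completion k V ⟶ N where
  lin :=
    { toFun := Completion.extension f
      map_add' := extension_add f h
      map_smul' := extension_smul f h }
  bounded := by
    obtain ⟨C, hC⟩ := h
    refine ⟨C, fun m => ?_⟩
    refine Completion.induction_on m ?_ fun m => ?_
    · exact isClosed_le (continuous_nnnorm.comp Completion.continuous_extension)
        (continuous_const.mul continuous_nnnorm)
    · refine (le_of_eq ?_).trans ((hC m).trans (le_of_eq ?_))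
      · exact congrArg _ (Completion.extension_coe (uniformContinuous_of_bound f ⟨C, hC⟩) m)
      · exact congrArg (C * ·) (Completion.nnnorm_coe m).symm

lemma extend_coe [FlavouredNorm k V] (N : Ban R k) (f : V →ₗ[R] N)
    (h : ∃ C : ℝ≥0, ∀ v, ‖f v‖₊ ≤ C * ‖v‖₊) (v : V) :
    (extend N f h).lin (v : Completion V) = f v :=
  Completion.extension_coe (uniformContinuous_of_bound f h) v

lemma extend_bound [FlavouredNorm k V] (N : Ban R k) (f : V →ₗ[R] N)
    (h : ∃ C : ℝ≥0, ∀ v, ‖f v‖₊ ≤ C * ‖v‖₊) {C : ℝ≥0} (hC : ∀ v, ‖f v‖₊ ≤ C * ‖v‖₊)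
    (x : completion k V) : ‖(extend N f h).lin x‖₊ ≤ C * ‖x‖₊ := by
  refine Completion.induction_on x ?_ fun m => ?_
  · exact isClosed_le (continuous_nnnorm.comp (Hom.continuous _))
        (continuous_const.mul continuous_nnnorm)
  · refine (le_of_eq ?_).trans ((hC m).trans (le_of_eq ?_))
    · exact congrArg _ (extend_coe N f h m)
    · exact congrArg (C * ·) (Completion.nnnorm_coe m).symm

lemma completion_hom_ext [FlavouredNorm k V] {N : Ban R k} {f g : completion k V ⟶ N}
    (h : ∀ v : V, f.lin (v : Completion V) = g.lin (v : Completion V)) : f = g :=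
  hom_ext fun m => Completion.induction_on m (isClosed_eq f.continuous g.continuous) h

end extend
/-- The tensor product of the underlying modules. -/
def PreTensor (M N : Ban R k) : Type u := M ⊗[R] N

section tensor
variable (M N P Q : Ban R k)

instance : AddCommGroup (PreTensor M N) := inferInstanceAs (AddCommGroup (M ⊗[R] N))
instance : Module R (PreTensor M N) := inferInstanceAs (Module R (M ⊗[R] N))

/-- The bilinear map `(m, n) ↦ m ⊗ n`. -/
def PreTensor.mk : M →ₗ[R] N →ₗ[R] PreTensor M N := TensorProduct.mk R M N

variable {M N}

/-- The element `∑ m ⊗ n` represented by a finite family of pairs `(m, n)`. -/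
def PreTensor.total (s : Multiset (M × N)) : PreTensor M N :=
  (s.map fun p => PreTensor.mk M N p.1 p.2).sum

/-- The weight `∑ ‖m‖ ‖n‖`, respectively `sup ‖m‖ ‖n‖`, of a finite family. -/
def PreTensor.weight (s : Multiset (M × N)) : ℝ≥0 := k.agg (s.map fun p => ‖p.1‖₊ * ‖p.2‖₊)

/-- The projective seminorm: the infimum of the weights of all representations. -/
def PreTensor.nnnorm (x : PreTensor M N) : ℝ≥0 :=
  sInf {r | ∃ s : Multiset (M × N), PreTensor.total s = x ∧ r = PreTensor.weight s}

lemma PreTensor.nnnorm_total_le (s : Multiset (M × N)) :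
    PreTensor.nnnorm (PreTensor.total s) ≤ PreTensor.weight s :=
  csInf_le' ⟨s, rfl, rfl⟩

lemma PreTensor.exists_total (x : PreTensor M N) :
    ∃ s : Multiset (M × N), PreTensor.total s = x := by
  induction x using TensorProduct.induction_on with
  | zero => exact ⟨0, by simp [total]; rfl⟩
  | tmul m n => exact ⟨{(m, n)}, by simp [total]; rfl⟩
  | add x y hx hy =>
    obtain ⟨s, rfl⟩ := hx
    obtain ⟨t, rfl⟩ := hy
    exact ⟨s + t, by simp [total]; rfl⟩

lemma PreTensor.le_nnnorm {x : PreTensor M N} {a : ℝ≥0}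
    (h : ∀ s : Multiset (M × N), PreTensor.total s = x → a ≤ PreTensor.weight s) :
    a ≤ PreTensor.nnnorm x := by
  obtain ⟨s, hs⟩ := PreTensor.exists_total x
  refine le_csInf ⟨_, s, hs, rfl⟩ ?_
  rintro _ ⟨s, hs, rfl⟩
  exact h s hs

lemma PreTensor.nnnorm_mk_le (m : M) (n : N) :
    PreTensor.nnnorm (PreTensor.mk M N m n) ≤ ‖m‖₊ * ‖n‖₊ := by
  simpa [total, weight, Flavour.agg_singleton] using nnnorm_total_le {(m, n)}

lemma PreTensor.nnnorm_add_le (x y : PreTensor M N) :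
    PreTensor.nnnorm (x + y) ≤ k.join (PreTensor.nnnorm x) (PreTensor.nnnorm y) := by
  refine le_of_forall_gt_imp_ge_of_dense fun a ha => ?_
  have hc : Continuous fun e : ℝ≥0 => k.join (nnnorm x + e) (nnnorm y + e) :=
    k.continuous_join.comp
      ((continuous_const.add continuous_id).prodMk (continuous_const.add continuous_id))
  have h0 : k.join (nnnorm x + 0) (nnnorm y + 0) < a := by simpa using ha
  obtain ⟨e, he, hea⟩ : ∃ e : ℝ≥0, 0 < e ∧ k.join (nnnorm x + e) (nnnorm y + e) < a := by
    have h1 : ∀ᶠ e in nhdsWithin (0 : ℝ≥0) (Set.Ioi 0), k.join (nnnorm x + e) (nnnorm y + e) < a :=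
      (hc.continuousAt.eventually_lt_const h0).filter_mono nhdsWithin_le_nhds
    obtain ⟨e, h, h'⟩ := (h1.and self_mem_nhdsWithin).exists
    exact ⟨e, h', h⟩
  obtain ⟨s, hs⟩ := PreTensor.exists_total x
  obtain ⟨t, ht⟩ := PreTensor.exists_total y
  obtain ⟨_, ⟨s, rfl, rfl⟩, hs'⟩ := exists_lt_of_csInf_lt (b := nnnorm x + e)
    (s := {r | ∃ s : Multiset (M × N), total s = x ∧ r = weight s}) ⟨_, s, hs, rfl⟩
    (show nnnorm x < nnnorm x + e from lt_add_of_pos_right _ he)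
  obtain ⟨_, ⟨t, rfl, rfl⟩, ht'⟩ := exists_lt_of_csInf_lt (b := nnnorm y + e)
    (s := {r | ∃ s : Multiset (M × N), total s = y ∧ r = weight s}) ⟨_, t, ht, rfl⟩
    (show nnnorm y < nnnorm y + e from lt_add_of_pos_right _ he)
  have h2 : total s + total t = total (s + t) := by simp [total]
  rw [h2]
  refine (nnnorm_total_le _).trans (le_trans ?_ hea.le)
  rw [weight, Multiset.map_add, Flavour.agg_add]
  exact k.join_mono hs'.le ht'.le

lemma PreTensor.nnnorm_zero : PreTensor.nnnorm (0 : PreTensor M N) = 0 := by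
  have := nnnorm_total_le (0 : Multiset (M × N))
  simpa [total, weight] using this

lemma PreTensor.le_mul_nnnorm {x : PreTensor M N} {a b : ℝ≥0}
    (h : ∀ s : Multiset (M × N), PreTensor.total s = x → a ≤ b * PreTensor.weight s) :
    a ≤ b * PreTensor.nnnorm x := by
  rcases eq_or_ne b 0 with rfl | hb
  · obtain ⟨s, hs⟩ := PreTensor.exists_total x
    simpa using h s hs
  · rw [← div_le_iff₀' (pos_iff_ne_zero.2 hb)]
    refine le_nnnorm fun s hs => ?_
    rw [div_le_iff₀' (pos_iff_ne_zero.2 hb)]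
    exact h s hs

lemma PreTensor.nnnorm_smul_le {C : ℝ≥0} (hC : ∀ (a : R) (m : M), ‖a • m‖₊ ≤ C * (‖a‖₊ * ‖m‖₊))
    (a : R) (x : PreTensor M N) : nnnorm (a • x) ≤ C * (‖a‖₊ * nnnorm x) := by
  rw [← mul_assoc]
  refine le_mul_nnnorm fun s hs => ?_
  have h1 : total (s.map fun p => (a • p.1, p.2)) = a • x := by
    subst hs
    simp [total, Multiset.smul_sum]
  rw [← h1]
  refine (nnnorm_total_le _).trans ?_
  rw [weight, weight, ← Flavour.agg_mul, Multiset.map_map]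
  refine k.agg_mono s _ _ fun p => ?_
  simp only [Function.comp_apply]
  rw [← mul_assoc]
  gcongr
  rw [mul_assoc]
  exact hC a p.1

lemma PreTensor.nnnorm_neg (x : PreTensor M N) : nnnorm (-x) = nnnorm x := by
  have h : ∀ x : PreTensor M N, nnnorm (-x) ≤ nnnorm x := by
    intro x
    refine le_nnnorm fun s hs => ?_
    have h1 : total (s.map fun p => (-p.1, p.2)) = -x := by
      subst hs
      simp [total]
    rw [← h1]
    refine (nnnorm_total_le _).trans (le_of_eq ?_)
    simp [weight]
  exact le_antisymm (h x) (by simpa using h (-x))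

instance : SeminormedAddCommGroup (PreTensor M N) :=
  AddGroupSeminorm.toSeminormedAddCommGroup
    { toFun := fun x => PreTensor.nnnorm x
      map_zero' := by simp [PreTensor.nnnorm_zero]
      add_le' := fun x y => by
        exact_mod_cast (PreTensor.nnnorm_add_le x y).trans (k.join_le_add _ _)
      neg' := fun x => by simp [PreTensor.nnnorm_neg] }

lemma PreTensor.nnnorm_eq (x : PreTensor M N) : ‖x‖₊ = PreTensor.nnnorm x := rfl

instance : BoundedScalars R (PreTensor M N) where
  exists_nnnorm_smul_le := by
    obtain ⟨C, hC⟩ := BoundedScalars.exists_nnnorm_smul_le R M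
    exact ⟨C, PreTensor.nnnorm_smul_le hC⟩

instance : FlavouredNorm k (PreTensor M N) where
  nnnorm_add_le_join := PreTensor.nnnorm_add_le

variable (M N) in
/-- The completed projective tensor product. -/
def tensor : Ban R k := completion k (PreTensor M N)

/-- The pure tensor `m ⊗ n`. -/
def tmul (m : M) (n : N) : tensor M N := ((PreTensor.mk M N m n : PreTensor M N) : Completion _)

lemma tmul_bound (m : M) (n : N) : ‖tmul m n‖₊ ≤ ‖m‖₊ * ‖n‖₊ :=
  (Completion.nnnorm_coe _).le.trans (PreTensor.nnnorm_mk_le m n)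

variable (M N) in
/-- The universal bilinear map. -/
def tmulₗ : M →ₗ[R] N →ₗ[R] tensor M N :=
  LinearMap.mk₂ R tmul
    (fun m m' n => by
      simp only [tmul, map_add, LinearMap.add_apply]; exact Completion.coe_add _ _)
    (fun c m n => by
      simp only [tmul, map_smul, LinearMap.smul_apply]; exact Completion.coe_smul _ _)
    (fun m n n' => by simp only [tmul, map_add]; exact Completion.coe_add _ _)
    (fun c m n => by simp only [tmul, map_smul]; exact Completion.coe_smul _ _)

lemma add_tmul (m m' : M) (n : N) : tmul (m + m') n = tmul m n + tmul m' n :=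
  LinearMap.map_add₂ (tmulₗ M N) m m' n

lemma tmul_add (m : M) (n n' : N) : tmul m (n + n') = tmul m n + tmul m n' :=
  map_add (tmulₗ M N m) n n'

lemma smul_tmul (c : R) (m : M) (n : N) : tmul (c • m) n = c • tmul m n :=
  LinearMap.map_smul₂ (tmulₗ M N) c m n

lemma tmul_smul (c : R) (m : M) (n : N) : tmul m (c • n) = c • tmul m n :=
  map_smul (tmulₗ M N m) c n

lemma tensor_ind {p : tensor M N → Prop} (hc : IsClosed {x | p x}) (h : ∀ m n, p (tmul m n))
    (hadd : ∀ x y, p x → p y → p (x + y)) (x : tensor M N) : p x := by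
  refine Completion.induction_on x hc fun x => ?_
  induction x using TensorProduct.induction_on with
  | zero =>
    have := h 0 0
    rwa [tmul, map_zero] at this
  | tmul m n => exact h m n
  | add x y hx hy =>
    have := hadd _ _ hx hy
    exact (Completion.coe_add (α := PreTensor M N) x y).symm ▸ this

lemma tensor_ext {L : Ban R k} {f g : tensor M N ⟶ L}
    (h : ∀ m n, f.lin (tmul m n) = g.lin (tmul m n)) : f = g :=
  hom_ext fun x => tensor_ind (p := fun x => f.lin x = g.lin x)
    (isClosed_eq f.continuous g.continuous) h (fun x y hx hy => by rw [map_add, map_add, hx, hy]) x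

lemma continuous_tmul_left (n : N) : Continuous fun m : M => tmul m n :=
  AddMonoidHomClass.continuous_of_bound ((tmulₗ M N).flip n) ‖n‖ fun m => by
    rw [mul_comm]; exact_mod_cast tmul_bound m n

lemma continuous_tmul_right (m : M) : Continuous fun n : N => tmul m n :=
  AddMonoidHomClass.continuous_of_bound (tmulₗ M N m) ‖m‖ fun n => by
    exact_mod_cast tmul_bound m n

/-- The linear map on the algebraic tensor product induced by a bilinear map. -/
def preLift {L : Ban R k} (f : M →ₗ[R] N →ₗ[R] L) : PreTensor M N →ₗ[R] L := TensorProduct.lift f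

lemma preLift_bound {L : Ban R k} (f : M →ₗ[R] N →ₗ[R] L) {C : ℝ≥0}
    (hC : ∀ m n, ‖f m n‖₊ ≤ C * (‖m‖₊ * ‖n‖₊)) (x : PreTensor M N) :
    ‖preLift f x‖₊ ≤ C * ‖x‖₊ := by
  refine PreTensor.le_mul_nnnorm fun s hs => ?_
  subst hs
  have : preLift f (PreTensor.total s) = (s.map fun p => f p.1 p.2).sum := by
    rw [PreTensor.total, map_multiset_sum, Multiset.map_map]
    congr 1
  rw [this, PreTensor.weight, ← Flavour.agg_mul]
  refine (nnnorm_sum_le_agg k _).trans ?_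
  rw [Multiset.map_map]
  exact k.agg_mono s _ _ fun p => hC p.1 p.2

/-- The map out of the completed tensor product induced by a bounded bilinear map. -/
def lift {L : Ban R k} (f : M →ₗ[R] N →ₗ[R] L)
    (h : ∃ C : ℝ≥0, ∀ m n, ‖f m n‖₊ ≤ C * (‖m‖₊ * ‖n‖₊)) : tensor M N ⟶ L :=
  extend L (preLift f) (h.imp fun _ hC => preLift_bound f hC)

@[simp] lemma lift_tmul {L : Ban R k} (f : M →ₗ[R] N →ₗ[R] L)
    (h : ∃ C : ℝ≥0, ∀ m n, ‖f m n‖₊ ≤ C * (‖m‖₊ * ‖n‖₊)) (m : M) (n : N) :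
    (lift f h).lin (tmul m n) = f m n :=
  (extend_coe _ _ _ _).trans (TensorProduct.lift.tmul m n)

lemma lift_bound {L : Ban R k} (f : M →ₗ[R] N →ₗ[R] L)
    (h : ∃ C : ℝ≥0, ∀ m n, ‖f m n‖₊ ≤ C * (‖m‖₊ * ‖n‖₊)) {C : ℝ≥0}
    (hC : ∀ m n, ‖f m n‖₊ ≤ C * (‖m‖₊ * ‖n‖₊)) (x : tensor M N) :
    ‖(lift f h).lin x‖₊ ≤ C * ‖x‖₊ :=
  extend_bound L _ _ (preLift_bound f hC) x

end tensor
end Ban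

namespace Ban
open CategoryTheory MonoidalCategory
variable {R : Type u} [BanachRing R] {k : Flavour}

section monoidal
variable {M N P Q L : Ban R k}

/-- The tensor product of two bounded linear maps. -/
def tensorMap (f : M ⟶ P) (g : N ⟶ Q) : tensor M N ⟶ tensor P Q :=
  lift ((tmulₗ P Q).compl₁₂ f.lin g.lin) (by
    obtain ⟨C, hC⟩ := f.bounded
    obtain ⟨D, hD⟩ := g.bounded
    refine ⟨C * D, fun m n => (tmul_bound _ _).trans ?_⟩
    rw [mul_mul_mul_comm]
    exact mul_le_mul' (hC m) (hD n))

@[simp] lemma tensorMap_tmul (f : M ⟶ P) (g : N ⟶ Q) (m : M) (n : N) :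
    (tensorMap f g).lin (tmul m n) = tmul (f.lin m) (g.lin n) :=
  lift_tmul _ _ _ _

/-- The bilinear map `(m, n) ↦ m ⊗ (n ⊗ p)`. -/
def assocAux (p : P) : tensor M N ⟶ tensor M (tensor N P) :=
  lift ((tmulₗ M (tensor N P)).compl₂ ((tmulₗ N P).flip p)) ⟨‖p‖₊, fun m n => by
    refine (tmul_bound m (tmul n p)).trans ?_
    rw [mul_left_comm, mul_comm ‖p‖₊]
    gcongr
    exact tmul_bound n p⟩

lemma assocAux_tmul (p : P) (m : M) (n : N) :
    (assocAux p).lin (tmul m n) = tmul m (tmul n p) :=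
  lift_tmul _ _ _ _

lemma assocAux_bound (p : P) (x : tensor M N) :
    ‖(assocAux p).lin x‖₊ ≤ ‖x‖₊ * ‖p‖₊ := by
  rw [mul_comm]
  refine lift_bound _ _ (fun m n => ?_) x
  refine (tmul_bound m (tmul n p)).trans ?_
  rw [mul_left_comm, mul_comm ‖p‖₊]
  gcongr
  exact tmul_bound n p

variable (M N P) in
/-- The map `(m ⊗ n) ⊗ p ↦ m ⊗ (n ⊗ p)`. -/
def assocHom : tensor (tensor M N) P ⟶ tensor M (tensor N P) :=
  lift (LinearMap.mk₂ R (fun x p => (assocAux p).lin x)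
    (fun x x' p => map_add _ _ _)
    (fun c x p => map_smul _ _ _)
    (fun x p p' => by
      refine tensor_ind (p := fun x : tensor M N => (assocAux (p + p')).lin x =
        (assocAux p).lin x + (assocAux p').lin x) ?_ (fun m n => ?_) (fun x y hx hy => ?_) x
      · exact isClosed_eq (Hom.continuous _) ((assocAux p).continuous.add (assocAux p').continuous)
      · simp only [assocAux_tmul, tmul_add]
      · rw [map_add, map_add, map_add, hx, hy, add_add_add_comm])
    (fun c x p => by
      refine tensor_ind (p := fun x : tensor M N => (assocAux (c • p)).lin x =
        c • (assocAux p).lin x) ?_ (fun m n => ?_) (fun x y hx hy => ?_) x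
      · exact isClosed_eq (Hom.continuous _) ((continuous_const_smul c).comp (Hom.continuous _))
      · simp only [assocAux_tmul, tmul_smul]
      · rw [map_add, map_add, hx, hy, smul_add]))
    ⟨1, fun x p => by rw [one_mul]; exact assocAux_bound p x⟩

@[simp] lemma assocHom_tmul (m : M) (n : N) (p : P) :
    (assocHom M N P).lin (tmul (tmul m n) p) = tmul m (tmul n p) :=
  (lift_tmul _ _ _ _).trans (assocAux_tmul p m n)

variable (M N) in
/-- The map `m ⊗ n ↦ n ⊗ m`. -/
def swap : tensor M N ⟶ tensor N M :=
  lift (tmulₗ N M).flip ⟨1, fun m n => by rw [one_mul, mul_comm]; exact tmul_bound n m⟩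

@[simp] lemma swap_tmul (m : M) (n : N) : (swap M N).lin (tmul m n) = tmul n m :=
  lift_tmul _ _ _ _

lemma tensor_ext₃ {f g : tensor (tensor M N) P ⟶ L}
    (h : ∀ m n p, f.lin (tmul (tmul m n) p) = g.lin (tmul (tmul m n) p)) : f = g :=
  tensor_ext fun x p => tensor_ind
    (p := fun x : tensor M N => f.lin (tmul x p) = g.lin (tmul x p))
    (isClosed_eq (f.continuous.comp (continuous_tmul_left p))
      (g.continuous.comp (continuous_tmul_left p))) (fun m n => h m n p)
    (fun x y hx hy => by rw [add_tmul, map_add, map_add, hx, hy]) x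

lemma tensor_ext₃' {f g : tensor M (tensor N P) ⟶ L}
    (h : ∀ m n p, f.lin (tmul m (tmul n p)) = g.lin (tmul m (tmul n p))) : f = g :=
  tensor_ext fun m x => tensor_ind
    (p := fun x : tensor N P => f.lin (tmul m x) = g.lin (tmul m x))
    (isClosed_eq (f.continuous.comp (continuous_tmul_right m))
      (g.continuous.comp (continuous_tmul_right m))) (fun n p => h m n p)
    (fun x y hx hy => by rw [tmul_add, map_add, map_add, hx, hy]) x

lemma tensor_ext₄ {f g : tensor (tensor (tensor M N) P) Q ⟶ L}
    (h : ∀ m n p q, f.lin (tmul (tmul (tmul m n) p) q) = g.lin (tmul (tmul (tmul m n) p) q)) :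
    f = g :=
  tensor_ext₃ fun x p q => tensor_ind
    (p := fun x : tensor M N => f.lin (tmul (tmul x p) q) = g.lin (tmul (tmul x p) q))
    (isClosed_eq (f.continuous.comp ((continuous_tmul_left q).comp (continuous_tmul_left p)))
      (g.continuous.comp ((continuous_tmul_left q).comp (continuous_tmul_left p))))
    (fun m n => h m n p q)
    (fun x y hx hy => by rw [add_tmul, add_tmul, map_add, map_add, hx, hy]) x

variable (M N P) in
/-- The map `m ⊗ (n ⊗ p) ↦ (m ⊗ n) ⊗ p`. -/
def assocInv : tensor M (tensor N P) ⟶ tensor (tensor M N) P :=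
  swap M (tensor N P) ≫ tensorMap (swap N P) (𝟙 M) ≫ assocHom P N M ≫
    swap P (tensor N M) ≫ tensorMap (swap N M) (𝟙 P)

@[simp] lemma assocInv_tmul (m : M) (n : N) (p : P) :
    (assocInv M N P).lin (tmul m (tmul n p)) = tmul (tmul m n) p := by
  simp [assocInv]

variable [IsUltrametricDist R]

variable (R k) in
/-- The Banach ring `R` as a Banach module over itself. -/

def base : Ban R k where
  carrier := R

/-- The element `1` of `R`. -/
def baseOne : base R k := (1 : R)

/-- The scalar multiplication, written for elements of the module `R`. -/
def scale (a : base R k) (m : M) : M := (show R from a) • m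

lemma baseOne_scale (m : M) : scale (baseOne (R := R) (k := k)) m = m := one_smul R m

lemma tmul_scale (a : base R k) (m : M) : tmul baseOne (scale a m) = tmul a m :=
  (tmul_smul (M := base R k) (show R from a) baseOne m).trans
    ((smul_tmul (M := base R k) (show R from a) baseOne m).symm.trans
      (congrArg (fun b : base R k => tmul b m) (mul_one (show R from a))))

lemma scale_tmul (a : base R k) (m : M) :
    tmul (scale a m) (baseOne (R := R) (k := k)) = tmul m a :=
  (smul_tmul (N := base R k) (show R from a) m baseOne).trans
    ((tmul_smul (N := base R k) (show R from a) m baseOne).symm.trans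
      (congrArg (fun b : base R k => tmul m b) (mul_one (show R from a))))

variable (M) in
/-- The map `a ⊗ m ↦ a m`. -/
def leftUnit : tensor (base R k) M ⟶ M :=
  lift (LinearMap.lsmul R M) (BoundedScalars.exists_nnnorm_smul_le R M)

@[simp] lemma leftUnit_tmul (a : base R k) (m : M) :
    (leftUnit M).lin (tmul a m) = scale a m :=
  lift_tmul _ _ _ _

variable (M) in
/-- The map `m ↦ 1 ⊗ m`. -/
def leftUnitInv : M ⟶ tensor (base R k) M where
  lin := tmulₗ (base R k) M baseOne
  bounded := ⟨‖(1 : R)‖₊, fun m => tmul_bound _ m⟩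

@[simp] lemma leftUnitInv_apply (m : M) :
    (leftUnitInv M).lin m = tmul (baseOne (R := R) (k := k)) m := rfl

instance : MonoidalCategoryStruct (Ban R k) where
  tensorObj := tensor
  whiskerLeft M _ _ f := tensorMap (𝟙 M) f
  whiskerRight f N := tensorMap f (𝟙 N)
  tensorHom := tensorMap
  tensorUnit := base R k
  associator M N P :=
    { hom := assocHom M N P
      inv := assocInv M N P
      hom_inv_id := tensor_ext₃ fun m n p => by simp
      inv_hom_id := tensor_ext₃' fun m n p => by simp }
  leftUnitor M :=
    { hom := leftUnit M
      inv := leftUnitInv M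
      hom_inv_id := tensor_ext fun a m => by simp [tmul_scale]
      inv_hom_id := hom_ext fun m => by simp [baseOne_scale] }
  rightUnitor M :=
    { hom := swap _ _ ≫ leftUnit M
      inv := leftUnitInv M ≫ swap _ _
      hom_inv_id := tensor_ext fun m a => by simp [scale_tmul]
      inv_hom_id := hom_ext fun m => by simp [baseOne_scale] }

lemma tensorHom_tmul (f : M ⟶ P) (g : N ⟶ Q) (m : M) (n : N) :
    Hom.lin (f ⊗ₘ g) (tmul m n) = tmul (f.lin m) (g.lin n) := tensorMap_tmul f g m n

lemma whiskerLeft_tmul (g : N ⟶ Q) (m : M) (n : N) :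
    Hom.lin (M ◁ g) (tmul m n) = tmul m (g.lin n) := tensorMap_tmul _ g m n

lemma whiskerRight_tmul (f : M ⟶ P) (m : M) (n : N) :
    Hom.lin (f ▷ N) (tmul m n) = tmul (f.lin m) n := tensorMap_tmul f _ m n

lemma associator_tmul (m : M) (n : N) (p : P) :
    Hom.lin (α_ M N P).hom (tmul (tmul m n) p) = tmul m (tmul n p) := assocHom_tmul m n p

lemma associator_inv_tmul (m : M) (n : N) (p : P) :
    Hom.lin (α_ M N P).inv (tmul m (tmul n p)) = tmul (tmul m n) p := assocInv_tmul m n p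

lemma leftUnitor_tmul (a : base R k) (m : M) :
    Hom.lin (λ_ M).hom (tmul a m) = scale a m := leftUnit_tmul a m

lemma rightUnitor_tmul (a : base R k) (m : M) :
    Hom.lin (ρ_ M).hom (tmul m a) = scale a m :=
  (congrArg (leftUnit M).lin (swap_tmul m a)).trans (leftUnit_tmul a m)

lemma map_scale (f : M ⟶ N) (a : base R k) (m : M) : f.lin (scale a m) = scale a (f.lin m) :=
  map_smul f.lin (show R from a) m

lemma tmul_scale_right (a : base R k) (m : M) (n : N) :
    tmul m (scale a n) = tmul (scale a m) n :=
  (tmul_smul (show R from a) m n).trans (smul_tmul (show R from a) m n).symm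

instance : MonoidalCategory (Ban R k) where
  tensorHom_def f g := tensor_ext fun m n => by
    rw [comp_lin, tensorHom_tmul, whiskerRight_tmul, whiskerLeft_tmul]
  id_tensorHom_id M N := tensor_ext fun m n => by rw [tensorHom_tmul]; rfl
  tensorHom_comp_tensorHom f g f' g' := tensor_ext fun m n => by
    rw [comp_lin, tensorHom_tmul, tensorHom_tmul, tensorHom_tmul]; rfl
  whiskerLeft_id M N := tensor_ext fun m n => by rw [whiskerLeft_tmul]; rfl
  id_whiskerRight M N := tensor_ext fun m n => by rw [whiskerRight_tmul]; rfl
  associator_naturality f g h := tensor_ext₃ fun m n p => by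
    rw [comp_lin, comp_lin, tensorHom_tmul, tensorHom_tmul, associator_tmul, associator_tmul,
      tensorHom_tmul, tensorHom_tmul]
  leftUnitor_naturality f := tensor_ext fun a m => by
    rw [comp_lin, comp_lin, whiskerLeft_tmul, leftUnitor_tmul, leftUnitor_tmul, map_scale]
  rightUnitor_naturality f := tensor_ext fun m a => by
    rw [comp_lin, comp_lin, whiskerRight_tmul, rightUnitor_tmul, rightUnitor_tmul, map_scale]
  pentagon M N P Q := tensor_ext₄ fun m n p q => by
    simp only [comp_lin]
    rw [whiskerRight_tmul, associator_tmul, associator_tmul, associator_tmul, whiskerLeft_tmul,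
      associator_tmul, associator_tmul]
  triangle M N := tensor_ext₃ fun m a n => by
    rw [comp_lin, associator_tmul, whiskerLeft_tmul, whiskerRight_tmul, leftUnitor_tmul,
      rightUnitor_tmul, tmul_scale_right]

variable (M N) in
/-- The symmetry of the tensor product. -/
def braid : (M ⊗ N : Ban R k) ≅ N ⊗ M where
  hom := swap M N
  inv := swap N M
  hom_inv_id := tensor_ext fun m n => by rw [comp_lin, swap_tmul, swap_tmul]; rfl
  inv_hom_id := tensor_ext fun m n => by rw [comp_lin, swap_tmul, swap_tmul]; rfl

lemma braid_tmul (m : M) (n : N) : Hom.lin (braid M N).hom (tmul m n) = tmul n m :=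
  swap_tmul m n

instance : SymmetricCategory (Ban R k) where
  braiding M N := braid M N
  braiding_naturality_right M _ _ f := tensor_ext fun m n => by
    rw [comp_lin, comp_lin, whiskerLeft_tmul, braid_tmul, braid_tmul, whiskerRight_tmul]
  braiding_naturality_left f M := tensor_ext fun m n => by
    rw [comp_lin, comp_lin, whiskerRight_tmul, braid_tmul, braid_tmul, whiskerLeft_tmul]
  hexagon_forward M N P := tensor_ext₃ fun m n p => by
    simp only [comp_lin]
    rw [associator_tmul, whiskerRight_tmul, braid_tmul, associator_tmul, braid_tmul,
      associator_tmul, whiskerLeft_tmul, braid_tmul]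
  hexagon_reverse M N P := tensor_ext₃' fun m n p => by
    simp only [comp_lin]
    rw [associator_inv_tmul, whiskerLeft_tmul, braid_tmul, associator_inv_tmul, braid_tmul,
      associator_inv_tmul, whiskerRight_tmul, braid_tmul]
  symmetry M N := (braid M N).hom_inv_id

end monoidal
end Ban

instance (V : Type u) [SeminormedAddCommGroup V] : FlavouredNorm .arch V where
  nnnorm_add_le_join := nnnorm_add_le

namespace Ban
open CategoryTheory Limits UniformSpace
variable {R : Type u} [BanachRing R] {k : Flavour}

/-- The inclusion of non-Archimedean Banach modules into all Banach modules. -/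

def incl (R : Type u) [BanachRing R] : Ban R .nonArch ⥤ Ban R .arch where
  obj M := { carrier := M }
  map f := ⟨f.lin, f.bounded⟩

/-- The canonical map `m ⊗ n ↦ m ⊗ n` from the Archimedean tensor product to the
non-Archimedean one. -/
def compare (M N : Ban R .nonArch) :
    tensor ((incl R).obj M) ((incl R).obj N) ⟶ (incl R).obj (tensor M N) :=
  lift (tmulₗ M N) ⟨1, fun m n => by rw [one_mul]; exact tmul_bound (M := M) (N := N) m n⟩

section zero

/-- The zero module. -/
def zeroObj (R : Type u) [BanachRing R] (k : Flavour) : Ban R k where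
  carrier := PUnit
  scalars := ⟨⟨0, fun _ _ => (nnnorm_zero (E := PUnit.{u + 1})).le.trans zero_le⟩⟩
  flavour := ⟨fun _ _ => (nnnorm_zero (E := PUnit.{u + 1})).le.trans zero_le⟩

lemma isZero_zeroObj : IsZero (zeroObj R k) where
  unique_to M := ⟨{ default := ⟨0, 0, fun m => by simp⟩
                    uniq := fun f => hom_ext fun m => by
                      rw [Subsingleton.elim (α := PUnit) m 0]
                      exact (map_zero f.lin).trans (map_zero _).symm }⟩
  unique_from M := ⟨{ default := ⟨0, 0, fun m => by simp⟩
                      uniq := fun f => hom_ext fun m => Subsingleton.elim (α := PUnit) _ _ }⟩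

instance : HasZeroObject (Ban R k) := ⟨⟨_, isZero_zeroObj⟩⟩

end zero

section sum
variable (M N : Ban R k)

/-- The direct sum of two Banach modules. -/
def sum : Ban R k where
  carrier := M × N
  scalars := by
    obtain ⟨C, hC⟩ := BoundedScalars.exists_nnnorm_smul_le R M
    obtain ⟨D, hD⟩ := BoundedScalars.exists_nnnorm_smul_le R N
    refine ⟨⟨max C D, fun a m => ?_⟩⟩
    refine max_le ((hC a m.1).trans ?_) ((hD a m.2).trans ?_)
    · exact mul_le_mul' (le_max_left _ _) (mul_le_mul' le_rfl (norm_fst_le m))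
    · exact mul_le_mul' (le_max_right _ _) (mul_le_mul' le_rfl (norm_snd_le m))
  flavour := ⟨fun x y => max_le
    ((FlavouredNorm.nnnorm_add_le_join k x.1 y.1).trans
      (k.join_mono (le_max_left _ _) (le_max_left _ _)))
    ((FlavouredNorm.nnnorm_add_le_join k x.2 y.2).trans
      (k.join_mono (le_max_right _ _) (le_max_right _ _)))⟩

/-- The first inclusion into the direct sum. -/
def sumInl : M ⟶ sum M N where
  lin := LinearMap.inl R M N
  bounded := ⟨1, fun m => by
    rw [one_mul]
    exact show max ‖m‖ ‖(0 : N)‖ ≤ ‖m‖ by simp⟩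

/-- The second inclusion into the direct sum. -/
def sumInr : N ⟶ sum M N where
  lin := LinearMap.inr R M N
  bounded := ⟨1, fun m => by
    rw [one_mul]
    exact show max ‖(0 : M)‖ ‖m‖ ≤ ‖m‖ by simp⟩

variable {M N} in
/-- The map out of the direct sum. -/
def sumDesc {L : Ban R k} (f : M ⟶ L) (g : N ⟶ L) : sum M N ⟶ L where
  lin := LinearMap.coprod f.lin g.lin
  bounded := by
    obtain ⟨C, hC⟩ := f.bounded
    obtain ⟨D, hD⟩ := g.bounded
    refine ⟨C + D, fun m => ?_⟩
    refine (nnnorm_add_le _ _).trans ?_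
    rw [add_mul]
    refine add_le_add ((hC m.1).trans ?_) ((hD m.2).trans ?_)
    · exact mul_le_mul' le_rfl (norm_fst_le m)
    · exact mul_le_mul' le_rfl (norm_snd_le m)

instance : HasBinaryCoproduct M N :=
  ⟨⟨⟨BinaryCofan.mk (sumInl M N) (sumInr M N), BinaryCofan.IsColimit.mk _
    (fun f g => sumDesc f g)
    (fun f g => hom_ext fun m => show f.lin m + g.lin 0 = f.lin m by simp)
    (fun f g => hom_ext fun m => show f.lin 0 + g.lin m = g.lin m by simp)
    (fun f g h hf hg => hom_ext fun m => by
      subst hf hg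
      exact (congrArg h.lin (Prod.ext (add_zero _).symm (zero_add _).symm)).trans
        (map_add h.lin ((sumInl M N).lin m.1) ((sumInr M N).lin m.2)))⟩⟩⟩

instance : HasFiniteCoproducts (Ban R k) :=
  haveI : HasBinaryCoproducts (Ban R k) := hasBinaryCoproducts_of_hasColimit_pair _
  hasFiniteCoproducts_of_has_binary_and_initial
end sum

section free
variable [IsUltrametricDist R] {k' : Flavour}

/-- The free module on the non-zero elements of `M`. -/
def PreFree (M : Ban R k') (_ : Flavour) : Type u := {m : M // m ≠ 0} →₀ R

variable {M : Ban R k'}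

instance : AddCommGroup (PreFree M k) := inferInstanceAs (AddCommGroup ({m : M // m ≠ 0} →₀ R))
instance : Module R (PreFree M k) := inferInstanceAs (Module R ({m : M // m ≠ 0} →₀ R))

/-- The coefficient of `c` at `m`. -/
def PreFree.coeff (c : PreFree M k) (m : {m : M // m ≠ 0}) : R := Finsupp.toFun c m

/-- The indices of the non-zero coefficients. -/
def PreFree.support (c : PreFree M k) : Finset {m : M // m ≠ 0} := Finsupp.support c

/-- The norm `∑ |c_m| ‖m‖`, respectively `sup |c_m| ‖m‖`. -/
def PreFree.nnnorm (c : PreFree M k) : ℝ≥0 :=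
  k.agg (c.support.val.map fun m => ‖c.coeff m‖₊ * ‖m.1‖₊)

lemma PreFree.nnnorm_eq {c : PreFree M k} {s : Finset {m : M // m ≠ 0}} (h : c.support ⊆ s) :
    c.nnnorm = k.agg (s.val.map fun m => ‖c.coeff m‖₊ * ‖m.1‖₊) := by
  have h0 : ∀ m ∈ s, m ∉ c.support → ‖c.coeff m‖₊ * ‖m.1‖₊ = 0 := by
    intro m _ hm
    have : c.coeff m = 0 := Finsupp.notMem_support_iff.1 hm
    simp [this]
  cases k
  · exact Finset.sum_subset h h0
  · refine le_antisymm (Finset.sup_mono h) (Finset.sup_le fun m hm => ?_)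
    by_cases hm' : m ∈ c.support
    · exact Finset.le_sup (f := fun m => ‖c.coeff m‖₊ * ‖m.1‖₊) hm'
    · rw [h0 m hm hm']; exact zero_le

lemma PreFree.nnnorm_add_le (c d : PreFree M k) :
    (c + d).nnnorm ≤ k.join c.nnnorm d.nnnorm := by
  classical
  have hs : (c + d).support ⊆ c.support ∪ d.support := Finsupp.support_add
  rw [nnnorm_eq hs, nnnorm_eq (c := c) Finset.subset_union_left,
    nnnorm_eq (c := d) Finset.subset_union_right]
  generalize c.support ∪ d.support = s
  have h : ∀ m, ‖(c + d).coeff m‖₊ * ‖m.1‖₊ ≤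
      k.join (‖c.coeff m‖₊ * ‖m.1‖₊) (‖d.coeff m‖₊ * ‖m.1‖₊) := by
    intro m
    rw [mul_comm, mul_comm _ ‖m.1‖₊, mul_comm _ ‖m.1‖₊, ← Flavour.mul_join]
    exact mul_le_mul' le_rfl (FlavouredNorm.nnnorm_add_le_join k (c.coeff m) (d.coeff m))
  refine (k.agg_mono _ _ _ h).trans (le_of_eq ?_)
  cases k
  · exact Finset.sum_add_distrib
  · exact Finset.sup_sup

lemma PreFree.nnnorm_zero : (0 : PreFree M k).nnnorm = 0 := by
  have hs : (0 : PreFree M k).support ⊆ ∅ := (Finsupp.support_zero (M := R)).le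
  rw [nnnorm_eq hs]
  simp

lemma PreFree.nnnorm_smul_le {C : ℝ≥0} (hC : ∀ a b : R, ‖a * b‖₊ ≤ C * (‖a‖₊ * ‖b‖₊))
    (a : R) (c : PreFree M k) : (a • c).nnnorm ≤ C * (‖a‖₊ * c.nnnorm) := by
  have hs : (a • c).support ⊆ c.support := Finsupp.support_smul
  rw [nnnorm_eq hs, nnnorm, ← mul_assoc, ← Flavour.agg_mul]
  refine k.agg_mono _ _ _ fun m => ?_
  rw [← mul_assoc]
  refine mul_le_mul' ?_ le_rfl
  rw [mul_assoc]
  exact hC a (c.coeff m)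

lemma PreFree.nnnorm_neg (c : PreFree M k) : (-c).nnnorm = c.nnnorm := by
  have hs : (-c).support ⊆ c.support := (Finsupp.support_neg c).le
  rw [nnnorm_eq hs, nnnorm]
  congr 1
  refine Multiset.map_congr rfl fun m _ => ?_
  congr 1
  exact _root_.nnnorm_neg (c.coeff m)

instance : SeminormedAddCommGroup (PreFree M k) :=
  AddGroupSeminorm.toSeminormedAddCommGroup
    { toFun := fun x => PreFree.nnnorm x
      map_zero' := by simp [PreFree.nnnorm_zero]
      add_le' := fun x y => by
        exact_mod_cast (PreFree.nnnorm_add_le x y).trans (k.join_le_add _ _)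
      neg' := fun x => by simp [PreFree.nnnorm_neg] }

instance : BoundedScalars R (PreFree M k) where
  exists_nnnorm_smul_le := by
    obtain ⟨C, hC⟩ := BanachRing.exists_nnnorm_mul_le (R := R)
    exact ⟨C, PreFree.nnnorm_smul_le hC⟩

instance : FlavouredNorm k (PreFree M k) where
  nnnorm_add_le_join := PreFree.nnnorm_add_le

variable (k M) in
/-- The module `P(M)` of the flavour `k`: the completed direct sum of the modules `R` with norm
rescaled by `‖m‖`, over all non-zero `m` in `M`. -/
def free : Ban R k := completion k (PreFree M k)

variable (M) in
/-- The map `c ↦ ∑ c_m m` from `P(M)` to `M`. -/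
def freeDesc : free k' M ⟶ M :=
  extend M (V := PreFree M k') (Finsupp.linearCombination R fun m : {m : M // m ≠ 0} => m.1) (by
    obtain ⟨C, hC⟩ := BoundedScalars.exists_nnnorm_smul_le R M
    refine ⟨C, fun c => ?_⟩
    refine (nnnorm_sum_le_agg k' (c.support.val.map fun m => c.coeff m • m.1)).trans ?_
    rw [Multiset.map_map]
    refine (k'.agg_mono _ _ _ fun m => hC (c.coeff m) m.1).trans (le_of_eq ?_)
    exact k'.agg_mul _ _ _)

variable (M) in
/-- The canonical map from the Archimedean to the non-Archimedean version of `P(M)`, given by the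
identity on finite families. -/
def freeCompare : free .arch M ⟶ (incl R).obj (free .nonArch M) :=
  extend ((incl R).obj (free .nonArch M)) (V := PreFree M .arch)
    ((toCompletion .nonArch (PreFree M .nonArch)).comp
      (LinearMap.id : ({m : M // m ≠ 0} →₀ R) →ₗ[R] ({m : M // m ≠ 0} →₀ R)))
    ⟨1, fun c => by
      rw [one_mul]
      refine (Completion.nnnorm_coe (E := PreFree M .nonArch) _).le.trans ?_
      exact Finset.sup_le fun m hm => Finset.single_le_sum
        (f := fun m => ‖PreFree.coeff c m‖₊ * ‖m.1‖₊) (fun _ _ => zero_le) hm⟩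

end free
end Ban

namespace Ban
open CategoryTheory

/-- The identity of `R`, from the Archimedean unit to the non-Archimedean one. -/
def compareUnit (R : Type u) [BanachRing R] [IsUltrametricDist R] :
    base R .arch ⟶ (incl R).obj (base R .nonArch) where
  lin := LinearMap.id (R := R) (M := R)
  bounded := ⟨1, fun m => (one_mul ‖(show R from m)‖₊).ge⟩

end Ban

end

namespace CategoryTheory.Ind
open Limits MonoidalCategory Opposite

section map
variable {C : Type u} [Category.{v} C] {D : Type w} [Category.{v} D]

/-- The category of elements of an ind-object, computed in presheaves. -/
def elementsEquivalence (X : Ind C) :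
    CostructuredArrow Ind.yoneda X ≌ CostructuredArrow CategoryTheory.yoneda
      ((Ind.inclusion C).obj X) :=
  (CostructuredArrow.post Ind.yoneda (Ind.inclusion C) X).asEquivalence.trans
    (CostructuredArrow.mapNatIso Ind.yonedaCompInclusion)

instance (F : C ⥤ D) : Ind.yoneda.HasPointwiseLeftKanExtension (F ⋙ Ind.yoneda (C := D)) :=
  fun X => Functor.Final.hasColimit_of_comp
    (X.presentation.toCostructuredArrow ⋙ (elementsEquivalence X).inverse)

/-- The functor on ind-objects induced by a functor `F`: the extension of `F` which commutes with
filtered colimits, that is, the left Kan extension of `F` along the embedding of `C`. -/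
def map (F : C ⥤ D) : Ind C ⥤ Ind D :=
  (Ind.yoneda (C := C)).leftKanExtension (F ⋙ Ind.yoneda)

/-- The canonical identification of `F(X)` with the value at `X` of the induced functor. -/
def mapUnit (F : C ⥤ D) : F ⋙ Ind.yoneda ⟶ Ind.yoneda ⋙ map F :=
  (Ind.yoneda (C := C)).leftKanExtensionUnit (F ⋙ Ind.yoneda)

end map

section tensor
variable {C : Type u} [Category.{v} C]

/-- The tautological element of the presheaf represented by `X`. -/
def self (X : C) : ((Ind.inclusion C).obj (Ind.yoneda.obj X)).obj (op X) :=
  (Ind.yonedaCompInclusion.inv.app X).app (op X) (𝟙 X)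

/-- The morphism from `X` to an ind-object `Z` given by an element of `Z(X)`. -/
def ofElement {X : C} {Z : Ind C} (z : ((Ind.inclusion C).obj Z).obj (op X)) :
    Ind.yoneda.obj X ⟶ Z :=
  Ind.inclusion.fullyFaithful.preimage
    (Ind.yonedaCompInclusion.hom.app X ≫ yonedaEquiv.symm z)

variable [MonoidalCategory C]

/-- The canonical morphism from `X ⊗ Y`, formed in `C`, to the tensor product of ind-objects. -/
def tensorComparison (X Y : C) : Ind.yoneda.obj (X ⊗ Y) ⟶ Ind.yoneda.obj X ⊗ Ind.yoneda.obj Y :=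
  ofElement (Z := IndTensor.tensorObj (Ind.yoneda.obj X) (Ind.yoneda.obj Y))
    (IndTensor.pair (Ind.yoneda.obj X).presentation (Ind.yoneda.obj Y).presentation
      (IndTensor.tensorCocone _ _) (op X) (op Y) (self X) (self Y))

end tensor

section zero
variable {C : Type u} [Category.{v} C] [HasZeroObject C]

instance : HasZeroObject (Ind C) := by
  obtain ⟨Z, hZ⟩ := HasZeroObject.zero (C := C)
  have hi : IsInitial (Ind.yoneda.obj Z) := IsInitial.isInitialObj Ind.yoneda Z hZ.isInitial
  have ht : IsTerminal (Ind.yoneda.obj Z) := IsTerminal.isTerminalObj Ind.yoneda Z hZ.isTerminal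
  exact ⟨⟨Ind.yoneda.obj Z, fun Y => ⟨⟨⟨hi.to Y⟩, fun f => hi.hom_ext _ _⟩⟩,
    fun Y => ⟨⟨⟨ht.from Y⟩, fun f => ht.hom_ext _ _⟩⟩⟩⟩
end zero
end CategoryTheory.Ind

namespace Ban
open CategoryTheory Limits MonoidalCategory
variable {R : Type u} [BanachRing R] {k : Flavour}

instance : HasZeroMorphisms (Ind (Ban R k)) := HasZeroObject.zeroMorphismsOfZeroObject

variable [IsUltrametricDist R] {I : Type u} [SmallCategory I] [IsFiltered I]

/-- `P(E)` for the ind-object `E` given by the filtered system `V`: the coproduct of the modules `P(V_i)`. -/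
def indFree (k' : Flavour) (V : I ⥤ Ban R k) : Ind (Ban R k') :=
  ∐ fun i => Ind.yoneda.obj (free k' (V.obj i))

/-- The canonical morphism `P(E) ⟶ ∐ V_i ⟶ E`. -/
def indFreeDesc (V : I ⥤ Ban R k) : indFree k V ⟶ (Ind.lim I).obj V :=
  Sigma.desc fun i => Ind.yoneda.map (freeDesc (V.obj i)) ≫ colimit.ι (V ⋙ Ind.yoneda) i

/-- The inclusion of non-Archimedean ind-Banach modules into all ind-Banach modules. -/
def indIncl (R : Type u) [BanachRing R] : Ind (Ban R .nonArch) ⥤ Ind (Ban R .arch) :=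
  Ind.map (incl R)

/-- The canonical morphism from the Archimedean to the non-Archimedean version of `P(E)`. -/
def indFreeCompare (V : I ⥤ Ban R k) :
    indFree .arch V ⟶ (indIncl R).obj (indFree .nonArch V) :=
  Sigma.desc fun i => Ind.yoneda.map (freeCompare (V.obj i)) ≫
    (Ind.mapUnit (incl R)).app (free .nonArch (V.obj i)) ≫
      (indIncl R).map (Sigma.ι (fun i => Ind.yoneda.obj (free .nonArch (V.obj i))) i)

end Ban

end

open CategoryTheory Limits MonoidalCategory

/-!
Write `ι` for the extension of the inclusion of non-Archimedean Banach modules to ind-objects.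

**Ind-objects.** An ind-object is determined by its elements, the morphisms `A ⟶ X` from
representable ind-objects, and the tensor product of ind-objects is characterized by the products
`mul x y` of elements (`tensor_hom_ext`, `exists_tensor_desc`). In these terms a lax braided functor
`G` extends to a lax braided functor `Ind.map G` on ind-objects, and a universal arrow `A ⟶ G M`
remains one (`isUniversalArrow_map`), so that the extension of a right adjoint is a right adjoint. Its
left adjoint is oplax monoidal. The structure maps of a left adjoint are invertible where universal
arrows are stable under the multiplication of the right adjoint (`isIso_δ_of_isUniversalArrow`); this
settles the representable ind-objects, and the general case follows since tensor products in closed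
categories commute with filtered colimits (`exists_braided_leftAdjoint`). The adjunction for
internal homs is then formal (`isIso_curry_ihom`).

**Banach modules.** The reflection of a Banach module `A` is the quotient of the non-Archimedean
`P(A)` by the closure of the relations which hold in `A` (`isUniversalArrow_reflectionMap`). Bounded
maps from any Banach module to a non-Archimedean one form a non-Archimedean module, so a bounded
bilinear map `A × B ⟶ P` extends along the reflections of `A` and `B` one variable at a time; this is
the stability of universal arrows under tensor products (`isUniversalArrow_tensor`).

**Closedness.** The internal hom from `E` to `F` is the presheaf `W ↦ Hom(E ⊗ W, F)` on Banach
modules, if this presheaf is an ind-object. It turns finite colimits into limits, as tensoring with a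
Banach module has a right adjoint. Moreover a morphism `E ⊗ W ⟶ F` factors through a quotient of `W`
of cardinality bounded in terms of `E` and `F` (`exists_factor_through_bounded`). So the category of
elements of the presheaf is filtered and has a small weakly terminal set, which makes it an ind-object
(`isIndObject_homPresheaf`).

**The explicit construction.** The canonical map `P(M) ⟶ M` is a cokernel of its kernel, as every `m`
lifts to a basis vector of norm at most `|1| ‖m‖`. To pass to ind-objects, one needs that a
morphism which kills the elements killed by `P(E) ⟶ E` does not separate elements with the same image
in `E`; the difference of two elements is available because addition `A ⊕ A ⟶ A` is the cokernel of
`a ↦ (a, -a)` (`comp_eq_of_comp_eq`). So `E` is the cokernel of `P(ker) ⟶ P(E)`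
(`nonempty_isColimit_indFreeDesc`). The comparison of the two versions of `P(E)` is a universal arrow
to `ι` (`isUniversalArrow_indFreeCompare`), hence identifies the non-Archimedean `P(E)` with the
reflection of the Archimedean one. As left adjoints preserve cokernels, the reflection of `E` is the
cokernel of the corresponding map of non-Archimedean modules (`exists_presentation_reflection`).
-/

noncomputable section

/-! ### Elements of ind-objects and their products -/

namespace CategoryTheory.Ind
open Opposite

section elements
variable {C : Type u} [Category.{v} C] {A B : C} {X Y Z : Ind C}

/-- The element of the presheaf `X` at `A` given by a morphism `A ⟶ X`. Throughout, such morphisms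
with representable source are called elements of `X`; `toElement` and `ofElement` translate between
the two points of view. -/
def toElement (x : Ind.yoneda.obj A ⟶ X) : ((Ind.inclusion C).obj X).obj (op A) :=
  ((Ind.inclusion C).map x).app (op A) (self A)

lemma hom_app_self (A : C) : (Ind.yonedaCompInclusion.hom.app A).app (op A) (self A) = 𝟙 A :=
  congrArg (fun t => t.app (op A) (𝟙 A)) (Ind.yonedaCompInclusion.inv_hom_id_app A)

lemma toElement_ofElement (z : ((Ind.inclusion C).obj X).obj (op A)) :
    toElement (ofElement z) = z := by
  unfold toElement ofElement
  rw [Functor.FullyFaithful.map_preimage]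
  refine (congrArg ((yonedaEquiv.symm z).app (op A)) (hom_app_self A)).trans ?_
  exact (yonedaEquiv_apply _).symm.trans (yonedaEquiv.apply_symm_apply z)

lemma ofElement_toElement (x : Ind.yoneda.obj A ⟶ X) : ofElement (toElement x) = x := by
  unfold ofElement
  apply (Ind.inclusion C).map_injective
  rw [Functor.FullyFaithful.map_preimage, ← Iso.app_hom, ← Iso.eq_inv_comp]
  apply yonedaEquiv.injective
  rw [Equiv.apply_symm_apply]
  exact (yonedaEquiv_apply _).symm

lemma toElement_injective : Function.Injective (toElement : (Ind.yoneda.obj A ⟶ X) → _) :=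
  Function.LeftInverse.injective ofElement_toElement

lemma toElement_id : toElement (𝟙 (Ind.yoneda.obj A)) = self A := by
  unfold toElement
  rw [Functor.map_id]
  rfl

lemma toElement_comp (x : Ind.yoneda.obj A ⟶ X) (f : X ⟶ Y) :
    toElement (x ≫ f) = ((Ind.inclusion C).map f).app (op A) (toElement x) := by
  unfold toElement
  rw [Functor.map_comp]
  rfl

lemma map_self (f : A ⟶ B) :
    ((Ind.inclusion C).map (Ind.yoneda.map f)).app (op A) (self A) =
      ((Ind.inclusion C).obj (Ind.yoneda.obj B)).map f.op (self B) := by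
  have h1 := congrArg (fun t => t.app (op A) (𝟙 A)) (Ind.yonedaCompInclusion.inv.naturality f)
  have h2 := congrArg (fun t => t (𝟙 B)) ((Ind.yonedaCompInclusion.inv.app B).naturality f.op)
  refine h1.symm.trans (Eq.trans ?_ h2)
  exact congrArg ((Ind.yonedaCompInclusion.inv.app B).app (op A))
    ((Category.id_comp f).trans (Category.comp_id f).symm)

lemma toElement_precomp (f : A ⟶ B) (x : Ind.yoneda.obj B ⟶ X) :
    toElement (Ind.yoneda.map f ≫ x) = ((Ind.inclusion C).obj X).map f.op (toElement x) := by
  rw [toElement_comp]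
  refine (congrArg (((Ind.inclusion C).map x).app (op A)) (map_self f)).trans ?_
  exact congrArg (fun t => t (self B)) (((Ind.inclusion C).map x).naturality f.op)

/-- Morphisms of ind-objects agree as soon as they agree on all elements. -/
lemma hom_ext_elements {f g : X ⟶ Y}
    (h : ∀ (A : C) (x : Ind.yoneda.obj A ⟶ X), x ≫ f = x ≫ g) : f = g := by
  apply (Ind.inclusion C).map_injective
  ext ⟨A⟩ x
  have := congrArg toElement (h A (ofElement x))
  rwa [toElement_comp, toElement_comp, toElement_ofElement] at this

/-- A natural action on elements comes from a morphism of ind-objects. -/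
lemma exists_hom_of_elements (φ : ∀ A : C, (Ind.yoneda.obj A ⟶ X) → (Ind.yoneda.obj A ⟶ Y))
    (hφ : ∀ (A B : C) (f : A ⟶ B) x, φ A (Ind.yoneda.map f ≫ x) = Ind.yoneda.map f ≫ φ B x) :
    ∃ f : X ⟶ Y, ∀ (A : C) (x : Ind.yoneda.obj A ⟶ X), x ≫ f = φ A x := by
  let F : (Ind.inclusion C).obj X ⟶ (Ind.inclusion C).obj Y :=
    { app := fun A => ↾(fun x => toElement (φ A.unop (ofElement x)))
      naturality := by
        rintro ⟨A⟩ ⟨B⟩ f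
        ext x
        have h1 : ofElement (((Ind.inclusion C).obj X).map f x) =
            Ind.yoneda.map f.unop ≫ ofElement x := by
          apply toElement_injective
          rw [toElement_precomp, toElement_ofElement, toElement_ofElement]
          rfl
        exact (congrArg (fun t => toElement (φ B t)) h1).trans
          ((congrArg toElement (hφ _ _ f.unop _)).trans (toElement_precomp _ _)) }
  refine ⟨Ind.inclusion.fullyFaithful.preimage F, fun A x => toElement_injective ?_⟩
  rw [toElement_comp, Functor.FullyFaithful.map_preimage]
  exact congrArg (fun t => toElement (φ A t)) (ofElement_toElement x)

end elements

section tensor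
variable {C : Type u} [Category.{v} C] [MonoidalCategory C] {A B A' B' D : C} {X Y Z : Ind C}

open LawfulDayConvolutionMonoidalCategoryStruct

/-- The product of two elements of ind-objects, as an element of their tensor product. -/
def mul (x : Ind.yoneda.obj A ⟶ X) (y : Ind.yoneda.obj B ⟶ Y) : Ind.yoneda.obj (A ⊗ B) ⟶ X ⊗ Y :=
  tensorComparison A B ≫ (x ⊗ₘ y)

lemma mul_id : mul (𝟙 (Ind.yoneda.obj A)) (𝟙 (Ind.yoneda.obj B)) = tensorComparison A B := by
  simp [mul]

lemma mul_comp {X' Y' : Ind C} (x : Ind.yoneda.obj A ⟶ X) (y : Ind.yoneda.obj B ⟶ Y) (f : X ⟶ X')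
    (g : Y ⟶ Y') : mul x y ≫ (f ⊗ₘ g) = mul (x ≫ f) (y ≫ g) := by
  simp [mul]

/-- The action of the Day convolution pairing on elements. -/
def pairing (x : ((Ind.inclusion C).obj X).obj (op A)) (y : ((Ind.inclusion C).obj Y).obj (op B)) :
    ((Ind.inclusion C).obj (X ⊗ Y)).obj (op (A ⊗ B)) :=
  (convolutionExtensionUnit Cᵒᵖ (Type v) X Y).app (op A, op B) (x, y)

lemma toElement_mul (x : Ind.yoneda.obj A ⟶ X) (y : Ind.yoneda.obj B ⟶ Y) :
    toElement (mul x y) = pairing (toElement x) (toElement y) := by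
  unfold mul
  rw [toElement_comp]
  refine (congrArg _ (toElement_ofElement _)).trans ?_
  exact congrArg (fun t => t (self A, self B))
    (convolutionExtensionUnit_comp_ι_map_tensorHom_app Cᵒᵖ (Type v) x y (op A) (op B))

lemma map_mul (f : A ⟶ A') (g : B ⟶ B') (x : Ind.yoneda.obj A' ⟶ X) (y : Ind.yoneda.obj B' ⟶ Y) :
    Ind.yoneda.map (f ⊗ₘ g) ≫ mul x y = mul (Ind.yoneda.map f ≫ x) (Ind.yoneda.map g ≫ y) := by
  apply toElement_injective
  rw [toElement_precomp, toElement_mul, toElement_mul, toElement_precomp, toElement_precomp]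
  exact (congrArg (fun t => t (toElement x, toElement y))
    ((convolutionExtensionUnit Cᵒᵖ (Type v) X Y).naturality
      (X := (op A', op B')) (Y := (op A, op B)) (Prod.mkHom f.op g.op))).symm

lemma mul_associator (x : Ind.yoneda.obj A ⟶ X) (y : Ind.yoneda.obj B ⟶ Y)
    (z : Ind.yoneda.obj D ⟶ Z) :
    mul (mul x y) z ≫ (α_ X Y Z).hom = Ind.yoneda.map (α_ A B D).hom ≫ mul x (mul y z) := by
  apply toElement_injective
  rw [toElement_precomp, toElement_mul, toElement_mul, toElement_comp, toElement_mul,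
    toElement_mul]
  exact congrArg (fun t => t ((toElement x, toElement y), toElement z))
    (associator_hom_unit_unit (C := Cᵒᵖ) (Type v) X Y Z (op A) (op B) (op D))

/-- The tautological element of the unit object; the unit of ind-objects is by definition the image
of the unit of `C`. -/
def unitElement (C : Type u) [Category.{v} C] [MonoidalCategory C] :
    Ind.yoneda.obj (𝟙_ C) ⟶ 𝟙_ (Ind C) := 𝟙 _

lemma exists_eq_unitElement (x : Ind.yoneda.obj A ⟶ 𝟙_ (Ind C)) :
    ∃ f : A ⟶ 𝟙_ C, Ind.yoneda.map f ≫ unitElement C = x := by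
  obtain ⟨f, hf⟩ : ∃ f : A ⟶ 𝟙_ C, Ind.yoneda.map f = x := Ind.yoneda.map_surjective x
  exact ⟨f, (Category.comp_id _).trans hf⟩

lemma toElement_unitElement : toElement (unitElement C) = self (𝟙_ C) := toElement_id

lemma mul_leftUnitor (y : Ind.yoneda.obj B ⟶ Y) :
    mul (unitElement C) y ≫ (λ_ Y).hom = Ind.yoneda.map (λ_ B).hom ≫ y := by
  apply toElement_injective
  rw [toElement_precomp, toElement_comp, toElement_mul, toElement_unitElement]
  exact congrArg (fun t => t (PUnit.unit, toElement y))
    (leftUnitor_hom_unit_app (C := Cᵒᵖ) (Type v) Y (op B))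

lemma mul_rightUnitor (y : Ind.yoneda.obj B ⟶ Y) :
    mul y (unitElement C) ≫ (ρ_ Y).hom = Ind.yoneda.map (ρ_ B).hom ≫ y := by
  apply toElement_injective
  rw [toElement_precomp, toElement_comp, toElement_mul, toElement_unitElement]
  exact congrArg (fun t => t (toElement y, PUnit.unit))
    (rightUnitor_hom_unit_app (C := Cᵒᵖ) (Type v) Y (op B))

instance (X Y : Ind C) : ((ι Cᵒᵖ (Type v) (Ind C)).obj (X ⊗ Y)).IsLeftKanExtension
    (convolutionExtensionUnit Cᵒᵖ (Type v) X Y) :=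
  (isPointwiseLeftKanExtensionConvolutionExtensionUnit (C := Cᵒᵖ) (V := Type v)
    X Y).isLeftKanExtension

/-- Every element of a tensor product is a restriction of a product of elements. -/
lemma exists_eq_mul (w : Ind.yoneda.obj D ⟶ X ⊗ Y) : ∃ (A B : C) (x : Ind.yoneda.obj A ⟶ X)
    (y : Ind.yoneda.obj B ⟶ Y) (s : D ⟶ A ⊗ B), w = Ind.yoneda.map s ≫ mul x y := by
  obtain ⟨⟨i, j⟩, h, hh⟩ := IndTensor.exists_rep (IndTensor.pres X.presentation Y.presentation
    (IndTensor.tensorCocone X Y) (IndTensor.tensorCoconeIsColimit X Y)) (op D) (toElement w)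
  refine ⟨_, _, ofElement (IndTensor.elt X.presentation i),
    ofElement (IndTensor.elt Y.presentation j), h, toElement_injective ?_⟩
  rw [toElement_precomp, toElement_mul, toElement_ofElement, toElement_ofElement, ← hh]
  refine Eq.trans ?_ (congrArg (((Ind.inclusion C).obj (X ⊗ Y)).map (Quiver.Hom.op h))
    (IndTensor.pair_rep X.presentation Y.presentation (IndTensor.tensorCocone X Y)
      (IndTensor.tensorCoconeIsColimit X Y) _ _ (𝟙 _) (𝟙 _)).symm)
  refine Eq.trans ?_ (IndTensor.rep_pre (IndTensor.pres X.presentation Y.presentation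
    (IndTensor.tensorCocone X Y) (IndTensor.tensorCoconeIsColimit X Y)) (i := (i, j))
      (a := op _) _ (Quiver.Hom.op h))
  congr 1
  simp

/-- Morphisms out of a tensor product agree if they agree on all products of elements. -/
lemma tensor_hom_ext {f g : X ⊗ Y ⟶ Z}
    (h : ∀ (A B : C) (x : Ind.yoneda.obj A ⟶ X) (y : Ind.yoneda.obj B ⟶ Y),
      mul x y ≫ f = mul x y ≫ g) : f = g := by
  apply (Ind.inclusion C).map_injective
  refine Functor.hom_ext_of_isLeftKanExtension _
    (convolutionExtensionUnit Cᵒᵖ (Type v) X Y) _ _ ?_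
  ext ⟨⟨A⟩, ⟨B⟩⟩ ⟨x, y⟩
  have := congrArg toElement (h A B (ofElement x) (ofElement y))
  rw [toElement_comp, toElement_comp, toElement_mul, toElement_ofElement,
    toElement_ofElement] at this
  exact this

open scoped ExternalProduct in
/-- A natural pairing of the elements of `X` with those of `Y` comes from a morphism out of `X ⊗ Y`:
the tensor product of ind-objects is the Day convolution, hence a left Kan extension. -/
lemma exists_tensor_desc
    (φ : ∀ A B : C, (Ind.yoneda.obj A ⟶ X) → (Ind.yoneda.obj B ⟶ Y) →
      (Ind.yoneda.obj (A ⊗ B) ⟶ Z))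
    (hφ : ∀ (A A' B B' : C) (f : A ⟶ A') (g : B ⟶ B') x y,
      φ A B (Ind.yoneda.map f ≫ x) (Ind.yoneda.map g ≫ y) =
        Ind.yoneda.map (f ⊗ₘ g) ≫ φ A' B' x y) :
    ∃ f : X ⊗ Y ⟶ Z, ∀ (A B : C) (x : Ind.yoneda.obj A ⟶ X) (y : Ind.yoneda.obj B ⟶ Y),
      mul x y ≫ f = φ A B x y := by
  have hof : ∀ {A B : C} {X : Ind C} (f : A ⟶ B) (x : ((Ind.inclusion C).obj X).obj (op B)),
      ofElement (((Ind.inclusion C).obj X).map f.op x) = Ind.yoneda.map f ≫ ofElement x := by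
    intro A B X f x
    apply toElement_injective
    rw [toElement_precomp, toElement_ofElement, toElement_ofElement]
  let F : (Ind.inclusion C).obj X ⊠ (Ind.inclusion C).obj Y ⟶
      MonoidalCategory.tensor Cᵒᵖ ⋙ (Ind.inclusion C).obj Z :=
    { app := fun p => ↾(fun xy => toElement (φ p.1.unop p.2.unop (ofElement xy.1) (ofElement xy.2)))
      naturality := by
        rintro ⟨⟨A⟩, ⟨B⟩⟩ ⟨⟨A'⟩, ⟨B'⟩⟩ ⟨f, g⟩
        ext ⟨x, y⟩
        refine (congrArg₂ (fun s t => toElement (φ A' B' s t)) (hof f.unop x) (hof g.unop y)).trans ?_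
        exact (congrArg toElement (hφ _ _ _ _ f.unop g.unop _ _)).trans (toElement_precomp _ _) }
  refine ⟨Ind.inclusion.fullyFaithful.preimage (Functor.descOfIsLeftKanExtension
    (α := convolutionExtensionUnit Cᵒᵖ (Type v) X Y) _ _ F), fun A B x y => toElement_injective ?_⟩
  rw [toElement_comp, Functor.FullyFaithful.map_preimage, toElement_mul]
  have h1 := congrArg (fun t => t (toElement x, toElement y))
    (Functor.descOfIsLeftKanExtension_fac_app _ (convolutionExtensionUnit Cᵒᵖ (Type v) X Y) _ F
      (op A, op B))
  refine h1.trans ?_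
  exact congrArg₂ (fun s t => toElement (φ A B s t)) (ofElement_toElement x) (ofElement_toElement y)

lemma tensor_hom_ext₃ {X' : Ind C} {f g : (X ⊗ Y) ⊗ Z ⟶ X'}
    (h : ∀ (A B D : C) (x : Ind.yoneda.obj A ⟶ X) (y : Ind.yoneda.obj B ⟶ Y)
      (z : Ind.yoneda.obj D ⟶ Z), mul (mul x y) z ≫ f = mul (mul x y) z ≫ g) : f = g := by
  refine tensor_hom_ext fun A B w z => ?_
  obtain ⟨A', B', x, y, s, rfl⟩ := exists_eq_mul w
  have := map_mul s (𝟙 B) (mul x y) z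
  rw [Functor.map_id, Category.id_comp] at this
  rw [← this, Category.assoc, Category.assoc, h]

end tensor

section braided
variable {C : Type u} [Category.{v} C] [MonoidalCategory C] [SymmetricCategory C] {A B : C}
  {X Y : Ind C}
open LawfulDayConvolutionMonoidalCategoryStruct

lemma mul_braiding (x : Ind.yoneda.obj A ⟶ X) (y : Ind.yoneda.obj B ⟶ Y) :
    mul x y ≫ (β_ X Y).hom = Ind.yoneda.map (β_ A B).hom ≫ mul y x := by
  apply toElement_injective
  rw [toElement_precomp, toElement_comp, toElement_mul, toElement_mul]
  let := convolution (C := Cᵒᵖ) (V := Type v) (D := Ind C) X Y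
  let := convolution (C := Cᵒᵖ) (V := Type v) (D := Ind C) Y X
  have h1 := IndTensor.map_braid (C := Cᵒᵖ) (V := Type v) Ind.inclusion.fullyFaithful X Y
  refine (congrArg (fun t => t.app (op (A ⊗ B)) (pairing (toElement x) (toElement y)))
    h1).trans ?_
  exact congrArg (fun t => t (toElement x, toElement y))
    (DayConvolution.unit_app_braiding_hom_app ((ι Cᵒᵖ (Type v) (Ind C)).obj X)
      ((ι Cᵒᵖ (Type v) (Ind C)).obj Y) (op A) (op B))

end braided

end CategoryTheory.Ind

/-! ### Filtered colimits and the extension of functors to ind-objects -/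

namespace CategoryTheory.Ind
open Opposite

section colimits
variable {C : Type u} [Category.{v} C]

/-- An ind-object as the colimit of its chosen presentation. -/
def presentationCocone (X : Ind C) : Cocone (X.presentation.F ⋙ Ind.yoneda) :=
  (colimit.cocone _).extend (Ind.colimitPresentationCompYoneda X).hom

/-- The elements which make up the chosen presentation. -/
def leg (X : Ind C) (i : X.presentation.I) : Ind.yoneda.obj (X.presentation.F.obj i) ⟶ X :=
  (presentationCocone X).ι.app i

@[simp]
lemma map_leg (X : Ind C) {i j : X.presentation.I} (s : i ⟶ j) :
    Ind.yoneda.map (X.presentation.F.map s) ≫ leg X j = leg X i :=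
  (presentationCocone X).w s

/-- The chosen presentation is a colimit. -/
def presentationIsColimit (X : Ind C) : IsColimit (presentationCocone X) :=
  (colimit.isColimit _).extendIso _

variable {J : Type v} [SmallCategory J] [IsFiltered J]

/-- Representable ind-objects are finitely presented: elements of a filtered colimit come from a
finite stage. -/
lemma exists_factor {K : J ⥤ Ind C} {c : Cocone K} (hc : IsColimit c) {A : C}
    (x : Ind.yoneda.obj A ⟶ c.pt) : ∃ (j : J) (z : Ind.yoneda.obj A ⟶ K.obj j),
      z ≫ c.ι.app j = x := by
  obtain ⟨j, z, hz⟩ := Types.jointly_surjective_of_isColimit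
    (isColimitOfPreserves (Ind.inclusion C ⋙ (evaluation Cᵒᵖ (Type v)).obj (op A)) hc) (toElement x)
  refine ⟨j, ofElement z, toElement_injective ?_⟩
  rw [toElement_comp, toElement_ofElement]
  exact hz

/-- Elements of two stages of a filtered colimit which agree in the colimit agree at a later stage. -/
lemma exists_factor_eq {K : J ⥤ Ind C} {c : Cocone K} (hc : IsColimit c) {A : C} {i j : J}
    (x : Ind.yoneda.obj A ⟶ K.obj i) (y : Ind.yoneda.obj A ⟶ K.obj j)
    (h : x ≫ c.ι.app i = y ≫ c.ι.app j) :
    ∃ (k : J) (s : i ⟶ k) (t : j ⟶ k), x ≫ K.map s = y ≫ K.map t := by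
  obtain ⟨k, s, t, hh⟩ := (Types.FilteredColimit.isColimit_eq_iff _
    (isColimitOfPreserves (Ind.inclusion C ⋙ (evaluation Cᵒᵖ (Type v)).obj (op A)) hc)
    (xi := toElement x) (xj := toElement y)).1 (by
      have := congrArg toElement h
      rwa [toElement_comp, toElement_comp] at this)
  refine ⟨k, s, t, toElement_injective ?_⟩
  rw [toElement_comp, toElement_comp]
  exact hh

/-- The stages of a presentation are cofinal among all elements. -/
lemma final_of_isColimit {K : J ⥤ C} {c : Cocone (K ⋙ Ind.yoneda)} (hc : IsColimit c) :
    (c.toCostructuredArrow ⋙ CostructuredArrow.pre K Ind.yoneda c.pt).Final := by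
  rw [Functor.final_iff_of_isFiltered]
  constructor
  · intro d
    obtain ⟨j, z, hz⟩ := exists_factor hc d.hom
    obtain ⟨f, rfl⟩ := Ind.yoneda.map_surjective z
    exact ⟨j, ⟨CostructuredArrow.homMk f hz⟩⟩
  · intro d j s t
    obtain ⟨k, a, b, hab⟩ := exists_factor_eq hc (Ind.yoneda.map s.left) (Ind.yoneda.map t.left)
      ((CostructuredArrow.w s).trans (CostructuredArrow.w t).symm)
    refine ⟨_, a ≫ IsFiltered.coeqHom a b, CostructuredArrow.hom_ext _ _ ?_⟩
    have h1 : s.left ≫ K.map a = t.left ≫ K.map b :=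
      Ind.yoneda.map_injective (by rw [Functor.map_comp, Functor.map_comp]; exact hab)
    have h2 : s.left ≫ K.map (a ≫ IsFiltered.coeqHom a b) =
        t.left ≫ K.map (a ≫ IsFiltered.coeqHom a b) := by
      conv_rhs => rw [IsFiltered.coeq_condition]
      rw [Functor.map_comp, Functor.map_comp, reassoc_of% h1]
    exact h2

/-- A morphism between functors which preserve filtered colimits is an isomorphism if it is one on
representable ind-objects. -/
lemma isIso_app_of_representable {D : Type*} [Category* D] {F G : Ind C ⥤ D} (τ : F ⟶ G)
    [PreservesFilteredColimitsOfSize.{v, v} F] [PreservesFilteredColimitsOfSize.{v, v} G]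
    (h : ∀ A : C, IsIso (τ.app (Ind.yoneda.obj A))) (X : Ind C) : IsIso (τ.app X) := by
  have : IsIso (Functor.whiskerLeft (X.presentation.F ⋙ Ind.yoneda) τ) := by
    have : ∀ j, IsIso ((Functor.whiskerLeft (X.presentation.F ⋙ Ind.yoneda) τ).app j) :=
      fun j => h _
    exact NatIso.isIso_of_isIso_app _
  have := PreservesFilteredColimitsOfSize.preserves_filtered_colimits (F := F) X.presentation.I
  have := PreservesFilteredColimitsOfSize.preserves_filtered_colimits (F := G) X.presentation.I
  exact isIso_app_coconePt_of_preservesColimit (X.presentation.F ⋙ Ind.yoneda) τ _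
    (presentationIsColimit X)

end colimits

section map
variable {C : Type u} [Category.{v} C] {D : Type w} [Category.{v} D] (G : D ⥤ C)

/-- The element of the image of `F` under `map G` induced by an element of `F`. -/
def mapElement {F : Ind D} {M : D} (z : Ind.yoneda.obj M ⟶ F) :
    Ind.yoneda.obj (G.obj M) ⟶ (Ind.map G).obj F :=
  (mapUnit G).app M ≫ (Ind.map G).map z

lemma mapElement_comp {F F' : Ind D} {M : D} (z : Ind.yoneda.obj M ⟶ F) (f : F ⟶ F') :
    mapElement G (z ≫ f) = mapElement G z ≫ (Ind.map G).map f := by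
  simp [mapElement]

lemma map_mapElement {F : Ind D} {M N : D} (s : M ⟶ N) (z : Ind.yoneda.obj N ⟶ F) :
    Ind.yoneda.map (G.map s) ≫ mapElement G z = mapElement G (Ind.yoneda.map s ≫ z) := by
  have := (mapUnit G).naturality s
  simp only [Functor.comp_map] at this
  simp [mapElement, reassoc_of% this]

variable {J : Type v} [SmallCategory J] [IsFiltered J]

/-- The image under `map G` of a filtered system. -/
def mapCocone {K : J ⥤ D} (c : Cocone (K ⋙ Ind.yoneda)) : Cocone ((K ⋙ G) ⋙ Ind.yoneda) where
  pt := (Ind.map G).obj c.pt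
  ι := { app := fun j => mapElement G (c.ι.app j)
         naturality := fun i j s => by
          have := c.w s
          dsimp at this ⊢
          rw [map_mapElement, this, Category.comp_id] }

/-- The extension `map G` commutes with filtered colimits of representable ind-objects: it is a
pointwise left Kan extension, and a presentation is cofinal in the category of elements. -/
def mapIsColimit {K : J ⥤ D} {c : Cocone (K ⋙ Ind.yoneda)} (hc : IsColimit c) :
    IsColimit (mapCocone G c) := by
  have hf := final_of_isColimit hc
  have h := (Functor.isPointwiseLeftKanExtensionLeftKanExtensionUnit (Ind.yoneda (C := D))
    (G ⋙ Ind.yoneda)) c.pt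
  exact IsColimit.ofIsoColimit ((Functor.Final.isColimitWhiskerEquiv
    (c.toCostructuredArrow ⋙ CostructuredArrow.pre K Ind.yoneda c.pt) _).symm h)
    (Cocone.ext (Iso.refl _) fun j => Category.comp_id _)

/-- Every element of `map G F` comes from some `A ⟶ G M` and an element of `F` at `M`. -/
lemma exists_eq_mapElement {A : C} {F : Ind D} (w : Ind.yoneda.obj A ⟶ (Ind.map G).obj F) :
    ∃ (M : D) (f : A ⟶ G.obj M) (z : Ind.yoneda.obj M ⟶ F),
      w = Ind.yoneda.map f ≫ mapElement G z := by
  obtain ⟨j, x, hx⟩ := exists_factor (mapIsColimit G (presentationIsColimit F)) w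
  obtain ⟨f, rfl⟩ := Ind.yoneda.map_surjective x
  exact ⟨_, f, (presentationCocone F).ι.app j, hx.symm⟩

/-- Two representatives of an element of `map G F` become equal after passing to a common `G L`. -/
lemma mapElement_eq {A : C} {F : Ind D} {M N : D} {f : A ⟶ G.obj M} {g : A ⟶ G.obj N}
    {z : Ind.yoneda.obj M ⟶ F} {w : Ind.yoneda.obj N ⟶ F}
    (h : Ind.yoneda.map f ≫ mapElement G z = Ind.yoneda.map g ≫ mapElement G w) :
    ∃ (L : D) (s : M ⟶ L) (t : N ⟶ L) (x : Ind.yoneda.obj L ⟶ F), Ind.yoneda.map s ≫ x = z ∧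
      Ind.yoneda.map t ≫ x = w ∧ f ≫ G.map s = g ≫ G.map t := by
  obtain ⟨i, z', hz⟩ := exists_factor (presentationIsColimit F) z
  obtain ⟨s, rfl⟩ := Ind.yoneda.map_surjective z'
  obtain ⟨j, w', hw⟩ := exists_factor (presentationIsColimit F) w
  obtain ⟨t, rfl⟩ := Ind.yoneda.map_surjective w'
  change Ind.yoneda.map s ≫ leg F i = z at hz
  change Ind.yoneda.map t ≫ leg F j = w at hw
  subst hz hw
  obtain ⟨k, a, b, hab⟩ := exists_factor_eq (mapIsColimit G (presentationIsColimit F))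
    (i := i) (j := j) (Ind.yoneda.map (f ≫ G.map s)) (Ind.yoneda.map (g ≫ G.map t)) (by
      change _ ≫ mapElement G (leg F i) = _ ≫ mapElement G (leg F j)
      simpa [map_mapElement] using h)
  refine ⟨_, s ≫ F.presentation.F.map a, t ≫ F.presentation.F.map b, leg F k, by simp, by simp,
    Ind.yoneda.map_injective ?_⟩
  simpa using hab

/-- A universal arrow from `A` to `G` remains universal in ind-objects. -/
lemma bijective_mapElement {A : C} {M : D} (c : A ⟶ G.obj M)
    (hc : ∀ N : D, Function.Bijective fun f : M ⟶ N => c ≫ G.map f) (F : Ind D) :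
    Function.Bijective fun z : Ind.yoneda.obj M ⟶ F => Ind.yoneda.map c ≫ mapElement G z := by
  constructor
  · intro z w h
    obtain ⟨L, s, t, x, rfl, rfl, h'⟩ := mapElement_eq G h
    rw [(hc L).1 h']
  · intro w
    obtain ⟨N, f, z, rfl⟩ := exists_eq_mapElement G w
    obtain ⟨f, rfl⟩ := (hc N).2 f
    exact ⟨Ind.yoneda.map f ≫ z, by simp [← map_mapElement]⟩

/-- A right adjoint extends to a right adjoint: the left adjoint is defined on representable
ind-objects, hence on their colimits. -/
lemma isRightAdjoint_map [G.IsRightAdjoint] : (Ind.map G).IsRightAdjoint := by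
  apply Functor.isRightAdjoint_of_leftAdjointObjIsDefined_eq_top
  ext X
  simp only [Pi.top_apply, Prop.top_eq_true, iff_true]
  have hy (A : C) : (Ind.map G).leftAdjointObjIsDefined (Ind.yoneda.obj A) := by
    have hc : ∀ N, Function.Bijective fun f : G.leftAdjoint.obj A ⟶ N =>
        (Adjunction.ofIsRightAdjoint G).unit.app A ≫ G.map f := fun N =>
      ((Adjunction.ofIsRightAdjoint G).homEquiv A N).bijective
    have : (Ind.map G ⋙ coyoneda.obj (op (Ind.yoneda.obj A))).CorepresentableBy
        (Ind.yoneda.obj (G.leftAdjoint.obj A)) :=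
      { homEquiv := fun {F} => Equiv.ofBijective _ (bijective_mapElement G _ hc F)
        homEquiv_comp := fun f z => by
          simp [mapElement_comp] }
    exact this.isCorepresentable
  have := X.presentation.hI
  exact Functor.leftAdjointObjIsDefined_of_isColimit (presentationIsColimit X) fun j => hy _

end map
end CategoryTheory.Ind

/-! ### The lax monoidal structure on the extension of a functor -/

namespace CategoryTheory.Ind
open Opposite

section comparison
variable {C : Type u} [Category.{v} C] [MonoidalCategory C]

lemma map_mul_id {A A' B B' : C} (f : A ⟶ A') (g : B ⟶ B') :
    mul (Ind.yoneda.map f) (Ind.yoneda.map g) =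
      Ind.yoneda.map (f ⊗ₘ g) ≫ tensorComparison A' B' := by
  rw [← mul_id, map_mul, Category.comp_id, Category.comp_id]

/-- The embedding of `C` into ind-objects commutes with tensor products, since both sides have the
same maps into every ind-object. -/
instance (A B : C) : IsIso (tensorComparison A B) := by
  refine isIso_of_coyoneda_map_bijective _ fun Z => ⟨fun f g h => ?_, fun h => ?_⟩
  · refine tensor_hom_ext fun A' B' x y => ?_
    obtain ⟨x, rfl⟩ := Ind.yoneda.map_surjective x
    obtain ⟨y, rfl⟩ := Ind.yoneda.map_surjective y
    dsimp at h
    rw [map_mul_id, Category.assoc, Category.assoc, h]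
  · obtain ⟨f, hf⟩ := exists_tensor_desc (X := Ind.yoneda.obj A) (Y := Ind.yoneda.obj B) (Z := Z)
      (fun A' B' x y => Ind.yoneda.map (Ind.yoneda.preimage x ⊗ₘ Ind.yoneda.preimage y) ≫ h)
      (fun A A' B B' f g x y => by
        obtain ⟨x, rfl⟩ := Ind.yoneda.map_surjective x
        obtain ⟨y, rfl⟩ := Ind.yoneda.map_surjective y
        rw [← Functor.map_comp, ← Functor.map_comp]
        simp only [Functor.preimage_map]
        rw [← tensorHom_comp_tensorHom, Functor.map_comp, Category.assoc])
    refine ⟨f, ?_⟩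
    have := hf A B (𝟙 _) (𝟙 _)
    rw [mul_id, Functor.preimage_id, Functor.preimage_id] at this
    simpa using this

end comparison

section lax
variable {C : Type u} [Category.{v} C] {D : Type w} [Category.{v} D]
  [MonoidalCategory C] [MonoidalCategory D] (G : D ⥤ C)

lemma map_tensor_hom_ext {F F' : Ind D} {Z : Ind C}
    {f g : (Ind.map G).obj F ⊗ (Ind.map G).obj F' ⟶ Z}
    (h : ∀ (M N : D) (x : Ind.yoneda.obj M ⟶ F) (y : Ind.yoneda.obj N ⟶ F'),
      mul (mapElement G x) (mapElement G y) ≫ f = mul (mapElement G x) (mapElement G y) ≫ g) :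
    f = g := by
  refine tensor_hom_ext fun A B x y => ?_
  obtain ⟨M, s, x, rfl⟩ := exists_eq_mapElement G x
  obtain ⟨N, t, y, rfl⟩ := exists_eq_mapElement G y
  rw [← map_mul, Category.assoc, Category.assoc, h]

lemma map_tensor_hom_ext₃ {F F' F'' : Ind D} {Z : Ind C}
    {f g : ((Ind.map G).obj F ⊗ (Ind.map G).obj F') ⊗ (Ind.map G).obj F'' ⟶ Z}
    (h : ∀ (M N P : D) (x : Ind.yoneda.obj M ⟶ F) (y : Ind.yoneda.obj N ⟶ F')
      (z : Ind.yoneda.obj P ⟶ F''),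
      mul (mul (mapElement G x) (mapElement G y)) (mapElement G z) ≫ f =
        mul (mul (mapElement G x) (mapElement G y)) (mapElement G z) ≫ g) :
    f = g := by
  refine tensor_hom_ext₃ fun A B D x y z => ?_
  obtain ⟨M, s, x, rfl⟩ := exists_eq_mapElement G x
  obtain ⟨N, t, y, rfl⟩ := exists_eq_mapElement G y
  obtain ⟨P, r, z, rfl⟩ := exists_eq_mapElement G z
  rw [← map_mul, ← map_mul, Category.assoc, Category.assoc, h]

open Functor.LaxMonoidal

variable [G.LaxMonoidal]

/-- The pairing `(x, y) ↦ x y` of elements of `F` and `F'` induces one of elements of `map G F` and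
`map G F'`, through representatives and the multiplication of `G`. -/
lemma exists_mapTensor (F F' : Ind D) :
    ∃ m : (Ind.map G).obj F ⊗ (Ind.map G).obj F' ⟶ (Ind.map G).obj (F ⊗ F'),
      ∀ (M N : D) (x : Ind.yoneda.obj M ⟶ F) (y : Ind.yoneda.obj N ⟶ F'),
        mul (mapElement G x) (mapElement G y) ≫ m =
          Ind.yoneda.map (μ G M N) ≫ mapElement G (mul x y) := by
  choose M f x h using fun (A : C) (F : Ind D) (w : Ind.yoneda.obj A ⟶ (Ind.map G).obj F) =>
    exists_eq_mapElement G w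
  -- the product of two elements does not depend on the representatives
  have key : ∀ {A B : C} {M M' N N' : D} (f : A ⟶ G.obj M) (f' : A ⟶ G.obj M')
      (g : B ⟶ G.obj N) (g' : B ⟶ G.obj N') (x : Ind.yoneda.obj M ⟶ F)
      (x' : Ind.yoneda.obj M' ⟶ F) (y : Ind.yoneda.obj N ⟶ F') (y' : Ind.yoneda.obj N' ⟶ F')
      (_ : Ind.yoneda.map f ≫ mapElement G x = Ind.yoneda.map f' ≫ mapElement G x')
      (_ : Ind.yoneda.map g ≫ mapElement G y = Ind.yoneda.map g' ≫ mapElement G y'),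
      Ind.yoneda.map ((f ⊗ₘ g) ≫ μ G M N) ≫ mapElement G (mul x y) =
        Ind.yoneda.map ((f' ⊗ₘ g') ≫ μ G M' N') ≫ mapElement G (mul x' y') := by
    intro A B M M' N N' f f' g g' x x' y y' hx hy
    obtain ⟨P, s, t, x, rfl, rfl, hx'⟩ := mapElement_eq G hx
    obtain ⟨Q, s', t', y, rfl, rfl, hy'⟩ := mapElement_eq G hy
    rw [← map_mul, ← map_mul, ← map_mapElement, ← map_mapElement, ← Category.assoc,
      ← Category.assoc, ← Functor.map_comp, ← Functor.map_comp, Category.assoc, Category.assoc,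
      ← μ_natural, ← μ_natural, ← Category.assoc, ← Category.assoc, tensorHom_comp_tensorHom,
      tensorHom_comp_tensorHom, hx', hy']
  obtain ⟨m, hm⟩ := exists_tensor_desc (X := (Ind.map G).obj F) (Y := (Ind.map G).obj F')
    (Z := (Ind.map G).obj (F ⊗ F'))
    (fun A B a b => Ind.yoneda.map ((f A F a ⊗ₘ f B F' b) ≫ μ G _ _) ≫
      mapElement G (mul (x A F a) (x B F' b)))
    (fun A A' B B' s t a b => by
      rw [← Category.assoc, ← Functor.map_comp, ← Category.assoc, tensorHom_comp_tensorHom]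
      refine key _ _ _ _ _ _ _ _ ?_ ?_
      · rw [← h, Functor.map_comp, Category.assoc, ← h]
      · rw [← h, Functor.map_comp, Category.assoc, ← h])
  refine ⟨m, fun M N x y => (hm _ _ _ _).trans ((key _ (𝟙 _) _ (𝟙 _) _ x _ y ?_ ?_).trans ?_)⟩
  · rw [← h, Functor.map_id, Category.id_comp]
  · rw [← h, Functor.map_id, Category.id_comp]
  · rw [id_tensorHom_id, Category.id_comp]

/-- The multiplication `ι F ⊗ ι F' ⟶ ι (F ⊗ F')` of the extension `ι` of a lax monoidal functor
to ind-objects. -/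
def mapTensor (F F' : Ind D) :
    (Ind.map G).obj F ⊗ (Ind.map G).obj F' ⟶ (Ind.map G).obj (F ⊗ F') :=
  (exists_mapTensor G F F').choose

lemma mul_mapTensor {F F' : Ind D} {M N : D} (x : Ind.yoneda.obj M ⟶ F)
    (y : Ind.yoneda.obj N ⟶ F') :
    mul (mapElement G x) (mapElement G y) ≫ mapTensor G F F' =
      Ind.yoneda.map (μ G M N) ≫ mapElement G (mul x y) :=
  (exists_mapTensor G F F').choose_spec M N x y

lemma mul_whiskerRight {X Y X' : Ind C} {A B : C} (x : Ind.yoneda.obj A ⟶ X)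
    (y : Ind.yoneda.obj B ⟶ Y) (f : X ⟶ X') : mul x y ≫ f ▷ Y = mul (x ≫ f) y := by
  rw [← tensorHom_id, mul_comp, Category.comp_id]

lemma mul_whiskerLeft {X Y Y' : Ind C} {A B : C} (x : Ind.yoneda.obj A ⟶ X)
    (y : Ind.yoneda.obj B ⟶ Y) (f : Y ⟶ Y') : mul x y ≫ X ◁ f = mul x (y ≫ f) := by
  rw [← id_tensorHom, mul_comp, Category.comp_id]

lemma map_mul_right {A B B' : C} {X Y : Ind C} (g : B ⟶ B') (x : Ind.yoneda.obj A ⟶ X)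
    (y : Ind.yoneda.obj B' ⟶ Y) :
    mul x (Ind.yoneda.map g ≫ y) = Ind.yoneda.map (A ◁ g) ≫ mul x y := by
  rw [← id_tensorHom, map_mul, Functor.map_id, Category.id_comp]

lemma map_mul_left {A A' B : C} {X Y : Ind C} (f : A ⟶ A') (x : Ind.yoneda.obj A' ⟶ X)
    (y : Ind.yoneda.obj B ⟶ Y) :
    mul (Ind.yoneda.map f ≫ x) y = Ind.yoneda.map (f ▷ B) ≫ mul x y := by
  rw [← tensorHom_id, map_mul, Functor.map_id, Category.id_comp]

lemma unitElement_comp {X : Ind C} (f : 𝟙_ (Ind C) ⟶ X) : unitElement C ≫ f = f :=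
  Category.id_comp f

/-- The extension of a lax monoidal functor to ind-objects is lax monoidal. -/
instance mapLaxMonoidal : (Ind.map G).LaxMonoidal where
  ε := Ind.yoneda.map (ε G) ≫ mapElement G (unitElement D)
  μ := mapTensor G
  μ_natural_left f F := map_tensor_hom_ext G fun M N x y => by
    rw [← Category.assoc, ← Category.assoc, mul_whiskerRight, ← mapElement_comp, mul_mapTensor,
      mul_mapTensor, Category.assoc, ← mapElement_comp, mul_whiskerRight]
  μ_natural_right F f := map_tensor_hom_ext G fun M N x y => by
    rw [← Category.assoc, ← Category.assoc, mul_whiskerLeft, ← mapElement_comp, mul_mapTensor,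
      mul_mapTensor, Category.assoc, ← mapElement_comp, mul_whiskerLeft]
  associativity F F' F'' := map_tensor_hom_ext₃ G fun M N P x y z => by
    rw [← Category.assoc, mul_whiskerRight, mul_mapTensor, map_mul_left, Category.assoc,
      ← Category.assoc (mul _ _), mul_mapTensor, Category.assoc, ← mapElement_comp, mul_associator,
      ← map_mapElement, ← Category.assoc (mul _ _), mul_associator, Category.assoc,
      ← Category.assoc (mul _ _), mul_whiskerLeft, mul_mapTensor, map_mul_right, Category.assoc,
      mul_mapTensor]
    simp only [← Category.assoc, ← Functor.map_comp]
    simp only [Category.assoc, associativity]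
  left_unitality F := tensor_hom_ext fun A B x y => by
    obtain ⟨x, rfl⟩ := exists_eq_unitElement x
    obtain ⟨N, g, y, rfl⟩ := exists_eq_mapElement G y
    rw [← map_mul, Category.assoc, Category.assoc, mul_leftUnitor,
      ← Category.assoc (mul _ _), mul_whiskerRight, unitElement_comp, map_mul_left, Category.assoc,
      ← Category.assoc (mul _ _), mul_mapTensor, Category.assoc, ← mapElement_comp,
      mul_leftUnitor, ← map_mapElement, left_unitality]
    simp only [Functor.map_comp, Category.assoc]
  right_unitality F := tensor_hom_ext fun A B y x => by
    obtain ⟨x, rfl⟩ := exists_eq_unitElement x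
    obtain ⟨N, g, y, rfl⟩ := exists_eq_mapElement G y
    rw [← map_mul, Category.assoc, Category.assoc, mul_rightUnitor,
      ← Category.assoc (mul _ _), mul_whiskerLeft, unitElement_comp, map_mul_right, Category.assoc,
      ← Category.assoc (mul _ _), mul_mapTensor, Category.assoc, ← mapElement_comp,
      mul_rightUnitor, ← map_mapElement, right_unitality]
    simp only [Functor.map_comp, Category.assoc]

end lax
end CategoryTheory.Ind

/-! ### Universal arrows and monoidal adjunctions -/

namespace CategoryTheory
open Functor.LaxMonoidal Functor.OplaxMonoidal

section universalArrow
variable {C D : Type*} [Category* C] [Category* D] (G : D ⥤ C)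

/-- A universal arrow from `A` to the functor `G`: every arrow from `A` to a value of `G` factors
uniquely through it. -/
def IsUniversalArrow {A : C} {M : D} (c : A ⟶ G.obj M) : Prop :=
  ∀ N : D, Function.Bijective fun f : M ⟶ N => c ≫ G.map f

variable {G}

lemma IsUniversalArrow.comp_iso {A A' : C} {M M' : D} {c : A ⟶ G.obj M}
    (h : IsUniversalArrow G c) (e : A' ⟶ A) [IsIso e] (f : M ⟶ M') [IsIso f] :
    IsUniversalArrow G (e ≫ c ≫ G.map f) := by
  intro N
  have h1 : Function.Bijective fun g : M' ⟶ N => f ≫ g :=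
    ⟨fun _ _ h => (cancel_epi f).1 h, fun g => ⟨inv f ≫ g, by simp⟩⟩
  have h2 : Function.Bijective fun g : A ⟶ G.obj N => e ≫ g :=
    ⟨fun _ _ h => (cancel_epi e).1 h, fun g => ⟨inv e ≫ g, by simp⟩⟩
  convert h2.comp ((h N).comp h1) using 2
  simp

variable {F : C ⥤ D}

lemma isUniversalArrow_unit (adj : F ⊣ G) (A : C) : IsUniversalArrow G (adj.unit.app A) :=
  fun N => by
    simpa [adj.homEquiv_unit] using! (adj.homEquiv A N).bijective

/-- An arrow is universal exactly if its adjunct is an isomorphism. This turns invertibility of the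
structure maps of an oplax left adjoint into statements on the right adjoint. -/
lemma isUniversalArrow_iff_isIso (adj : F ⊣ G) {A : C} {M : D} (c : A ⟶ G.obj M) :
    IsUniversalArrow G c ↔ IsIso ((adj.homEquiv A M).symm c) := by
  constructor
  · intro h
    refine isIso_of_coyoneda_map_bijective _ fun N => ?_
    have h1 := (Function.Bijective.of_comp_iff' (adj.homEquiv A N).bijective
      (fun f : M ⟶ N => (adj.homEquiv A M).symm c ≫ f)).1
    refine h1 ?_
    convert h N using 2 with f
    simp [adj.homEquiv_naturality_right]
  · intro h
    have := (isUniversalArrow_unit adj A).comp_iso (𝟙 A) ((adj.homEquiv A M).symm c)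
    rw [Category.id_comp] at this
    convert this
    exact ((adj.homEquiv_unit A M _).symm.trans (Equiv.apply_symm_apply _ _)).symm

end universalArrow

section oplax
variable {C D : Type*} [Category* C] [Category* D] [MonoidalCategory C] [MonoidalCategory D]
  {F : C ⥤ D} {G : D ⥤ C} [G.LaxMonoidal] [F.OplaxMonoidal]

/-- The comparison `F (X ⊗ Y) ⟶ F X ⊗ F Y` is an isomorphism as soon as universal arrows out of `X`
and `Y` have a universal product. -/
lemma isIso_δ_of_isUniversalArrow (adj : F ⊣ G) [adj.IsMonoidal] {X Y : C} {M N : D}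
    {c : X ⟶ G.obj M} {d : Y ⟶ G.obj N}
    (hc : IsUniversalArrow G c) (hd : IsUniversalArrow G d)
    (h : IsUniversalArrow G ((c ⊗ₘ d) ≫ μ G M N)) : IsIso (δ F X Y) := by
  have hc' := (isUniversalArrow_iff_isIso adj c).1 hc
  have hd' := (isUniversalArrow_iff_isIso adj d).1 hd
  have h' := (isUniversalArrow_iff_isIso adj _).1 h
  have : (adj.homEquiv _ _).symm ((c ⊗ₘ d) ≫ μ G M N) =
      δ F X Y ≫ ((adj.homEquiv _ _).symm c ⊗ₘ (adj.homEquiv _ _).symm d) := by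
    -- an arrow factors through the unit by its adjunct
    have h1 {X : C} {M : D} (c : X ⟶ G.obj M) :
        adj.unit.app X ≫ G.map ((adj.homEquiv _ _).symm c) = c :=
      (adj.homEquiv_unit _ _ _).symm.trans (Equiv.apply_symm_apply _ _)
    rw [Equiv.symm_apply_eq, adj.homEquiv_unit, Functor.map_comp,
      Adjunction.unit_app_tensor_comp_map_δ_assoc, ← μ_natural, tensorHom_comp_tensorHom_assoc]
    exact congrArg₂ (fun c d => (c ⊗ₘ d) ≫ μ G M N) (h1 c).symm (h1 d).symm
  rw [this] at h'
  exact IsIso.of_isIso_comp_right _ ((adj.homEquiv _ _).symm c ⊗ₘ (adj.homEquiv _ _).symm d)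

lemma isIso_η_of_isUniversalArrow (adj : F ⊣ G) [adj.IsMonoidal]
    (h : IsUniversalArrow G (ε G)) : IsIso (η F) := by
  have := (isUniversalArrow_iff_isIso adj _).1 h
  rw [← Adjunction.map_ε_comp_counit_app_unit adj]
  rwa [adj.homEquiv_counit] at this

end oplax

section braided
variable {C D : Type*} [Category* C] [Category* D] [MonoidalCategory C] [MonoidalCategory D]
  [BraidedCategory C] [BraidedCategory D]
  {F : C ⥤ D} {G : D ⥤ C} [G.LaxBraided] [F.OplaxMonoidal]

/-- The left adjoint of a lax braided functor is compatible with the braidings. -/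
lemma δ_braiding (adj : F ⊣ G) [adj.IsMonoidal] (X Y : C) :
    δ F X Y ≫ (β_ (F.obj X) (F.obj Y)).hom = F.map (β_ X Y).hom ≫ δ F Y X := by
  apply (adj.homEquiv _ _).injective
  rw [adj.homEquiv_naturality_left, adj.homEquiv_unit, adj.homEquiv_unit, Functor.map_comp,
    Adjunction.unit_app_tensor_comp_map_δ_assoc, Adjunction.unit_app_tensor_comp_map_δ,
    Functor.LaxBraided.braided, BraidedCategory.braiding_naturality_assoc]

end braided

section closed
variable {C D : Type*} [Category* C] [Category* D] [MonoidalCategory C] [MonoidalCategory D]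
  [MonoidalClosed C] [MonoidalClosed D]
  {F : C ⥤ D} {G : D ⥤ C} (adj : F ⊣ G) [G.LaxMonoidal] [F.Monoidal] [adj.IsMonoidal]

/-- For a strong monoidal left adjoint the adjunction holds for internal homs: the maps from `Z` to
either side are the maps `F (X ⊗ Z) ≅ F X ⊗ F Z ⟶ Y`. -/
lemma isIso_curry_ihom (X : C) (Y : D) :
    IsIso (MonoidalClosed.curry (A := X) (Y := G.obj ((ihom (F.obj X)).obj Y)) (X := G.obj Y)
      (adj.homEquiv _ _ (δ F _ _ ≫ F.obj X ◁ adj.counit.app ((ihom (F.obj X)).obj Y) ≫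
        (ihom.ev (F.obj X)).app Y))) := by
  refine isIso_of_yoneda_map_bijective _ fun Z => ?_
  -- the chain of bijections which identifies the maps from `Z` to both sides
  let e : (Z ⟶ G.obj ((ihom (F.obj X)).obj Y)) ≃ (Z ⟶ (ihom X).obj (G.obj Y)) :=
    (adj.homEquiv _ _).symm.trans (((ihom.adjunction (F.obj X)).homEquiv _ _).symm.trans
      (((asIso (δ F X Z)).symm.homFromEquiv (Z := Y)).trans ((adj.homEquiv _ _).trans
        ((ihom.adjunction X).homEquiv _ _))))
  convert e.bijective using 2 with f
  have h1 : δ F X Z ≫ MonoidalClosed.uncurry ((adj.homEquiv _ _).symm f) =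
      F.map (X ◁ f) ≫ δ F _ _ ≫ F.obj X ◁ adj.counit.app ((ihom (F.obj X)).obj Y) ≫
        (ihom.ev (F.obj X)).app Y := by
    rw [← δ_natural_right_assoc, MonoidalClosed.uncurry_eq, adj.homEquiv_counit,
      MonoidalCategory.whiskerLeft_comp, Category.assoc]
  change f ≫ _ = MonoidalClosed.curry (adj.homEquiv _ _ (δ F X Z ≫
    MonoidalClosed.uncurry ((adj.homEquiv _ _).symm f)))
  rw [h1, adj.homEquiv_naturality_left, MonoidalClosed.curry_natural_left]

end closed
end CategoryTheory

namespace CategoryTheory.Ind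
open Functor.LaxMonoidal Functor.OplaxMonoidal
variable {C : Type u} [Category.{v} C] {D : Type w} [Category.{v} D]
  [MonoidalCategory C] [MonoidalCategory D]

/-- Universal arrows to `G` are universal arrows to the extension of `G`. -/
lemma isUniversalArrow_map (G : D ⥤ C) {A : C} {M : D} {c : A ⟶ G.obj M}
    (hc : IsUniversalArrow G c) :
    IsUniversalArrow (Ind.map G) (Ind.yoneda.map c ≫ mapElement G (𝟙 (Ind.yoneda.obj M))) := by
  intro F
  convert bijective_mapElement G c hc F using 2 with z
  rw [Category.assoc, ← mapElement_comp, Category.id_comp]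

variable [SymmetricCategory C] [SymmetricCategory D] (G : D ⥤ C) [G.LaxBraided]

instance : (Ind.map G).LaxBraided where
  braided F F' := map_tensor_hom_ext G fun M N x y => by
    change _ ≫ mapTensor G F F' ≫ _ = _ ≫ _ ≫ mapTensor G F' F
    rw [← Category.assoc, mul_mapTensor, Category.assoc, ← mapElement_comp, mul_braiding,
      ← map_mapElement, ← Category.assoc (mul _ _), mul_braiding, Category.assoc, mul_mapTensor]
    simp only [← Category.assoc, ← Functor.map_comp, Functor.LaxBraided.braided]

variable [G.IsRightAdjoint]

/-- Extension of a monoidal adjunction to ind-objects: if `G` is lax braided and universal arrows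
to `G` are stable under tensor products, then the left adjoint of the extension of `G` to
ind-objects is strong monoidal. -/
theorem exists_braided_leftAdjoint [MonoidalClosed (Ind C)] [MonoidalClosed (Ind D)]
    (hε : IsUniversalArrow G (ε G))
    (hμ : ∀ {A B : C} {M N : D} (c : A ⟶ G.obj M) (d : B ⟶ G.obj N), IsUniversalArrow G c →
      IsUniversalArrow G d → IsUniversalArrow G ((c ⊗ₘ d) ≫ μ G M N)) :
    ∃ (F : Ind C ⥤ Ind D) (adj : F ⊣ Ind.map G) (_ : F.Braided), adj.IsMonoidal := by
  have := isRightAdjoint_map G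
  let adj := Adjunction.ofIsRightAdjoint (Ind.map G)
  let F := (Ind.map G).leftAdjoint
  let : F.OplaxMonoidal := adj.leftAdjointOplaxMonoidal
  have hadj : adj.IsMonoidal := inferInstance
  have : F.IsLeftAdjoint := adj.isLeftAdjoint
  have hη : IsIso (η F) := by
    refine isIso_η_of_isUniversalArrow adj ?_
    exact isUniversalArrow_map G hε
  -- the case of representable ind-objects
  have h1 : ∀ A B : C, IsIso (δ F (Ind.yoneda.obj A) (Ind.yoneda.obj B)) := by
    intro A B
    have hA := isUniversalArrow_unit (Adjunction.ofIsRightAdjoint G) A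
    have hB := isUniversalArrow_unit (Adjunction.ofIsRightAdjoint G) B
    refine isIso_δ_of_isUniversalArrow adj (isUniversalArrow_map G hA)
      (isUniversalArrow_map G hB) ?_
    have h := (isUniversalArrow_map G (hμ _ _ hA hB)).comp_iso (inv (tensorComparison A B))
      (tensorComparison _ _)
    convert h using 1
    rw [IsIso.eq_inv_comp, Category.assoc, ← mapElement_comp, Category.id_comp, ← mul_id,
      ← Category.assoc, mul_comp, Category.id_comp, Category.id_comp, ← map_mul,
      Functor.map_comp, Category.assoc, Category.assoc]
    erw [mul_mapTensor]
    rw [mul_id]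
  -- both sides of `δ` commute with filtered colimits in each variable, as tensoring does in a closed
  -- category
  let τ (X : Ind C) : tensorLeft X ⋙ F ⟶ F ⋙ tensorLeft (F.obj X) :=
    { app := fun Y => δ F X Y
      naturality := fun _ _ f => (δ_natural_right F X f).symm }
  let τ' (Y : Ind C) : tensorRight Y ⋙ F ⟶ F ⋙ tensorRight (F.obj Y) :=
    { app := fun X => δ F X Y
      naturality := fun _ _ f => (δ_natural_left F f Y).symm }
  have h2 (A : C) (Y : Ind C) : IsIso (δ F (Ind.yoneda.obj A) Y) :=
    isIso_app_of_representable (τ (Ind.yoneda.obj A)) (fun B => h1 A B) Y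
  have hδ (X Y : Ind C) : IsIso (δ F X Y) :=
    isIso_app_of_representable (τ' Y) (fun A => h2 A Y) X
  let m : F.Monoidal := Functor.Monoidal.ofOplaxMonoidal F
  refine ⟨F, adj, { m with braided := fun X Y => ?_ }, hadj⟩
  rw [← cancel_epi (δ F X Y), ← cancel_mono (δ F Y X)]
  simp only [Category.assoc]
  erw [Functor.Monoidal.δ_μ_assoc, Functor.Monoidal.μ_δ, Category.comp_id]
  exact (δ_braiding adj X Y).symm

end CategoryTheory.Ind

/-! ### Quotients, closed submodules and internal homs of Banach modules -/

namespace Ban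
open CategoryTheory Limits
open scoped NNReal
variable {R : Type u} [BanachRing R] {k : Flavour}

section quotient
variable (M : Ban R k) (S : Submodule R M) [hS : IsClosed (S : Set M)]

instance : BoundedScalars R (M ⧸ S) where
  exists_nnnorm_smul_le := by
    obtain ⟨C, hC⟩ := BoundedScalars.exists_nnnorm_smul_le R M
    refine ⟨C, fun a x => le_of_forall_pos_le_add fun ε hε => ?_⟩
    obtain ⟨δ, hδ, hδε⟩ : ∃ δ : ℝ≥0, 0 < δ ∧ C * (‖a‖₊ * δ) ≤ ε := by
      refine ⟨ε / (C * ‖a‖₊ + 1), by positivity, ?_⟩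
      rw [← mul_assoc, ← mul_div_assoc, div_le_iff₀ (by positivity), mul_comm]
      gcongr
      exact le_self_add
    obtain ⟨m, rfl, hm⟩ := Submodule.Quotient.norm_mk_lt (S := S) x (ε := δ) (by exact_mod_cast hδ)
    have hm' : ‖m‖₊ ≤ ‖(Submodule.Quotient.mk m : M ⧸ S)‖₊ + δ := by exact_mod_cast hm.le
    calc ‖a • (Submodule.Quotient.mk m : M ⧸ S)‖₊ ≤ ‖a • m‖₊ := Submodule.Quotient.norm_mk_le S (a • m)
      _ ≤ C * (‖a‖₊ * ‖m‖₊) := hC a m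
      _ ≤ C * (‖a‖₊ * (‖(Submodule.Quotient.mk m : M ⧸ S)‖₊ + δ)) := by gcongr
      _ ≤ _ := by rw [mul_add, mul_add]; gcongr

instance : FlavouredNorm k (M ⧸ S) where
  nnnorm_add_le_join x y := by
    have hc : Continuous fun e : ℝ≥0 => k.join (‖x‖₊ + e) (‖y‖₊ + e) :=
      k.continuous_join.comp
        ((continuous_const.add continuous_id).prodMk (continuous_const.add continuous_id))
    have h0 : Filter.Tendsto (fun e : ℝ≥0 => k.join (‖x‖₊ + e) (‖y‖₊ + e))
        (nhdsWithin 0 (Set.Ioi 0)) (nhds (k.join ‖x‖₊ ‖y‖₊)) := by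
      simpa using (hc.tendsto 0).mono_left nhdsWithin_le_nhds
    refine ge_of_tendsto h0 (Filter.eventually_of_mem self_mem_nhdsWithin fun e he => ?_)
    obtain ⟨m, rfl, hm⟩ := Submodule.Quotient.norm_mk_lt (S := S) x (ε := e) (by exact_mod_cast he)
    obtain ⟨n, rfl, hn⟩ := Submodule.Quotient.norm_mk_lt (S := S) y (ε := e) (by exact_mod_cast he)
    refine (Submodule.Quotient.norm_mk_le S (m + n)).trans ?_
    refine (FlavouredNorm.nnnorm_add_le_join k m n).trans (k.join_mono ?_ ?_)
    · exact_mod_cast hm.le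
    · exact_mod_cast hn.le

/-- The quotient of a Banach module by a closed submodule, with the quotient norm. -/
def quot : Ban R k where
  carrier := M ⧸ S

/-- The projection to the quotient. -/
def quotMk : M ⟶ quot M S where
  lin := S.mkQ
  bounded := ⟨1, fun m => by rw [one_mul]; exact Submodule.Quotient.norm_mk_le S m⟩

lemma quotMk_surjective : Function.Surjective (quotMk M S).lin := S.mkQ_surjective

variable {M S}

/-- The quotient norm is an infimum over representatives, so a bound by all representatives is a
bound by the quotient norm. -/
lemma le_mul_nnnorm_quot {x : quot M S} {a C : ℝ≥0}
    (h : ∀ m, (quotMk M S).lin m = x → a ≤ C * ‖m‖₊) : a ≤ C * ‖x‖₊ := by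
  refine le_of_forall_pos_le_add fun ε hε => ?_
  obtain ⟨m, hm, hm'⟩ := Submodule.Quotient.norm_mk_lt (S := S) x (ε := ε / (C + 1))
    (div_pos (by exact_mod_cast hε) (by positivity))
  refine (h m hm).trans ?_
  have hm'' : ‖m‖₊ ≤ ‖x‖₊ + ε / (C + 1) := by exact_mod_cast hm'.le
  calc C * ‖m‖₊ ≤ C * (‖x‖₊ + ε / (C + 1)) := by gcongr
    _ ≤ _ := by
      rw [mul_add]
      gcongr
      rw [← mul_div_assoc, div_le_iff₀ (by positivity), mul_comm]
      gcongr
      exact le_self_add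

/-- The map out of a quotient. -/
def quotLift {N : Ban R k} (f : M ⟶ N) (h : ∀ m ∈ S, f.lin m = 0) : quot M S ⟶ N where
  lin := S.liftQ f.lin h
  bounded := f.bounded.imp fun C hC x => le_mul_nnnorm_quot fun m hm => by
    subst hm
    exact hC m

lemma quotMk_quotLift {N : Ban R k} (f : M ⟶ N) (h : ∀ m ∈ S, f.lin m = 0) :
    quotMk M S ≫ quotLift f h = f := rfl

lemma epi_of_surjective {M N : Ban R k} (f : M ⟶ N) (hf : Function.Surjective f.lin) : Epi f where
  left_cancellation g h e := hom_ext fun n => by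
    obtain ⟨m, rfl⟩ := hf n
    exact congrArg (fun t : M ⟶ _ => t.lin m) e

end quotient

section coequalizer
variable {M N : Ban R k} (f g : M ⟶ N)

/-- The closure of the image of `f - g`; the quotient by it is the coequalizer. -/
def coeqSubmodule : Submodule R N := (LinearMap.range (f.lin - g.lin)).topologicalClosure

instance : IsClosed (coeqSubmodule f g : Set N) := Submodule.isClosed_topologicalClosure _

lemma sub_mem_coeqSubmodule (m : M) : f.lin m - g.lin m ∈ coeqSubmodule f g :=
  Submodule.le_topologicalClosure _ ⟨m, rfl⟩

lemma isClosed_ker {N L : Ban R k} (h : N ⟶ L) : IsClosed (LinearMap.ker h.lin : Set N) :=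
  isClosed_singleton.preimage h.continuous

lemma eq_zero_of_mem_coeqSubmodule {L : Ban R k} (h : N ⟶ L) (e : f ≫ h = g ≫ h) (n : N)
    (hn : n ∈ coeqSubmodule f g) : h.lin n = 0 := by
  have h1 : coeqSubmodule f g ≤ LinearMap.ker h.lin := by
    refine Submodule.topologicalClosure_minimal _ ?_ (isClosed_ker h)
    rintro _ ⟨m, rfl⟩
    have : h.lin (f.lin m) = h.lin (g.lin m) := congrArg (fun t : M ⟶ L => t.lin m) e
    simp [this]
  exact h1 hn

instance : HasColimitsOfShape WalkingParallelPair (Ban R k) := by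
  have : ∀ {M N : Ban R k} {f g : M ⟶ N}, HasColimit (parallelPair f g) := fun {M N f g} =>
    ⟨⟨⟨Cofork.ofπ (quotMk N (coeqSubmodule f g)) (hom_ext fun m =>
        (Submodule.Quotient.eq _).2 (sub_mem_coeqSubmodule f g m)),
      Cofork.IsColimit.mk _
        (fun s => quotLift s.π (eq_zero_of_mem_coeqSubmodule f g s.π s.condition))
        (fun s => quotMk_quotLift _ _)
        (fun s m hm => by
          have := epi_of_surjective _ (quotMk_surjective N (coeqSubmodule f g))
          rw [← cancel_epi (quotMk N (coeqSubmodule f g)), quotMk_quotLift]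
          exact hm)⟩⟩⟩
  exact hasCoequalizers_of_hasColimit_parallelPair _

instance : HasFiniteColimits (Ban R k) :=
  hasFiniteColimits_of_hasCoequalizers_and_finite_coproducts

end coequalizer

section equalizer

/-- A closed submodule of a Banach module. -/
def sub (M : Ban R k) (S : Submodule R M) [hS : IsClosed (S : Set M)] : Ban R k where
  carrier := S
  complete := hS.completeSpace_coe
  scalars := ⟨(BoundedScalars.exists_nnnorm_smul_le R M).imp fun _ hC a m => hC a m.1⟩
  flavour := ⟨fun x y => FlavouredNorm.nnnorm_add_le_join k x.1 y.1⟩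

/-- The inclusion of a closed submodule. -/
def subι (M : Ban R k) (S : Submodule R M) [hS : IsClosed (S : Set M)] : sub M S ⟶ M where
  lin := S.subtype
  bounded := ⟨1, fun m => by rw [one_mul]; exact le_rfl⟩

/-- The map into a closed submodule. -/
def subLift {M N : Ban R k} {S : Submodule R M} [hS : IsClosed (S : Set M)] (f : N ⟶ M)
    (h : ∀ n, f.lin n ∈ S) : N ⟶ sub M S where
  lin := f.lin.codRestrict S h
  bounded := f.bounded

lemma isClosed_eqLocus {M N : Ban R k} (f g : M ⟶ N) :
    IsClosed (LinearMap.eqLocus f.lin g.lin : Set M) :=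
  isClosed_eq f.continuous g.continuous

instance : HasLimitsOfShape WalkingParallelPair (Ban R k) := by
  have : ∀ {M N : Ban R k} {f g : M ⟶ N}, HasLimit (parallelPair f g) := fun {M N f g} =>
    have := isClosed_eqLocus f g
    ⟨⟨⟨Fork.ofι (subι M (LinearMap.eqLocus f.lin g.lin)) (hom_ext fun m => m.2),
      Fork.IsLimit.mk _
        (fun s => subLift s.ι fun n => congrArg (fun t : s.pt ⟶ _ => t.lin n) s.condition)
        (fun s => rfl)
        (fun s m hm => hom_ext fun n => Subtype.ext (congrArg (fun t : s.pt ⟶ _ => t.lin n) hm))⟩⟩⟩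
  exact hasEqualizers_of_hasLimit_parallelPair _

end equalizer

section internalHom
variable {k' : Flavour} (M : Ban R k') (N : Ban R k)

/-- The bounded linear maps, as a submodule of all linear maps. The flavours of source and target
need not agree. -/
def boundedMaps : Submodule R (M →ₗ[R] N) where
  carrier := {f | ∃ C : ℝ≥0, ∀ m, ‖f m‖₊ ≤ C * ‖m‖₊}
  add_mem' := by
    rintro f g ⟨C, hC⟩ ⟨D, hD⟩
    refine ⟨C + D, fun m => (nnnorm_add_le _ _).trans ?_⟩
    rw [add_mul]
    exact add_le_add (hC m) (hD m)
  zero_mem' := ⟨0, by simp⟩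
  smul_mem' := by
    rintro a f ⟨C, hC⟩
    obtain ⟨D, hD⟩ := BoundedScalars.exists_nnnorm_smul_le R N
    refine ⟨D * (‖a‖₊ * C), fun m => (hD a _).trans ?_⟩
    rw [mul_assoc, mul_assoc]
    gcongr
    exact hC m

variable {M N}

/-- The operator norm: the smallest bound. The infimum is over a non-empty set, by boundedness. -/
def opNNNorm (f : boundedMaps M N) : ℝ≥0 := sInf {C | ∀ m, ‖f.1 m‖₊ ≤ C * ‖m‖₊}

lemma le_opNNNorm (f : boundedMaps M N) (m : M) : ‖f.1 m‖₊ ≤ opNNNorm f * ‖m‖₊ := by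
  rcases eq_or_ne ‖m‖₊ 0 with h | h
  · obtain ⟨C, hC⟩ := f.2
    simpa [h] using hC m
  · rw [← div_le_iff₀ (pos_iff_ne_zero.2 h)]
    refine le_csInf f.2 fun C hC => ?_
    rw [div_le_iff₀ (pos_iff_ne_zero.2 h)]
    exact hC m

lemma opNNNorm_le {f : boundedMaps M N} {C : ℝ≥0} (h : ∀ m, ‖f.1 m‖₊ ≤ C * ‖m‖₊) :
    opNNNorm f ≤ C := csInf_le' h

lemma opNNNorm_join (f g : boundedMaps M N) :
    opNNNorm (f + g) ≤ k.join (opNNNorm f) (opNNNorm g) := opNNNorm_le fun m => by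
  rw [mul_comm, k.mul_join, mul_comm, mul_comm ‖m‖₊]
  exact (FlavouredNorm.nnnorm_add_le_join k _ _).trans
    (k.join_mono (le_opNNNorm f m) (le_opNNNorm g m))

instance : NormedAddCommGroup (boundedMaps M N) :=
  AddGroupNorm.toNormedAddCommGroup
    { toFun := fun f => opNNNorm f
      map_zero' := by
        have : opNNNorm (0 : boundedMaps M N) ≤ 0 := opNNNorm_le (by simp)
        exact_mod_cast le_antisymm this zero_le
      add_le' := fun f g => by
        exact_mod_cast (opNNNorm_join f g).trans (k.join_le_add _ _)
      neg' := fun f => by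
        have h : ∀ f : boundedMaps M N, opNNNorm (-f) ≤ opNNNorm f := fun f =>
          opNNNorm_le fun m => by simpa using le_opNNNorm f m
        exact_mod_cast le_antisymm (h f) (by simpa using h (-f))
      eq_zero_of_map_eq_zero' := fun f hf => by
        have hf : opNNNorm f = 0 := by exact_mod_cast hf
        refine Subtype.ext (LinearMap.ext fun m => ?_)
        simpa [hf] using le_opNNNorm f m }

instance : BoundedScalars R (boundedMaps M N) where
  exists_nnnorm_smul_le := by
    obtain ⟨D, hD⟩ := BoundedScalars.exists_nnnorm_smul_le R N
    refine ⟨D, fun a f => opNNNorm_le fun m => (hD a _).trans ?_⟩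
    rw [mul_assoc, mul_assoc]
    gcongr
    exact le_opNNNorm f m

instance : FlavouredNorm k (boundedMaps M N) where
  nnnorm_add_le_join := opNNNorm_join

/-- A Cauchy sequence of bounded maps converges pointwise; its limit is bounded and the convergence is
uniform for the operator norm. -/
instance : CompleteSpace (boundedMaps M N) := by
  refine Metric.complete_of_cauchySeq_tendsto fun f hf => ?_
  have hf' : ∀ ε : ℝ≥0, 0 < ε → ∃ n, ∀ i ≥ n, ∀ j ≥ n, ∀ m,
      ‖(f i).1 m - (f j).1 m‖₊ ≤ ε * ‖m‖₊ := by
    intro ε hε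
    obtain ⟨n, hn⟩ := Metric.cauchySeq_iff.1 hf ε (by exact_mod_cast hε)
    refine ⟨n, fun i hi j hj m => (le_opNNNorm (f i - f j) m).trans ?_⟩
    have := hn i hi j hj
    rw [dist_eq_norm] at this
    gcongr
    exact_mod_cast this.le
  have hc : ∀ m, CauchySeq fun i => (f i).1 m := by
    intro m
    refine Metric.cauchySeq_iff.2 fun ε hε => ?_
    obtain ⟨n, hn⟩ := hf' (⟨ε, hε.le⟩ / (‖m‖₊ + 1)) (div_pos (by exact_mod_cast hε) (by positivity))
    refine ⟨n, fun i hi j hj => ?_⟩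
    rw [dist_eq_norm]
    have h1 : ‖(f i).1 m - (f j).1 m‖ ≤ ε / (‖m‖ + 1) * ‖m‖ := by exact_mod_cast hn i hi j hj m
    refine h1.trans_lt ?_
    rw [div_mul_eq_mul_div, div_lt_iff₀ (by positivity)]
    nlinarith [norm_nonneg m]
  choose g hg using fun m => cauchySeq_tendsto_of_complete (hc m)
  let g' : M →ₗ[R] N :=
    { toFun := g
      map_add' := fun x y => tendsto_nhds_unique (hg (x + y)) (by
        simpa using (hg x).add (hg y))
      map_smul' := fun a x => tendsto_nhds_unique (hg (a • x)) (by
        simpa using (hg x).const_smul a) }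
  have hfg : ∀ ε : ℝ≥0, 0 < ε → ∃ n, ∀ i ≥ n, ∀ m, ‖(f i).1 m - g' m‖₊ ≤ ε * ‖m‖₊ := by
    intro ε hε
    obtain ⟨n, hn⟩ := hf' ε hε
    refine ⟨n, fun i hi m => ?_⟩
    have ht : Filter.Tendsto (fun j => ‖(f i).1 m - (f j).1 m‖₊) Filter.atTop
        (nhds ‖(f i).1 m - g' m‖₊) := (tendsto_const_nhds.sub (hg m)).nnnorm
    exact le_of_tendsto ht (Filter.eventually_atTop.2 ⟨n, fun j hj => hn i hi j hj m⟩)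
  have hb : g' ∈ boundedMaps M N := by
    obtain ⟨n, hn⟩ := hfg 1 one_pos
    have h1 : (f n).1 - g' ∈ boundedMaps M N := ⟨1, fun m => hn n le_rfl m⟩
    simpa using (boundedMaps M N).sub_mem (f n).2 h1
  refine ⟨⟨g', hb⟩, Metric.tendsto_atTop.2 fun ε hε => ?_⟩
  obtain ⟨n, hn⟩ := hfg ⟨ε / 2, (half_pos hε).le⟩ (half_pos hε)
  refine ⟨n, fun i hi => ?_⟩
  rw [dist_eq_norm]
  have h2 : ‖f i - ⟨g', hb⟩‖₊ ≤ ⟨ε / 2, (half_pos hε).le⟩ := opNNNorm_le (hn i hi)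
  have h3 : ‖f i - ⟨g', hb⟩‖ ≤ ε / 2 := h2
  linarith

variable (M N) in
/-- The Banach module of bounded linear maps, with the operator norm. It inherits the flavour of the
target, whatever the flavour of the source. -/
def internalHom : Ban R k where
  carrier := boundedMaps M N

/-- The map of Banach modules attached to a bounded bilinear map. -/
def bilin (L : Ban R k) (f : L →ₗ[R] M →ₗ[R] N)
    (h : ∃ C : ℝ≥0, ∀ l m, ‖f l m‖₊ ≤ C * (‖l‖₊ * ‖m‖₊)) : L ⟶ internalHom M N where
  lin := f.codRestrict (boundedMaps M N) fun l => h.imp' (· * ‖l‖₊) fun C hC m => by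
    rw [mul_assoc]
    exact hC l m
  bounded := h.imp fun C hC l => opNNNorm_le fun m => by
    rw [mul_assoc]
    exact hC l m

/-- The bilinear map attached to a map into a module of bounded linear maps. -/
def unbilin {L : Ban R k} (g : L ⟶ internalHom M N) : L →ₗ[R] M →ₗ[R] N :=
  (boundedMaps M N).subtype.comp g.lin

lemma unbilin_bound {L : Ban R k} (g : L ⟶ internalHom M N) :
    ∃ C : ℝ≥0, ∀ l m, ‖unbilin g l m‖₊ ≤ C * (‖l‖₊ * ‖m‖₊) :=
  g.bounded.imp fun C hC l m => (le_opNNNorm (g.lin l) m).trans (by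
    rw [← mul_assoc]
    gcongr
    exact hC l)

lemma flip_bound {k₁ k₂ : Flavour} {L : Ban R k₁} {M : Ban R k₂} {f : L →ₗ[R] M →ₗ[R] N}
    (h : ∃ C : ℝ≥0, ∀ l m, ‖f l m‖₊ ≤ C * (‖l‖₊ * ‖m‖₊)) :
    ∃ C : ℝ≥0, ∀ m l, ‖f.flip m l‖₊ ≤ C * (‖m‖₊ * ‖l‖₊) :=
  h.imp fun C hC m l => by
    rw [mul_comm ‖m‖₊]
    exact hC l m

lemma comp_tmulₗ_bound {M L N : Ban R k} (f : tensor M L ⟶ N) : ∃ C : ℝ≥0, ∀ m l,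
    ‖(tmulₗ M L).compr₂ f.lin m l‖₊ ≤ C * (‖m‖₊ * ‖l‖₊) :=
  f.bounded.imp fun _ hC m l => (hC _).trans (mul_le_mul' le_rfl (tmul_bound m l))

variable [IsUltrametricDist R]

/-- The adjunction between tensor products and bounded linear maps. -/
def tensorHomEquiv {M L N : Ban R k} : (M ⊗ L ⟶ N) ≃ (L ⟶ internalHom M N) where
  toFun f := bilin L ((tmulₗ M L).compr₂ f.lin).flip (flip_bound (comp_tmulₗ_bound f))
  invFun g := lift (unbilin g).flip (flip_bound (unbilin_bound g))
  left_inv f := tensor_ext fun m l =>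
    lift_tmul _ (flip_bound (unbilin_bound (bilin L _ (flip_bound (comp_tmulₗ_bound f))))) m l
  right_inv g := hom_ext fun l => Subtype.ext (LinearMap.ext fun m =>
    lift_tmul _ (flip_bound (unbilin_bound g)) m l)

instance (M : Ban R k) : (tensorLeft M).IsLeftAdjoint :=
  (Adjunction.adjunctionOfEquivRight (F := tensorLeft M) (G_obj := internalHom M)
    (fun _ _ => tensorHomEquiv) (fun _ L' N f g => hom_ext fun l =>
      Subtype.ext (LinearMap.ext fun m => congrArg (Hom.lin (M := M ⊗ L') (N := N) g)
        (whiskerLeft_tmul f m l)))).isLeftAdjoint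

end internalHom
end Ban

/-! ### The lax inclusion of non-Archimedean modules, and the modules `P(M)` -/

namespace Ban
open CategoryTheory Limits Functor.LaxMonoidal
open scoped NNReal
variable {R : Type u} [BanachRing R] {k k' : Flavour}

section lax
variable [IsUltrametricDist R]

lemma compare_tmul (M N : Ban R .nonArch) (m : M) (n : N) :
    (compare M N).lin (tmul (M := (incl R).obj M) (N := (incl R).obj N) m n) =
      tmul (M := M) (N := N) m n :=
  lift_tmul _ _ _ _

lemma compareUnit_whiskerRight (M : Ban R .nonArch) (a : base R .arch) (m : M) :
    (compare (base R .nonArch) M).lin ((tensorMap (compareUnit R) (𝟙 ((incl R).obj M))).lin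
      (tmul (N := (incl R).obj M) a m)) = tmul (M := base R .nonArch) (N := M) a m :=
  (congrArg (compare (base R .nonArch) M).lin
    (tensorMap_tmul (compareUnit R) (𝟙 ((incl R).obj M)) a m)).trans
      (compare_tmul (base R .nonArch) M a m)

lemma compareUnit_whiskerLeft (M : Ban R .nonArch) (m : M) (a : base R .arch) :
    (compare M (base R .nonArch)).lin ((tensorMap (𝟙 ((incl R).obj M)) (compareUnit R)).lin
      (tmul (M := (incl R).obj M) m a)) = tmul (M := M) (N := base R .nonArch) m a :=
  (congrArg (compare M (base R .nonArch)).lin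
    (tensorMap_tmul (𝟙 ((incl R).obj M)) (compareUnit R) m a)).trans
      (compare_tmul M (base R .nonArch) m a)

/-- The inclusion of non-Archimedean modules is lax monoidal, through `m ⊗ n ↦ m ⊗ n`. -/
instance inclLaxMonoidal : (incl R).LaxMonoidal where
  ε := compareUnit R
  μ M N := compare M N
  μ_natural_left {M M'} f N := tensor_ext fun m n =>
    (congrArg (compare M' N).lin (whiskerRight_tmul ((incl R).map f) m n)).trans
      ((compare_tmul M' N (f.lin m) n).trans ((whiskerRight_tmul f m n).symm.trans
        (congrArg (Hom.lin (f ▷ N)) (compare_tmul M N m n)).symm))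
  μ_natural_right {M M'} N f := tensor_ext fun n m =>
    (congrArg (compare N M').lin (whiskerLeft_tmul ((incl R).map f) n m)).trans
      ((compare_tmul N M' n (f.lin m)).trans ((whiskerLeft_tmul f n m).symm.trans
        (congrArg (Hom.lin (N ◁ f)) (compare_tmul N M n m)).symm))
  associativity M N P := tensor_ext₃ fun m n p => by
    refine (congrArg (Hom.lin ((incl R).map (α_ M N P).hom)) ((congrArg (compare (M ⊗ N) P).lin
      ((whiskerRight_tmul (compare M N) _ p).trans
        (congrArg (fun t => tmul t p) (compare_tmul M N m n)))).trans
          (compare_tmul (M ⊗ N) P (tmul m n) p))).trans ?_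
    refine (associator_tmul (M := M) (N := N) (P := P) m n p).trans ?_
    exact ((congrArg (compare M (N ⊗ P)).lin
      ((congrArg (Hom.lin ((incl R).obj M ◁ compare N P)) (associator_tmul _ _ _)).trans
        ((whiskerLeft_tmul (compare N P) m _).trans
          (congrArg (fun t => tmul m t) (compare_tmul N P n p))))).trans
            (compare_tmul M (N ⊗ P) m (tmul n p))).symm
  left_unitality M := tensor_ext fun a m =>
    (leftUnitor_tmul (M := (incl R).obj M) a m).trans
      ((leftUnitor_tmul (M := M) a m).symm.trans
        (congrArg (leftUnit M).lin (compareUnit_whiskerRight M a m)).symm)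
  right_unitality M := tensor_ext fun m a =>
    (rightUnitor_tmul (M := (incl R).obj M) a m).trans
      ((rightUnitor_tmul (M := M) a m).symm.trans
        (congrArg (Hom.lin (ρ_ M).hom) (compareUnit_whiskerLeft M m a)).symm)

instance inclLaxBraided : (incl R).LaxBraided where
  toLaxMonoidal := inclLaxMonoidal
  braided M N := tensor_ext fun m n =>
    (congrArg (Hom.lin (braid M N).hom) (compare_tmul M N m n)).trans
      ((braid_tmul (M := M) (N := N) m n).trans ((congrArg (compare N M).lin
        (braid_tmul (M := (incl R).obj M) (N := (incl R).obj N) m n)).trans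
          (compare_tmul N M n m)).symm)

end lax

section free
variable [IsUltrametricDist R] {M : Ban R k'}

/-- The basis vector of `P(M)` attached to an element of `M`; it is zero for the zero element. -/
def preGen (k : Flavour) (m : M) : PreFree M k :=
  haveI := Classical.dec (m = 0)
  if h : m = 0 then (0 : {m : M // m ≠ 0} →₀ R) else Finsupp.single ⟨m, h⟩ 1

variable (k M) in
/-- The finite families, as elements of `P(M)`. -/
def toFree : PreFree M k →ₗ[R] free k M := toCompletion k (PreFree M k)

/-- The finite linear combinations `∑ c_m b(m)`. The flavour of the source is only a label, since
finite families do not depend on it. -/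
def combination {N : Ban R k} (b : {m : M // m ≠ 0} → N) (k₁ : Flavour) : PreFree M k₁ →ₗ[R] N :=
  Finsupp.linearCombination R b

/-- The basis vector of `P(M)` attached to an element of `M`, in the completion. -/
def gen (k : Flavour) (m : M) : free k M := toFree k M (preGen k m)

lemma preGen_of_ne (m : {m : M // m ≠ 0}) :
    preGen k m.1 = (Finsupp.single m (1 : R) : {m : M // m ≠ 0} →₀ R) := dif_neg m.2

lemma preGen_zero : preGen k (0 : M) = 0 := dif_pos rfl

lemma gen_zero : gen k (0 : M) = 0 := (congrArg _ preGen_zero).trans (map_zero _)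

/-- The factor `|1|` cannot be dropped: the norm of the unit of a Banach ring need not be at most one. -/
lemma nnnorm_preGen_le (m : M) : (preGen k m).nnnorm ≤ ‖(1 : R)‖₊ * ‖m‖₊ := by
  by_cases h : m = 0
  · rw [h, preGen_zero, PreFree.nnnorm_zero]
    exact zero_le
  · rw [preGen_of_ne ⟨m, h⟩]
    rw [PreFree.nnnorm_eq (s := {⟨m, h⟩}) Finsupp.support_single_subset]
    rw [Finset.singleton_val, Multiset.map_singleton, Flavour.agg_singleton]
    refine le_of_eq (congrArg (fun t => ‖t‖₊ * _) ?_)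
    exact Finsupp.single_eq_same

lemma nnnorm_gen_le (m : M) : ‖gen k m‖₊ ≤ ‖(1 : R)‖₊ * ‖m‖₊ :=
  (UniformSpace.Completion.nnnorm_coe _).le.trans (nnnorm_preGen_le m)

lemma toFree_eq_sum (c : PreFree M k) :
    toFree k M c = ∑ m ∈ c.support, c.coeff m • gen k m.1 := by
  have h : c = ∑ m ∈ c.support, c.coeff m • preGen k m.1 := by
    conv_lhs => rw [← Finsupp.sum_single (M := R) c]
    refine Finset.sum_congr rfl fun m _ => ?_
    rw [preGen_of_ne]
    exact (Finsupp.smul_single_one m (c.coeff m)).symm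
  conv_lhs => rw [h]
  rw [map_sum]
  refine Finset.sum_congr rfl fun m _ => ?_
  rw [map_smul]
  rfl

lemma free_hom_ext {N : Ban R k} {f g : free k M ⟶ N}
    (h : ∀ m, f.lin (gen k m) = g.lin (gen k m)) : f = g :=
  completion_hom_ext fun c => by
    have e := toFree_eq_sum c
    change f.lin (toFree k M c) = g.lin (toFree k M c)
    rw [e, map_sum, map_sum]
    refine Finset.sum_congr rfl fun m _ => ?_
    rw [map_smul, map_smul, h]

lemma nnnorm_combination_le {N : Ban R k} (b : {m : M // m ≠ 0} → N) {C D : ℝ≥0}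
    (hC : ∀ m, ‖b m‖₊ ≤ C * ‖m.1‖₊) (hD : ∀ (a : R) (n : N), ‖a • n‖₊ ≤ D * (‖a‖₊ * ‖n‖₊))
    (c : PreFree M k) : ‖combination b k c‖₊ ≤ D * C * ‖c‖₊ := by
  refine (nnnorm_sum_le_agg k (c.support.val.map fun m => c.coeff m • b m)).trans ?_
  rw [Multiset.map_map]
  refine (k.agg_mono _ _ (fun m => D * C * (‖c.coeff m‖₊ * ‖m.1‖₊)) fun m => ?_).trans
    (k.agg_mul _ _ _).le
  refine (hD _ _).trans ?_
  rw [mul_assoc, mul_left_comm C]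
  gcongr
  exact hC m

/-- The map out of `P(M)` with prescribed values on the basis vectors. -/
def freeLift {N : Ban R k} (b : {m : M // m ≠ 0} → N)
    (hb : ∃ C : ℝ≥0, ∀ m, ‖b m‖₊ ≤ C * ‖m.1‖₊) :
    free k M ⟶ N :=
  extend N (V := PreFree M k) (combination b k) (by
    obtain ⟨C, hC⟩ := hb
    obtain ⟨D, hD⟩ := BoundedScalars.exists_nnnorm_smul_le R N
    exact ⟨D * C, nnnorm_combination_le b hC hD⟩)

lemma freeLift_toFree {N : Ban R k} (b : {m : M // m ≠ 0} → N)
    (hb : ∃ C : ℝ≥0, ∀ m, ‖b m‖₊ ≤ C * ‖m.1‖₊) (c : PreFree M k) :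
    (freeLift b hb).lin (toFree k M c) = combination b k c :=
  extend_coe _ _ _ _

lemma combination_preGen {k₁ : Flavour} {N : Ban R k} (b : {m : M // m ≠ 0} → N)
    (m : {m : M // m ≠ 0}) :
    combination b k₁ (preGen k₁ m.1) = b m := by
  rw [preGen_of_ne]
  exact (Finsupp.linearCombination_single R 1 m).trans (one_smul R _)

lemma combination_preGen' {k₁ : Flavour} {N : Ban R k} (b : M → N) (h0 : b 0 = 0) (m : M) :
    combination (fun m : {m : M // m ≠ 0} => b m.1) k₁ (preGen k₁ m) = b m := by
  by_cases h : m = 0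
  · rw [h, preGen_zero, map_zero, h0]
  · exact combination_preGen (fun m : {m : M // m ≠ 0} => b m.1) ⟨m, h⟩

lemma freeLift_gen {N : Ban R k} (b : M → N) (h0 : b 0 = 0)
    (hb : ∃ C : ℝ≥0, ∀ m : {m : M // m ≠ 0}, ‖b m.1‖₊ ≤ C * ‖m.1‖₊) (m : M) :
    (freeLift (fun m : {m : M // m ≠ 0} => b m.1) hb).lin (gen k m) = b m :=
  (freeLift_toFree _ hb _).trans (combination_preGen' b h0 m)

lemma freeDesc_gen (m : M) : (freeDesc M).lin (gen k' m) = m :=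
  freeLift_gen (fun m : M => m) rfl ⟨1, fun m => by rw [one_mul]⟩ m

lemma freeCompare_gen (m : M) : (freeCompare M).lin (gen .arch m) = gen .nonArch m := by
  refine (extend_coe _ _ _ _).trans ?_
  by_cases h : m = 0
  · subst h
    rw [preGen_zero]
    exact (map_zero (toCompletion (R := R) .nonArch (PreFree M .nonArch))).trans gen_zero.symm
  · rw [gen, preGen_of_ne ⟨m, h⟩, preGen_of_ne ⟨m, h⟩]
    rfl

/-- The comparison between the two versions of `P(M)` is universal: bounded families of elements of
a non-Archimedean module extend to both of them. -/
lemma isUniversalArrow_freeCompare (M : Ban R k') : IsUniversalArrow (incl R) (freeCompare M) := by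
  intro N
  constructor
  · intro f g h
    refine free_hom_ext fun m => ?_
    have := congrArg (fun t : free .arch M ⟶ (incl R).obj N => t.lin (gen .arch m)) h
    rw [← freeCompare_gen]
    exact this
  · intro g
    obtain ⟨C, hC⟩ := g.bounded
    let b : M → N := fun m => g.lin (gen .arch m)
    have h0 : b 0 = 0 := (congrArg g.lin gen_zero).trans (map_zero g.lin)
    have hb : ∃ C : ℝ≥0, ∀ m : {m : M // m ≠ 0}, ‖b m.1‖₊ ≤ C * ‖m.1‖₊ :=
      ⟨C * ‖(1 : R)‖₊, fun m => (hC _).trans (by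
        rw [mul_assoc]
        exact mul_le_mul' le_rfl (nnnorm_gen_le m.1))⟩
    refine ⟨freeLift (fun m : {m : M // m ≠ 0} => b m.1) hb, free_hom_ext fun m => ?_⟩
    refine (congrArg (Hom.lin (freeLift (fun m : {m : M // m ≠ 0} => b m.1) hb))
      (freeCompare_gen m)).trans ?_
    exact freeLift_gen b h0 hb m

end free
end Ban

/-! ### The reflection of Banach modules into non-Archimedean ones -/

namespace Ban
open CategoryTheory Limits Functor.LaxMonoidal
open scoped NNReal
variable {R : Type u} [BanachRing R] [IsUltrametricDist R]

section reflection
variable (A : Ban R .arch)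

/-- The closure, in the non-Archimedean `P(A)`, of the linear relations between the elements of `A`. -/
def relations : Submodule R (free .nonArch A) :=
  (Submodule.map (toFree .nonArch A)
    (LinearMap.ker (combination (fun a : {a : A // a ≠ 0} => a.1) .nonArch))).topologicalClosure

instance : IsClosed (relations A : Set (free .nonArch A)) := Submodule.isClosed_topologicalClosure _

/-- The reflection of `A` into non-Archimedean modules: the quotient of the non-Archimedean `P(A)` by
the relations which hold in `A`. -/
def reflection : Ban R .nonArch := quot (free .nonArch A) (relations A)

/-- The projection from the non-Archimedean `P(A)` to the reflection. -/
def reflectionMk : free .nonArch A ⟶ reflection A := quotMk _ (relations A)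

lemma reflectionMk_eq {c d : PreFree A .nonArch}
    (h : combination (fun a : {a : A // a ≠ 0} => a.1) .nonArch c =
      combination (fun a : {a : A // a ≠ 0} => a.1) .nonArch d) :
    (reflectionMk A).lin (toFree .nonArch A c) = (reflectionMk A).lin (toFree .nonArch A d) :=
  (Submodule.Quotient.eq _).2 (Submodule.le_topologicalClosure _
    ⟨c - d, (map_sub _ _ _).trans (sub_eq_zero.2 h), map_sub _ _ _⟩)

/-- The map from `A` to its reflection, `a ↦ [a]`. It is linear by the choice of the relations. -/
def reflectionMap : A ⟶ (incl R).obj (reflection A) where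
  lin :=
    { toFun := fun a => (reflectionMk A).lin (gen .nonArch a)
      map_add' := fun a b => by
        refine Eq.trans (reflectionMk_eq A (d := preGen .nonArch a + preGen .nonArch b) ?_) ?_
        · have h (a : A) := combination_preGen' (k₁ := .nonArch) (fun a : A => a) rfl a
          rw [map_add, h, h, h]
        · rw [map_add, map_add]
          rfl
      map_smul' := fun r a => by
        refine Eq.trans (reflectionMk_eq A (d := r • preGen .nonArch a) ?_) ?_
        · have h (a : A) := combination_preGen' (k₁ := .nonArch) (fun a : A => a) rfl a
          rw [map_smul, h, h]
        · rw [map_smul, map_smul]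
          rfl }
  bounded := ⟨‖(1 : R)‖₊, fun a =>
    (Submodule.Quotient.norm_mk_le (relations A) (gen .nonArch a)).trans (nnnorm_gen_le a)⟩

/-- A bounded map from `A` to a non-Archimedean module extends to the non-Archimedean `P(A)` and
kills the relations. -/
lemma isUniversalArrow_reflectionMap : IsUniversalArrow (incl R) (reflectionMap A) := by
  intro N
  constructor
  · intro f g h
    have : Epi (reflectionMk A) := epi_of_surjective _ (quotMk_surjective _ _)
    rw [← cancel_epi (reflectionMk A)]
    exact free_hom_ext fun a => congrArg (fun t : A ⟶ (incl R).obj N => t.lin a) h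
  · intro g
    have h0 : g.lin 0 = 0 := map_zero g.lin
    have hb : ∃ C : ℝ≥0, ∀ m : {m : A // m ≠ 0}, ‖(g.lin m.1 : N)‖₊ ≤ C * ‖m.1‖₊ :=
      g.bounded.imp fun C hC m => hC m.1
    let f : free .nonArch A ⟶ N := freeLift (N := N) (fun m => g.lin m.1) hb
    have hf (c) : f.lin (toFree .nonArch A c) =
        g.lin (combination (fun a : {a : A // a ≠ 0} => a.1) .nonArch c) := by
      refine (freeLift_toFree (N := N) _ hb c).trans ?_
      exact (Finsupp.apply_linearCombination R g.lin (fun m : {m : A // m ≠ 0} => m.1) c).symm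
    have hker : relations A ≤ LinearMap.ker f.lin := by
      refine Submodule.topologicalClosure_minimal _ ?_ (isClosed_ker f)
      rintro _ ⟨c, hc, rfl⟩
      refine (hf c).trans ?_
      exact (congrArg g.lin hc).trans (map_zero _)
    exact ⟨quotLift f hker, hom_ext fun a => freeLift_gen (N := N) (fun m => g.lin m) h0 hb a⟩

end reflection

instance : (incl R).IsRightAdjoint := by
  let e (A : Ban R .arch) (N : Ban R .nonArch) :=
    Equiv.ofBijective _ (isUniversalArrow_reflectionMap A N)
  exact (Adjunction.adjunctionOfEquivLeft (G := incl R) (F_obj := reflection) e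
    (fun A N N' g h => by simp [e])).isRightAdjoint

/-- The unit of `R` is the same module in both categories. -/
lemma isUniversalArrow_ε : IsUniversalArrow (incl R) (ε (incl R)) := by
  intro N
  constructor
  · intro f g h
    exact hom_ext fun a => congrArg (fun t : base R .arch ⟶ (incl R).obj N => t.lin a) h
  · intro g
    exact ⟨⟨g.lin, g.bounded⟩, rfl⟩

/-- Universal arrows to the inclusion are stable under tensor products. The point is that the bounded
maps into a non-Archimedean module form a non-Archimedean module, so that a bilinear map can be
extended one variable at a time. -/
lemma isUniversalArrow_tensor {A B : Ban R .arch} {M N : Ban R .nonArch} {c : A ⟶ (incl R).obj M}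
    {d : B ⟶ (incl R).obj N} (hc : IsUniversalArrow (incl R) c) (hd : IsUniversalArrow (incl R) d) :
    IsUniversalArrow (incl R) ((c ⊗ₘ d) ≫ μ (incl R) M N) := by
  have hcd (a : A) (b : B) : Hom.lin ((c ⊗ₘ d) ≫ μ (incl R) M N) (tmul a b) =
      tmul (M := M) (N := N) (c.lin a) (d.lin b) :=
    (congrArg (compare M N).lin (tensorHom_tmul c d a b)).trans (compare_tmul M N _ _)
  intro P
  constructor
  · intro f g h
    have h1 (a : A) (b : B) : f.lin (tmul (M := M) (N := N) (c.lin a) (d.lin b)) =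
        g.lin (tmul (M := M) (N := N) (c.lin a) (d.lin b)) := by
      rw [← hcd]
      exact congrArg (fun t : A ⊗ B ⟶ (incl R).obj P => t.lin (tmul a b)) h
    -- a map out of `M ⊗ N` is determined by its values on the image of `A × B`, one variable at a time
    apply tensorHomEquiv.injective
    refine (hd _).1 (hom_ext fun b => Subtype.ext (LinearMap.ext fun m => ?_))
    change f.lin (tmul (M := M) (N := N) m (d.lin b)) = g.lin (tmul (M := M) (N := N) m (d.lin b))
    let F (f : M ⊗ N ⟶ P) : M ⟶ P :=
      ⟨((tmulₗ M N).compr₂ f.lin).flip (d.lin b), by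
        obtain ⟨C, hC⟩ := comp_tmulₗ_bound f
        exact ⟨C * ‖d.lin b‖₊, fun m =>
          (hC m (d.lin b)).trans (by rw [mul_comm ‖m‖₊, mul_assoc]; rfl)⟩⟩
    have h2 : F f = F g := (hc _).1 (hom_ext fun a => h1 a b)
    exact congrArg (fun t : M ⟶ P => t.lin m) h2
  · intro g
    -- `g : A ⟶ Hom(B, P)` extends to `M ⟶ Hom(B, P)`, and its transpose `B ⟶ Hom(M, P)` to `N`
    obtain ⟨g₁, h₁⟩ := (hc (internalHom B P)).2
      (bilin (k := .arch) (N := (incl R).obj P) A ((tmulₗ A B).compr₂ g.lin) (comp_tmulₗ_bound g))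
    obtain ⟨g₂, h₂⟩ := (hd (internalHom M P)).2
      (bilin (k := .arch) (N := (incl R).obj P) B (unbilin g₁).flip (flip_bound (unbilin_bound g₁)))
    refine ⟨tensorHomEquiv.symm g₂, tensor_ext fun a b => ?_⟩
    refine (congrArg (tensorHomEquiv.symm g₂).lin (hcd a b)).trans ?_
    refine (lift_tmul _ (flip_bound (unbilin_bound g₂)) _ _).trans ?_
    have e₁ := congrArg (fun t : A ⟶ internalHom (k := .arch) B ((incl R).obj P) => (t.lin a).1 b) h₁
    have e₂ := congrArg
      (fun t : B ⟶ internalHom (k := .arch) M ((incl R).obj P) => (t.lin b).1 (c.lin a)) h₂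
    exact e₂.trans e₁

end Ban

/-! ### Internal homs of ind-objects -/

namespace CategoryTheory.Ind
open Opposite

section closed
variable {C : Type u} [Category.{v} C] [MonoidalCategory C]

section preserves
variable {J : Type*} [Category* J] {D : J ⥤ C}

lemma mul_id_right {A B : C} {E : Ind C} (x : Ind.yoneda.obj A ⟶ E) {B' : C} (g : B ⟶ B') :
    mul x (Ind.yoneda.map g) = Ind.yoneda.map (A ◁ g) ≫ mul x (𝟙 _) := by
  rw [← map_mul_right, Category.comp_id]

/-- If tensoring the maps `D_j ⟶ W` with `A` gives a colimit of ind-objects for all `A` in `C`, then so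
does tensoring them with any ind-object `E`. -/
lemma existsUnique_tensor_desc {W : C} (l : ∀ j, D.obj j ⟶ W)
    (h : ∀ (A : C) {Z : Ind C} (t : ∀ j, Ind.yoneda.obj (A ⊗ D.obj j) ⟶ Z),
      (∀ {j j'} (f : j ⟶ j'), Ind.yoneda.map (A ◁ D.map f) ≫ t j' = t j) →
        ∃! d : Ind.yoneda.obj (A ⊗ W) ⟶ Z, ∀ j, Ind.yoneda.map (A ◁ l j) ≫ d = t j)
    {E Z : Ind C} (t : ∀ j, E ⊗ Ind.yoneda.obj (D.obj j) ⟶ Z)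
    (ht : ∀ {j j'} (f : j ⟶ j'), E ◁ Ind.yoneda.map (D.map f) ≫ t j' = t j) :
    ∃! d : E ⊗ Ind.yoneda.obj W ⟶ Z, ∀ j, E ◁ Ind.yoneda.map (l j) ≫ d = t j := by
  have h0 {A : C} (x : Ind.yoneda.obj A ⟶ E) := h A (fun j => mul x (𝟙 _) ≫ t j) (fun {j j'} f => by
    rw [← Category.assoc, ← mul_id_right, ← ht f, ← Category.assoc, mul_whiskerLeft,
      Category.id_comp])
  choose d hd hd' using fun (A : C) (x : Ind.yoneda.obj A ⟶ E) => h0 x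
  obtain ⟨f, hf⟩ : ∃ f : E ⊗ Ind.yoneda.obj W ⟶ Z, ∀ (A B : C) (x : Ind.yoneda.obj A ⟶ E)
      (y : Ind.yoneda.obj B ⟶ Ind.yoneda.obj W), mul x y ≫ f =
        Ind.yoneda.map (A ◁ Ind.yoneda.preimage y) ≫ d A x := by
    refine exists_tensor_desc _ fun A A' B B' f g x y => ?_
    have h2 : d A (Ind.yoneda.map f ≫ x) = Ind.yoneda.map (f ▷ W) ≫ d A' x := by
      refine (hd' A _ _ fun j => ?_).symm
      rw [← Functor.map_comp_assoc, whisker_exchange, Functor.map_comp_assoc, hd, map_mul_left,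
        Category.assoc]
    rw [h2, ← Functor.map_comp_assoc, ← Functor.map_comp_assoc]
    congr 2
    obtain ⟨b, rfl⟩ := Ind.yoneda.map_surjective y
    rw [← Functor.map_comp, Functor.preimage_map, Functor.preimage_map,
      MonoidalCategory.whiskerLeft_comp, MonoidalCategory.tensorHom_def f g, Category.assoc,
      whisker_exchange, Category.assoc, whisker_exchange_assoc]
  refine ⟨f, fun j => tensor_hom_ext fun A B x y => ?_, fun m hm => tensor_hom_ext fun A B x y => ?_⟩
  · obtain ⟨b, rfl⟩ := Ind.yoneda.map_surjective y
    rw [← Category.assoc, mul_whiskerLeft, ← Functor.map_comp, hf, Functor.preimage_map,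
      MonoidalCategory.whiskerLeft_comp, Functor.map_comp_assoc, hd, ← Category.assoc,
      ← mul_id_right]
  · obtain ⟨b, rfl⟩ := Ind.yoneda.map_surjective y
    have h3 : mul x (𝟙 _) ≫ m = d A x := hd' A x _ fun j => by
      rw [← Category.assoc, ← mul_id_right, ← hm j, ← Category.assoc, mul_whiskerLeft,
        Category.id_comp]
    rw [hf, Functor.preimage_map, ← h3, ← Category.assoc, mul_id_right]

/-- Tensor products of ind-objects commute with finite colimits of representable ind-objects, if
the tensor products of `C` do. -/
instance [∀ A : C, PreservesFiniteColimits (tensorLeft A)] (E : Ind C) :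
    PreservesFiniteColimits (Ind.yoneda ⋙ tensorLeft E) where
  preservesFiniteColimits J _ _ := ⟨fun {D} => ⟨fun {c} hc => ⟨IsColimit.ofExistsUnique fun s =>
    existsUnique_tensor_desc (D := D) (fun j => c.ι.app j) (fun A Z t ht => by
      have h := isColimitOfPreserves (tensorLeft A ⋙ Ind.yoneda) hc
      let s : Cocone (D ⋙ tensorLeft A ⋙ Ind.yoneda) :=
        { pt := Z
          ι := { app := t
                 naturality := fun j j' f => (ht f).trans (Category.comp_id _).symm } }
      exact ⟨h.desc s, h.fac s, fun m hm => h.uniq s m hm⟩) s.ι.app (fun f => s.w f)⟩⟩⟩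

end preserves

section
variable (E F : Ind C)

/-- The presheaf `W ↦ Hom(E ⊗ W, F)` on `C`, which underlies the internal hom if there is one. -/
def homPresheaf : Cᵒᵖ ⥤ Type v := (Ind.yoneda ⋙ tensorLeft E).op ⋙ CategoryTheory.yoneda.obj F

variable {E F} in
/-- If the presheaf of homs is an ind-object, it is an internal hom. -/
lemma exists_internalHom (h : IsIndObject (homPresheaf E F)) : ∃ (H : Ind C) (ev : E ⊗ H ⟶ F),
    ∀ X : Ind C, Function.Bijective fun f : X ⟶ H => E ◁ f ≫ ev := by
  obtain ⟨H, ⟨e⟩⟩ : ∃ H : Ind C, Nonempty ((Ind.inclusion C).obj H ≅ homPresheaf E F) :=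
    ⟨(Ind.equivalence C).inverse.obj ⟨_, h⟩,
      ⟨(ObjectProperty.ι _).mapIso ((Ind.equivalence C).counitIso.app ⟨_, h⟩)⟩⟩
  let θ {B : C} (y : Ind.yoneda.obj B ⟶ H) : E ⊗ Ind.yoneda.obj B ⟶ F :=
    e.hom.app (op B) (toElement y)
  have hθ {B B' : C} (g : B ⟶ B') (y : Ind.yoneda.obj B' ⟶ H) :
      θ (Ind.yoneda.map g ≫ y) = E ◁ Ind.yoneda.map g ≫ θ y := by
    refine (congrArg (e.hom.app (op B)) (toElement_precomp g y)).trans ?_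
    exact congrArg (fun t => t (toElement y)) (e.hom.naturality g.op)
  -- elements of `H` at `B` are the same as morphisms `E ⊗ B ⟶ F`
  have hθb (B : C) : Function.Bijective (θ (B := B)) := by
    have h1 : Function.Bijective (e.hom.app (op B)) :=
      (isIso_iff_bijective (e.hom.app (op B))).1 inferInstance
    have h2 : Function.Bijective (toElement : (Ind.yoneda.obj B ⟶ H) → _) :=
      ⟨toElement_injective, fun z => ⟨ofElement z, toElement_ofElement z⟩⟩
    exact h1.comp h2
  obtain ⟨ev, hev⟩ := exists_tensor_desc (X := E) (Y := H) (Z := F)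
    (fun A B x y => mul x (𝟙 _) ≫ θ y) (fun A A' B B' f g x y => by
      rw [hθ, ← Category.assoc, mul_whiskerLeft, ← Category.assoc, map_mul, Category.comp_id,
        Category.id_comp])
  have hev' {B : C} (y : Ind.yoneda.obj B ⟶ H) : E ◁ y ≫ ev = θ y := by
    refine tensor_hom_ext fun A B' x y' => ?_
    obtain ⟨b, rfl⟩ := Ind.yoneda.map_surjective y'
    rw [← Category.assoc, mul_whiskerLeft, hev, hθ, ← Category.assoc, mul_whiskerLeft,
      Category.id_comp]
  refine ⟨H, ev, fun X => ⟨fun f f' hff => hom_ext_elements fun B y => ?_, fun g => ?_⟩⟩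
  · apply (hθb B).1
    rw [← hev', ← hev', MonoidalCategory.whiskerLeft_comp, MonoidalCategory.whiskerLeft_comp,
      Category.assoc, Category.assoc]
    exact congrArg _ hff
  · choose φ hφ using fun (B : C) (y : Ind.yoneda.obj B ⟶ X) => (hθb B).2 (E ◁ y ≫ g)
    obtain ⟨f, hf⟩ := exists_hom_of_elements φ (fun {A B} f x => (hθb _).1 (by
      rw [hφ, hθ, hφ, MonoidalCategory.whiskerLeft_comp, Category.assoc]))
    refine ⟨f, tensor_hom_ext fun A B x y => ?_⟩
    change mul x y ≫ E ◁ f ≫ ev = _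
    rw [← Category.assoc, mul_whiskerLeft, hf, hev]
    rw [hφ, ← Category.assoc, mul_whiskerLeft, Category.id_comp]

/-- Ind-objects form a closed category as soon as the presheaves `W ↦ Hom(E ⊗ W, F)` are ind-objects. -/
lemma nonempty_monoidalClosed (h : ∀ E F : Ind C, IsIndObject (homPresheaf E F)) :
    Nonempty (MonoidalClosed (Ind C)) := by
  choose H ev hev using fun E F => exists_internalHom (h E F)
  let e (E : Ind C) (X F : Ind C) : (E ⊗ X ⟶ F) ≃ (X ⟶ H E F) :=
    (Equiv.ofBijective _ (hev E F X)).symm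
  exact ⟨⟨fun E => ⟨_, Adjunction.adjunctionOfEquivRight (F := tensorLeft E) (e E)
    (fun X' X F f g => by
      apply (e E X' F).symm.injective
      rw [Equiv.symm_apply_apply]
      change _ = E ◁ (f ≫ e E X F g) ≫ ev E F
      rw [MonoidalCategory.whiskerLeft_comp, Category.assoc]
      exact congrArg (E ◁ f ≫ ·) ((e E X F).symm_apply_apply g).symm)⟩⟩⟩

end
end closed
end CategoryTheory.Ind

/-! ### Ind-Banach modules form a closed category -/

namespace Ban
open CategoryTheory Limits Opposite CategoryTheory.Ind
open scoped NNReal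

section transport
variable {R : Type u} [BanachRing R] {k : Flavour}

variable (R k) in
/-- The structures of a Banach module on a given type. They form a small type, so that there are only
a small set of isomorphism classes of Banach modules of bounded cardinality. -/
structure Structure (X : Type u) : Type u where
  [group : NormedAddCommGroup X]
  [module : Module R X]
  [complete : CompleteSpace X]
  [scalars : BoundedScalars R X]
  [flavour : FlavouredNorm k X]

/-- The Banach module attached to a structure on a type. -/
def Structure.ban {X : Type u} (s : Structure R k X) : Ban R k :=
  { carrier := X
    group := s.group
    module := s.module
    complete := s.complete
    scalars := s.scalars
    flavour := s.flavour }

/-- A type in bijection with a Banach module carries an isomorphic structure of a Banach module. -/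
lemma exists_structure_iso {X : Type u} {M : Ban R k} (e : X ≃ M) :
    ∃ s : Structure R k X, Nonempty (s.ban ≅ M) := by
  let : AddCommGroup X := e.addCommGroup
  let : Module R X := e.module R
  let l : X ≃ₗ[R] M := e.linearEquiv R
  let : NormedAddCommGroup X :=
    NormedAddCommGroup.induced X M l.toLinearMap.toAddMonoidHom l.injective
  have hl (x : X) : ‖l x‖₊ = ‖x‖₊ := rfl
  have hi : Isometry l := AddMonoidHomClass.isometry_of_norm l fun _ => rfl
  have : CompleteSpace X :=
    (completeSpace_congr (e := l.toEquiv) hi.isUniformEmbedding).2 M.complete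
  have : BoundedScalars R X :=
    ⟨(BoundedScalars.exists_nnnorm_smul_le R M).imp fun C hC a x => by
      rw [← hl, map_smul, ← hl]
      exact hC a (l x)⟩
  have : FlavouredNorm k X := ⟨fun x y => by
    rw [← hl, map_add, ← hl x, ← hl y]
    exact FlavouredNorm.nnnorm_add_le_join k (l x) (l y)⟩
  refine ⟨⟨⟩, ⟨⟨⟨l.toLinearMap, 1, fun x => ?_⟩, ⟨l.symm.toLinearMap, 1, fun m => ?_⟩, ?_, ?_⟩⟩⟩
  · rw [one_mul]
    exact (hl x).le
  · rw [one_mul]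
    refine (hl (l.symm m)).symm.le.trans ?_
    rw [l.apply_symm_apply]
  · exact hom_ext fun x => l.symm_apply_apply x
  · exact hom_ext fun m => l.apply_symm_apply m

end transport

variable {R : Type u} [BanachRing R] {k : Flavour}

/-- The zero map. -/
def zeroHom (M N : Ban R k) : M ⟶ N := ⟨0, 0, fun m => by simp⟩

lemma subι_quotMk (M : Ban R k) (S : Submodule R M) [IsClosed (S : Set M)] :
    subι M S ≫ quotMk M S = zeroHom (sub M S) M ≫ quotMk M S :=
  hom_ext fun m => ((Submodule.Quotient.mk_eq_zero S).2 m.2).trans (map_zero (quotMk M S).lin).symm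

/-- The quotient by a closed submodule is a cokernel of its inclusion. -/
def quotIsColimit (M : Ban R k) (S : Submodule R M) [IsClosed (S : Set M)] :
    IsColimit (Cofork.ofπ (quotMk M S) (subι_quotMk M S)) :=
  Cofork.IsColimit.mk _
    (fun s => quotLift s.π fun m hm =>
      (congrArg (fun t : sub M S ⟶ _ => t.lin (show sub M S from ⟨m, hm⟩)) s.condition).trans
        (map_zero s.π.lin))
    (fun s => quotMk_quotLift _ _)
    (fun s m hm => by
      have := epi_of_surjective _ (quotMk_surjective M S)
      rw [← cancel_epi (quotMk M S)]
      exact hm)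

variable [IsUltrametricDist R]

/-- A morphism `E ⊗ W ⟶ F` of ind-objects, for a Banach module `W`, factors through a quotient of `W`
whose cardinality is bounded in terms of `E` and `F`: elements of `W` can be identified if they give
the same maps from the terms of `E` to those of `F`. -/
lemma exists_factor_through_bounded (E F : Ind (Ban R k)) : ∃ X : Type u, ∀ (W : Ban R k)
    (h : E ⊗ Ind.yoneda.obj W ⟶ F), ∃ (W' : Ban R k) (p : W ⟶ W') (h' : E ⊗ Ind.yoneda.obj W' ⟶ F)
      (f : W' → X), Function.Injective f ∧ E ◁ Ind.yoneda.map p ≫ h' = h := by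
  -- an element `w` of `W` is recorded by the maps `E_i ⟶ F_j`, `e ↦ g_i (e ⊗ w)`, where
  -- `g_i : E_i ⊗ W ⟶ F_j` represents `h` on the stage `E_i`
  refine ⟨∀ i : E.presentation.I, E.presentation.F.obj i →
    Σ j : F.presentation.I, F.presentation.F.obj j, fun W h => ?_⟩
  choose j z hz using fun i => exists_factor (presentationIsColimit F) (mul (leg E i) (𝟙 _) ≫ h)
  choose g hg using fun i => Ind.yoneda.map_surjective (z i)
  have hz' (i) : mul (leg E i) (𝟙 _) ≫ h = Ind.yoneda.map (g i) ≫ leg F (j i) := by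
    rw [hg]
    exact (hz i).symm
  -- the elements of `W` which are not seen by `h`
  let N : Submodule R W :=
    { carrier := {w | ∀ i e, (g i).lin (tmul e w) = 0}
      zero_mem' := fun i e => (congrArg (g i).lin (map_zero (tmulₗ _ W e))).trans (map_zero (g i).lin)
      add_mem' := fun {a b} ha hb i e => by
        refine (congrArg (g i).lin (tmul_add e a b)).trans ((map_add (g i).lin _ _).trans ?_)
        rw [ha i e, hb i e, add_zero]
      smul_mem' := fun r a ha i e => by
        refine (congrArg (g i).lin (tmul_smul r e a)).trans ((map_smul (g i).lin _ _).trans ?_)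
        rw [ha i e, smul_zero] }
  have hN : IsClosed (N : Set W) := by
    have : (N : Set W) = ⋂ i, ⋂ e, {w | (g i).lin (tmul e w) = 0} := by
      ext w
      simp only [Set.mem_iInter]
      rfl
    rw [this]
    exact isClosed_iInter fun i => isClosed_iInter fun e => isClosed_eq
      ((g i).continuous.comp (continuous_tmul_right e)) continuous_const
  -- `h` kills `E ⊗ N`, so it descends to `E ⊗ W / N` since tensoring commutes with cokernels
  have hcond : (Ind.yoneda ⋙ tensorLeft E).map (subι W N) ≫ h =
      (Ind.yoneda ⋙ tensorLeft E).map (zeroHom (sub W N) W) ≫ h := by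
    refine tensor_hom_ext fun A B x y => ?_
    obtain ⟨b, rfl⟩ := Ind.yoneda.map_surjective y
    obtain ⟨i, a, rfl⟩ := exists_factor (presentationIsColimit E) x
    obtain ⟨a, rfl⟩ := Ind.yoneda.map_surjective a
    have key (t : sub W N ⟶ W) : mul (Ind.yoneda.map a ≫ leg E i) (Ind.yoneda.map b) ≫
        (E ◁ Ind.yoneda.map t ≫ h) = Ind.yoneda.map ((a ⊗ₘ (b ≫ t)) ≫ g i) ≫ leg F (j i) := by
      rw [← Category.assoc, mul_whiskerLeft, ← Functor.map_comp,
        ← Category.comp_id (Ind.yoneda.map (b ≫ t)), ← Ind.map_mul, Category.assoc, hz',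
        Functor.map_comp_assoc]
    refine (key _).trans (Eq.trans ?_ (key _).symm)
    congr 2
    refine tensor_ext fun m n => ?_
    refine (congrArg (g i).lin (tensorHom_tmul a (b ≫ subι W N) m n)).trans ?_
    refine ((b.lin n).2 i (a.lin m)).trans ?_
    refine (((congrArg (g i).lin (tensorHom_tmul a (b ≫ zeroHom _ W) m n)).trans ?_)).symm
    exact N.zero_mem i (a.lin m)
  have hcolim := isColimitCoforkMapOfIsColimit (Ind.yoneda ⋙ tensorLeft E) (subι_quotMk W N)
    (quotIsColimit W N)
  obtain ⟨h', hh'⟩ := Cofork.IsColimit.desc' hcolim h hcond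
  refine ⟨quot W N, quotMk W N, h', ?_, ?_, hh'⟩
  · exact fun w i e => ⟨j i, (g i).lin (tmul e (quotMk_surjective W N w).choose)⟩
  · intro w w' hww
    rw [← (quotMk_surjective W N w).choose_spec, ← (quotMk_surjective W N w').choose_spec]
    refine (Submodule.Quotient.eq N).2 fun i e => ?_
    refine (congrArg (g i).lin (map_sub (tmulₗ _ W e) _ _)).trans ((map_sub (g i).lin _ _).trans ?_)
    have := congrFun (congrFun hww i) e
    rw [Sigma.mk.injEq] at this
    exact sub_eq_zero.2 (eq_of_heq this.2)

/-- The presheaf `W ↦ Hom(E ⊗ W, F)` turns finite colimits into limits, so its category of elements is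
filtered; and that category has a small weakly terminal set, given by modules of bounded
cardinality. -/
lemma isIndObject_homPresheaf (E F : Ind (Ban R k)) : IsIndObject (homPresheaf E F) := by
  have : PreservesFiniteLimits (Ind.yoneda ⋙ tensorLeft E).op := preservesFiniteLimits_op _
  have : PreservesFiniteLimits (homPresheaf E F) := comp_preservesFiniteLimits _ _
  have := isFiltered_costructuredArrow_yoneda_of_preservesFiniteLimits (homPresheaf E F)
  obtain ⟨X, hX⟩ := exists_factor_through_bounded E F
  have : FinallySmall.{u} (CostructuredArrow CategoryTheory.yoneda (homPresheaf E F)) := by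
    let s (p : Σ (A : Set X) (S : Structure R k A), E ⊗ Ind.yoneda.obj S.ban ⟶ F) :
        CostructuredArrow CategoryTheory.yoneda (homPresheaf E F) :=
      CostructuredArrow.mk (Y := p.2.1.ban) (yonedaEquiv.symm p.2.2)
    refine finallySmall_of_small_weakly_terminal_set (Set.range s) fun Y => ?_
    obtain ⟨W', p, h', f, hf, hp⟩ := hX Y.left (yonedaEquiv Y.hom)
    obtain ⟨S, ⟨φ⟩⟩ := exists_structure_iso (Equiv.ofInjective f hf).symm
    refine ⟨_, ⟨⟨_, S, E ◁ Ind.yoneda.map φ.hom ≫ h'⟩, rfl⟩,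
      ⟨CostructuredArrow.homMk (p ≫ φ.inv) ?_⟩⟩
    refine (yonedaEquiv_symm_naturality_left _ _ _).trans ?_
    rw [Equiv.symm_apply_eq, ← hp]
    change E ◁ Ind.yoneda.map (p ≫ φ.inv) ≫ E ◁ Ind.yoneda.map φ.hom ≫ h' = _
    rw [← MonoidalCategory.whiskerLeft_comp_assoc, ← Functor.map_comp, Category.assoc, φ.inv_hom_id,
      Category.comp_id]
  exact isIndObject_of_isFiltered_of_finallySmall _

lemma nonempty_monoidalClosed : Nonempty (MonoidalClosed (Ind (Ban R k))) :=
  CategoryTheory.Ind.nonempty_monoidalClosed isIndObject_homPresheaf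

end Ban

/-! ### The canonical presentation of an ind-Banach module -/

namespace Ban
open CategoryTheory Limits CategoryTheory.Ind
open scoped NNReal
variable {R : Type u} [BanachRing R] {k : Flavour}

lemma zeroHom_eq_comp (M N : Ban R k) :
    zeroHom M N = zeroHom M (zeroObj R k) ≫ zeroHom (zeroObj R k) N := rfl

lemma yoneda_map_zeroHom (M N : Ban R k) : Ind.yoneda.map (zeroHom M N) = 0 := by
  have hi : IsInitial (Ind.yoneda.obj (zeroObj R k)) :=
    IsInitial.isInitialObj Ind.yoneda _ isZero_zeroObj.isInitial
  rw [zeroHom_eq_comp, Functor.map_comp, hi.hom_ext (Ind.yoneda.map (zeroHom (zeroObj R k) N)) 0,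
    comp_zero]

/-- The direct sum is a coproduct. -/
def sumIsColimit (M N : Ban R k) : IsColimit (BinaryCofan.mk (sumInl M N) (sumInr M N)) :=
  BinaryCofan.IsColimit.mk _ (fun f g => sumDesc f g)
    (fun f g => hom_ext fun m => show f.lin m + g.lin 0 = f.lin m by simp)
    (fun f g => hom_ext fun m => show f.lin 0 + g.lin m = g.lin m by simp)
    (fun f g h hf hg => hom_ext fun m => by
      subst hf hg
      exact (congrArg h.lin (Prod.ext (add_zero _).symm (zero_add _).symm)).trans
        (map_add h.lin ((sumInl M N).lin m.1) ((sumInr M N).lin m.2)))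

section codiagonal
variable (A : Ban R k)

/-- The map `a ↦ (a, -a)`. -/
def antidiagonal : A ⟶ sum A A where
  lin := LinearMap.prod LinearMap.id (-LinearMap.id)
  bounded := ⟨1, fun a => by
    rw [one_mul]
    exact max_le le_rfl (nnnorm_neg a).le⟩

/-- The map `(a, b) ↦ a + b`. -/
def codiagonal : sum A A ⟶ A := sumDesc (𝟙 A) (𝟙 A)

lemma antidiagonal_codiagonal : antidiagonal A ≫ codiagonal A = zeroHom A A :=
  hom_ext fun a => add_neg_cancel a

lemma antidiagonal_codiagonal' :
    antidiagonal A ≫ codiagonal A = zeroHom A (sum A A) ≫ codiagonal A :=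
  hom_ext fun a => (add_neg_cancel a).trans (map_zero (codiagonal A).lin).symm

/-- The addition is the cokernel of the antidiagonal. -/
def codiagonalIsColimit : IsColimit (Cofork.ofπ (codiagonal A) (antidiagonal_codiagonal' A)) :=
  Cofork.IsColimit.mk _ (fun s => sumInl A A ≫ s.π)
    (fun s => hom_ext fun x => by
      have h1 : s.π.lin ((antidiagonal A).lin x.2) = 0 :=
        (congrArg (fun t : A ⟶ s.pt => t.lin x.2) s.condition).trans (map_zero s.π.lin)
      have h2 : (sumInl A A).lin (x.1 + x.2) = x + (antidiagonal A).lin x.2 :=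
        Prod.ext rfl (add_neg_cancel x.2).symm
      refine (congrArg s.π.lin h2).trans ((map_add s.π.lin x _).trans ?_)
      rw [h1, add_zero])
    (fun s m hm => by
      rw [← hm]
      exact hom_ext fun a => congrArg m.lin (add_zero a).symm)

end codiagonal

/-- A morphism of ind-Banach modules which kills the elements killed by `κ` does not distinguish
elements with the same image under `κ`. The difference of two elements is formed on representable
ind-objects, where addition is the cokernel of the antidiagonal. -/
lemma comp_eq_of_comp_eq {P E Z : Ind (Ban R k)} (κ : P ⟶ E) (g : P ⟶ Z)
    (h : ∀ (B : Ban R k) (t : Ind.yoneda.obj B ⟶ P), t ≫ κ = 0 → t ≫ g = 0) {A : Ban R k}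
    (x y : Ind.yoneda.obj A ⟶ P) (e : x ≫ κ = y ≫ κ) : x ≫ g = y ≫ g := by
  let hs : IsColimit (BinaryCofan.mk (Ind.yoneda.map (sumInl A A)) (Ind.yoneda.map (sumInr A A))) :=
    mapIsColimitOfPreservesOfIsColimit Ind.yoneda _ _ (sumIsColimit A A)
  obtain ⟨w, hw₁, hw₂⟩ : ∃ w : Ind.yoneda.obj (sum A A) ⟶ P,
      Ind.yoneda.map (sumInl A A) ≫ w = x ∧ Ind.yoneda.map (sumInr A A) ≫ w = y :=
    let ⟨w, hw₁, hw₂⟩ := BinaryCofan.IsColimit.desc' hs x y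
    ⟨w, hw₁, hw₂⟩
  have h1 : sumInl A A ≫ codiagonal A = 𝟙 A := hom_ext fun a => add_zero a
  have h2 : sumInr A A ≫ codiagonal A = 𝟙 A := hom_ext fun a => zero_add a
  have e₁ : Ind.yoneda.map (sumInl A A) ≫ w ≫ κ =
      Ind.yoneda.map (sumInl A A) ≫ Ind.yoneda.map (codiagonal A) ≫ x ≫ κ := by
    rw [← Category.assoc, hw₁, ← Functor.map_comp_assoc, h1, CategoryTheory.Functor.map_id,
      Category.id_comp]
  have e₂ : Ind.yoneda.map (sumInr A A) ≫ w ≫ κ =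
      Ind.yoneda.map (sumInr A A) ≫ Ind.yoneda.map (codiagonal A) ≫ x ≫ κ := by
    rw [← Category.assoc, hw₂, ← Functor.map_comp_assoc, h2, CategoryTheory.Functor.map_id,
      Category.id_comp, e]
  -- `w` is `(a, b) ↦ x a + y b`, and `κ` sends it to `x (a + b)` since `x` and `y` agree there
  have h3 : w ≫ κ = Ind.yoneda.map (codiagonal A) ≫ x ≫ κ := BinaryCofan.IsColimit.hom_ext hs e₁ e₂
  -- hence `κ` kills `w (a, -a) = x a - y a`, and so does `g` by assumption
  have h4 : Ind.yoneda.map (antidiagonal A) ≫ w ≫ g = Ind.yoneda.map (zeroHom _ _) ≫ w ≫ g := by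
    rw [yoneda_map_zeroHom, zero_comp, ← Category.assoc]
    refine h _ _ ?_
    rw [Category.assoc, h3, ← Functor.map_comp_assoc, antidiagonal_codiagonal, yoneda_map_zeroHom,
      zero_comp]
  obtain ⟨r, hr⟩ : ∃ r : Ind.yoneda.obj A ⟶ Z, Ind.yoneda.map (codiagonal A) ≫ r = w ≫ g :=
    let ⟨r, hr⟩ := Cofork.IsColimit.desc' (isColimitCoforkMapOfIsColimit Ind.yoneda
      (antidiagonal_codiagonal' A) (codiagonalIsColimit A)) (w ≫ g) h4
    ⟨r, hr⟩
  rw [← hw₁, ← hw₂, Category.assoc, Category.assoc, ← hr, ← Functor.map_comp_assoc,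
    ← Functor.map_comp_assoc, h1, h2]

section free
variable [IsUltrametricDist R]

/-- A map out of `P(M)` which kills the kernel of the canonical map to `M` factors through `M`. The
factorization is bounded since `m` lifts to a basis vector of norm at most `|1| ‖m‖`. -/
lemma exists_freeDesc_comp {M N : Ban R k} (f : free k M ⟶ N)
    (h : ∀ c, (freeDesc M).lin c = 0 → f.lin c = 0) : ∃ g : M ⟶ N, freeDesc M ≫ g = f := by
  have h' (c c' : free k M) (e : (freeDesc M).lin c = (freeDesc M).lin c') : f.lin c = f.lin c' := by
    rw [← sub_eq_zero, ← map_sub]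
    exact h _ (by rw [map_sub, e, sub_self])
  obtain ⟨C, hC⟩ := f.bounded
  let g : M ⟶ N :=
    { lin :=
        { toFun := fun m => f.lin (gen k m)
          map_add' := fun m n => by
            rw [← map_add]
            exact h' _ _ (by rw [map_add, freeDesc_gen, freeDesc_gen, freeDesc_gen])
          map_smul' := fun r m => by
            rw [RingHom.id_apply, ← map_smul]
            exact h' _ _ (by rw [map_smul, freeDesc_gen, freeDesc_gen]) }
      bounded := ⟨C * ‖(1 : R)‖₊, fun m => (hC _).trans (by
        rw [mul_assoc]
        exact mul_le_mul' le_rfl (nnnorm_gen_le m))⟩ }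
  exact ⟨g, free_hom_ext fun m => congrArg (fun n => f.lin (gen k n)) (freeDesc_gen m)⟩

lemma freeDesc_surjective (M : Ban R k) : Function.Surjective (freeDesc M).lin :=
  fun m => ⟨gen k m, freeDesc_gen m⟩

/-- The kernel of the canonical map from `P(M)`. -/
def freeKer (M : Ban R k) : Ban R k :=
  have := isClosed_ker (freeDesc M)
  sub (free k M) (LinearMap.ker (freeDesc M).lin)

/-- The inclusion of the kernel. -/
def freeKerι (M : Ban R k) : freeKer M ⟶ free k M :=
  have := isClosed_ker (freeDesc M)
  subι (free k M) (LinearMap.ker (freeDesc M).lin)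

lemma freeKerι_freeDesc (M : Ban R k) : freeKerι M ≫ freeDesc M = zeroHom _ _ := hom_ext fun c => c.2

lemma freeKerι_freeDesc' (M : Ban R k) : freeKerι M ≫ freeDesc M = zeroHom _ _ ≫ freeDesc M :=
  hom_ext fun c => Eq.trans c.2 (map_zero (freeDesc M).lin).symm

/-- The canonical map from `P(M)` is the cokernel of its kernel. -/
def freeDescIsColimit (M : Ban R k) : IsColimit (Cofork.ofπ (freeDesc M) (freeKerι_freeDesc' M)) :=
  Cofork.IsColimit.ofExistsUnique fun s => by
    obtain ⟨g, hg⟩ := exists_freeDesc_comp s.π fun c hc =>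
      (congrArg (fun t : freeKer M ⟶ s.pt => t.lin ⟨c, hc⟩) s.condition).trans (map_zero s.π.lin)
    refine ⟨g, hg, fun g' hg' => ?_⟩
    have := epi_of_surjective _ (freeDesc_surjective M)
    rw [← cancel_epi (freeDesc M)]
    exact hg'.trans hg.symm

/-- The functoriality of `P(M)`. -/
def freeMap {M N : Ban R k} (f : M ⟶ N) : free k M ⟶ free k N :=
  freeLift (fun m => gen k (f.lin m.1)) (by
    obtain ⟨C, hC⟩ := f.bounded
    refine ⟨‖(1 : R)‖₊ * C, fun m => (nnnorm_gen_le _).trans ?_⟩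
    rw [mul_assoc]
    gcongr
    exact hC m.1)

lemma freeMap_freeDesc {M N : Ban R k} (f : M ⟶ N) :
    freeMap f ≫ freeDesc N = freeDesc M ≫ f := free_hom_ext fun m => by
  rw [comp_lin, comp_lin, freeDesc_gen]
  refine (congrArg (freeDesc N).lin (freeLift_gen (fun m : M => gen k (f.lin m)) ?_ _ m)).trans
    (freeDesc_gen _)
  rw [map_zero, gen_zero]

instance (M : Ban R k) : Epi (Ind.yoneda.map (freeDesc M)) := by
  have h := isColimitCoforkMapOfIsColimit Ind.yoneda (freeKerι_freeDesc' M) (freeDescIsColimit M)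
  exact ⟨fun f g e => Cofork.IsColimit.hom_ext h e⟩

variable {I : Type u} [SmallCategory I] [IsFiltered I] (V : I ⥤ Ban R k)

/-- The inclusion of a summand of `P(E)`. -/
def indFreeι (k' : Flavour) (i : I) : Ind.yoneda.obj (free k' (V.obj i)) ⟶ indFree k' V :=
  Sigma.ι (fun i => Ind.yoneda.obj (free k' (V.obj i))) i

/-- The canonical map from a term of the system `V` to its colimit. -/
def limι (i : I) : Ind.yoneda.obj (V.obj i) ⟶ (Ind.lim I).obj V := colimit.ι (V ⋙ Ind.yoneda) i

lemma map_limι {i j : I} (s : i ⟶ j) : Ind.yoneda.map (V.map s) ≫ limι V j = limι V i :=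
  colimit.w (V ⋙ Ind.yoneda) s

lemma lim_hom_ext {Z : Ind (Ban R k)} {f g : (Ind.lim I).obj V ⟶ Z}
    (h : ∀ i, limι V i ≫ f = limι V i ≫ g) : f = g :=
  colimit.hom_ext h

lemma indFree_hom_ext {k' : Flavour} {Z : Ind (Ban R k')} {f g : indFree k' V ⟶ Z}
    (h : ∀ i, indFreeι V k' i ≫ f = indFreeι V k' i ≫ g) : f = g :=
  Sigma.hom_ext _ _ h

lemma indFreeι_indFreeDesc (i : I) :
    indFreeι V k i ≫ indFreeDesc V = Ind.yoneda.map (freeDesc (V.obj i)) ≫ limι V i :=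
  Sigma.ι_desc _ _

instance : Epi (indFreeDesc V) where
  left_cancellation f g h := lim_hom_ext V fun i => by
    rw [← cancel_epi (Ind.yoneda.map (freeDesc (V.obj i))), ← Category.assoc, ← Category.assoc,
      ← indFreeι_indFreeDesc, Category.assoc, h, Category.assoc]

/-- A morphism out of `P(E)` which kills all elements killed by `P(E) ⟶ E` factors through `E`. It
factors on each term of the system; the factorizations are compatible by `comp_eq_of_comp_eq`, as the
transition maps of the system lift to `P`, although not compatibly with the inclusions into `P(E)`. -/
lemma exists_indFreeDesc_comp {Z : Ind (Ban R k)} (g : indFree k V ⟶ Z)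
    (h : ∀ (B : Ban R k) (t : Ind.yoneda.obj B ⟶ indFree k V), t ≫ indFreeDesc V = 0 → t ≫ g = 0) :
    ∃ f, indFreeDesc V ≫ f = g := by
  have h1 (i : I) : ∃ f, Ind.yoneda.map (freeDesc (V.obj i)) ≫ f = indFreeι V k i ≫ g := by
    have h2 : Ind.yoneda.map (freeKerι (V.obj i)) ≫ indFreeι V k i ≫ g =
        Ind.yoneda.map (zeroHom _ _) ≫ indFreeι V k i ≫ g := by
      rw [yoneda_map_zeroHom, zero_comp, ← Category.assoc]
      refine h _ _ ?_
      rw [Category.assoc, indFreeι_indFreeDesc, ← Functor.map_comp_assoc, freeKerι_freeDesc,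
        yoneda_map_zeroHom, zero_comp]
    let ⟨f, hf⟩ := Cofork.IsColimit.desc' (isColimitCoforkMapOfIsColimit Ind.yoneda
      (freeKerι_freeDesc' (V.obj i)) (freeDescIsColimit (V.obj i))) _ h2
    exact ⟨f, hf⟩
  choose f hf using h1
  have hf' {i j : I} (s : i ⟶ j) : Ind.yoneda.map (V.map s) ≫ f j = f i := by
    rw [← cancel_epi (Ind.yoneda.map (freeDesc (V.obj i))), hf, ← Functor.map_comp_assoc,
      ← freeMap_freeDesc, Functor.map_comp_assoc, hf, ← Category.assoc]
    refine comp_eq_of_comp_eq (indFreeDesc V) g h _ _ ?_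
    rw [Category.assoc, indFreeι_indFreeDesc, indFreeι_indFreeDesc, ← Functor.map_comp_assoc,
      freeMap_freeDesc, Functor.map_comp_assoc, map_limι]
  let c : Cocone (V ⋙ Ind.yoneda) :=
    { pt := Z
      ι := { app := f
             naturality := fun i j s => (hf' s).trans (Category.comp_id _).symm } }
  obtain ⟨d, hd⟩ : ∃ d : (Ind.lim I).obj V ⟶ Z, ∀ i, limι V i ≫ d = f i :=
    ⟨colimit.desc _ c, colimit.ι_desc c⟩
  refine ⟨d, indFree_hom_ext V fun i => ?_⟩
  rw [← Category.assoc, indFreeι_indFreeDesc, Category.assoc, hd, hf]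

/-- The comparison between the two versions of `P(E)` is a universal arrow, since it is one on each
summand. -/
lemma isUniversalArrow_indFreeCompare : IsUniversalArrow (indIncl R) (indFreeCompare V) := by
  intro F
  have hι (f : indFree .nonArch V ⟶ F) (i : I) :
      indFreeι V .arch i ≫ indFreeCompare V ≫ (indIncl R).map f =
        Ind.yoneda.map (freeCompare (V.obj i)) ≫
          mapElement (incl R) (indFreeι V .nonArch i ≫ f) := by
    rw [mapElement_comp]
    refine (Category.assoc _ _ _).symm.trans ?_
    refine (congrArg (· ≫ (indIncl R).map f) (Sigma.ι_desc _ i)).trans ?_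
    simp only [Category.assoc]
    rfl
  have hb (i : I) := bijective_mapElement (incl R) (freeCompare (V.obj i))
    (isUniversalArrow_freeCompare (V.obj i)) F
  constructor
  · intro f g h
    refine indFree_hom_ext V fun i => (hb i).1 ?_
    refine (hι f i).symm.trans (Eq.trans ?_ (hι g i))
    exact congrArg (indFreeι V .arch i ≫ ·) h
  · intro g
    choose z hz using fun i => (hb i).2 (indFreeι V .arch i ≫ g)
    refine ⟨Sigma.desc z, indFree_hom_ext V fun i => (hι _ i).trans (Eq.trans ?_ (hz i))⟩
    exact congrArg (fun t => Ind.yoneda.map (freeCompare (V.obj i)) ≫ mapElement (incl R) t)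
      (Sigma.ι_desc z i)

end free
end Ban

/-! ### The reflection of ind-Banach modules -/

namespace Ban
open CategoryTheory Limits CategoryTheory.Ind
variable {R : Type u} [BanachRing R] [IsUltrametricDist R]

section presentation
variable {I T : Type u} [SmallCategory I] [IsFiltered I] [SmallCategory T] [IsFiltered T]
  {k : Flavour} (V : I ⥤ Ban R k) (K : T ⥤ Ban R k)
  (j : (Ind.lim T).obj K ⟶ indFree k V) (hj : j ≫ indFreeDesc V = 0)

/-- An ind-Banach module `E` is the cokernel of the composite `P(ker) ⟶ ker ⟶ P(E)`, where `ker` is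
the kernel of `P(E) ⟶ E`. -/
lemma nonempty_isColimit_indFreeDesc (hK : IsLimit (KernelFork.ofι j hj)) :
    ∃ h : (indFreeDesc K ≫ j) ≫ indFreeDesc V = 0,
      Nonempty (IsColimit (CokernelCofork.ofπ (indFreeDesc V) h)) := by
  refine ⟨by rw [Category.assoc, hj, comp_zero], ⟨Cofork.IsColimit.ofExistsUnique fun s => ?_⟩⟩
  have h1 : j ≫ s.π = 0 := by
    rw [← cancel_epi (indFreeDesc K), comp_zero, ← Category.assoc]
    exact CokernelCofork.condition s
  obtain ⟨f, hf⟩ := exists_indFreeDesc_comp V s.π fun B t ht => by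
    obtain ⟨l, hl⟩ := KernelFork.IsLimit.lift' hK t ht
    have hl : l ≫ j = t := hl
    rw [← hl, Category.assoc, h1, comp_zero]
  refine ⟨f, hf, fun f' hf' => ?_⟩
  rw [← cancel_epi (indFreeDesc V)]
  exact hf'.trans hf.symm

end presentation

section reflection
variable {I T : Type u} [SmallCategory I] [IsFiltered I] [SmallCategory T] [IsFiltered T]
  (V : I ⥤ Ban R .arch) (K : T ⥤ Ban R .arch)
  (j : (Ind.lim T).obj K ⟶ indFree .arch V) (hj : j ≫ indFreeDesc V = 0)

/-- The reflection of `E` is computed by the same presentation as `E`, with the non-Archimedean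
version of `P` instead of the Archimedean one. -/
lemma exists_presentation_reflection (hK : IsLimit (KernelFork.ofι j hj))
    {π : Ind (Ban R .arch) ⥤ Ind (Ban R .nonArch)} (adj : π ⊣ indIncl R) :
    ∃ d : indFree .nonArch K ⟶ indFree .nonArch V,
      (∀ d' : indFree .nonArch K ⟶ indFree .nonArch V,
        indFreeCompare K ≫ (indIncl R).map d' =
          (indFreeDesc K ≫ j) ≫ indFreeCompare V ↔ d' = d) ∧
      ∃ q : indFree .nonArch V ⟶ π.obj ((Ind.lim I).obj V),
        indFreeCompare V ≫ (indIncl R).map q =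
          indFreeDesc V ≫ adj.unit.app ((Ind.lim I).obj V) ∧
        ∃ h : d ≫ q = 0, Nonempty (IsColimit (CokernelCofork.ofπ q h)) := by
  have : (indIncl R).IsRightAdjoint := adj.isRightAdjoint
  obtain ⟨d, hd⟩ := (isUniversalArrow_indFreeCompare K _).2
    ((indFreeDesc K ≫ j) ≫ indFreeCompare V)
  obtain ⟨q, hq⟩ := (isUniversalArrow_indFreeCompare V _).2
    (indFreeDesc V ≫ adj.unit.app ((Ind.lim I).obj V))
  dsimp only at hd hq
  have hdq : d ≫ q = 0 := (isUniversalArrow_indFreeCompare K _).1 (by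
    dsimp only
    rw [Functor.map_comp, Functor.map_zero, comp_zero, ← Category.assoc, hd, Category.assoc, hq,
      Category.assoc, ← Category.assoc j, hj, zero_comp, comp_zero])
  refine ⟨d, fun d' => ⟨fun h => (isUniversalArrow_indFreeCompare K _).1 (h.trans hd.symm), ?_⟩,
    q, hq, hdq, ⟨Cofork.IsColimit.ofExistsUnique fun s => ?_⟩⟩
  · rintro rfl
    exact hd
  · obtain ⟨hc, ⟨hV⟩⟩ := nonempty_isColimit_indFreeDesc V K j hj hK
    have hs : d ≫ s.π = 0 := CokernelCofork.condition s
    obtain ⟨f, hf⟩ := CokernelCofork.IsColimit.desc' hV (indFreeCompare V ≫ (indIncl R).map s.π) (by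
      rw [← Category.assoc, ← hd, Category.assoc, ← Functor.map_comp, hs, Functor.map_zero,
        comp_zero])
    have hf : indFreeDesc V ≫ f = _ := hf
    -- factoring `s.π` through `q` amounts to factoring its adjunct through `P(E) ⟶ E`
    have huniq (t : π.obj ((Ind.lim I).obj V) ⟶ s.pt) :
        q ≫ t = s.π ↔ adj.homEquiv _ _ t = f := by
      rw [← (isUniversalArrow_indFreeCompare V _).1.eq_iff, ← cancel_epi (indFreeDesc V), hf]
      rw [Functor.map_comp, ← Category.assoc, hq, Adjunction.homEquiv_unit, Category.assoc]
    exact ⟨(adj.homEquiv _ _).symm f, (huniq _).2 (Equiv.apply_symm_apply _ _),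
      fun t ht => (Equiv.eq_symm_apply _).2 ((huniq t).1 ht)⟩

end reflection

section monoidal
open Functor.LaxMonoidal Functor.OplaxMonoidal
variable {π : Ind (Ban R .arch) ⥤ Ind (Ban R .nonArch)} (adj : π ⊣ indIncl R) [π.Braided]

lemma mapElement_id (M : Ban R .nonArch) :
    mapElement (incl R) (𝟙 (Ind.yoneda.obj M)) = (Ind.mapUnit (incl R)).app M := by
  rw [mapElement, CategoryTheory.Functor.map_id]
  exact Category.comp_id _

/-- On non-Archimedean modules, the oplax structure of `π` corresponds under the adjunction to the map
`m ⊗ n ↦ m ⊗ n`, by the definition of the lax structure on the extension of the inclusion. -/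
lemma homEquiv_δ (h : Adjunction.IsMonoidal (G := Ind.map (incl R)) adj) (M N : Ban R .nonArch) :
    Ind.tensorComparison ((incl R).obj M) ((incl R).obj N) ≫
        ((Ind.mapUnit (incl R)).app M ⊗ₘ (Ind.mapUnit (incl R)).app N) ≫
          adj.homEquiv _ _ (δ π _ _ ≫
            (adj.counit.app (Ind.yoneda.obj M) ⊗ₘ adj.counit.app (Ind.yoneda.obj N))) =
      Ind.yoneda.map (compare M N) ≫ (Ind.mapUnit (incl R)).app (M ⊗ N) ≫
        (indIncl R).map (Ind.tensorComparison M N) := by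
  have h1 := (h.leftAdjoint_μ (Ind.yoneda.obj M) (Ind.yoneda.obj N)).trans
    (adj.homEquiv_unit (f := δ π _ _ ≫
      (adj.counit.app (Ind.yoneda.obj M) ⊗ₘ adj.counit.app (Ind.yoneda.obj N)))).symm
  have h2 := mul_mapTensor (incl R) (𝟙 (Ind.yoneda.obj M)) (𝟙 (Ind.yoneda.obj N))
  rw [mul_id, mapElement_id, mapElement_id] at h2
  refine Eq.trans ?_ h2
  refine Eq.trans ?_ (Category.assoc _ _ _).symm
  exact congrArg (fun t => Ind.tensorComparison _ _ ≫ (_ ⊗ₘ _) ≫ t) h1.symm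

/-- The unit of the oplax structure of `π` corresponds under the adjunction to the identity of `R`. -/
lemma homEquiv_η (h : Adjunction.IsMonoidal (G := Ind.map (incl R)) adj) :
    adj.homEquiv _ _ (η π) = Ind.yoneda.map (compareUnit R) ≫
      (Ind.mapUnit (incl R)).app (MonoidalCategoryStruct.tensorUnit (Ban R .nonArch)) := by
  refine ((h.leftAdjoint_ε).trans (adj.homEquiv_unit (f := η π)).symm).symm.trans ?_
  exact congrArg (Ind.yoneda.map (compareUnit R) ≫ ·) (mapElement_id _)

end monoidal
end Ban

end

theorem mainTheorem8 {R : Type u} [BanachRing R] [IsUltrametricDist R] :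
    -- both categories are closed
    Nonempty (MonoidalClosed (Ind (Ban R .arch))) ∧
    Nonempty (MonoidalClosed (Ind (Ban R .nonArch))) ∧
    -- the inclusion has a left adjoint, which is strong symmetric monoidal
    ∃ (π : Ind (Ban R .arch) ⥤ Ind (Ban R .nonArch)) (adj : π ⊣ Ban.indIncl R) (_ : π.Braided),
      -- the tensor structure of `π` is the one corresponding, under the adjunction, to the
      -- canonical maps `ι M ⊗ ι N ⟶ ι (M ⊗ N)` and `R ⟶ ι R`
      (∀ M N : Ban R .nonArch,
        Ind.tensorComparison ((Ban.incl R).obj M) ((Ban.incl R).obj N) ≫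
            ((Ind.mapUnit (Ban.incl R)).app M ⊗ₘ (Ind.mapUnit (Ban.incl R)).app N) ≫
              adj.homEquiv _ _ (Functor.OplaxMonoidal.δ π _ _ ≫
                (adj.counit.app (Ind.yoneda.obj M) ⊗ₘ adj.counit.app (Ind.yoneda.obj N))) =
          Ind.yoneda.map (Ban.compare M N) ≫ (Ind.mapUnit (Ban.incl R)).app (M ⊗ N) ≫
            (Ban.indIncl R).map (Ind.tensorComparison M N)) ∧
      adj.homEquiv _ _ (Functor.OplaxMonoidal.η π) =
        Ind.yoneda.map (Ban.compareUnit R) ≫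
          (Ind.mapUnit (Ban.incl R)).app (MonoidalCategoryStruct.tensorUnit (Ban R .nonArch)) ∧
      -- the adjunction holds for internal homs
      (∀ (_ : MonoidalClosed (Ind (Ban R .arch))) (_ : MonoidalClosed (Ind (Ban R .nonArch)))
        (E : Ind (Ban R .arch)) (F : Ind (Ban R .nonArch)),
        IsIso (MonoidalClosed.curry (A := E)
          (Y := (Ban.indIncl R).obj ((ihom (π.obj E)).obj F)) (X := (Ban.indIncl R).obj F)
          (adj.homEquiv _ _ (Functor.OplaxMonoidal.δ π _ _ ≫
            π.obj E ◁ adj.counit.app ((ihom (π.obj E)).obj F) ≫ (ihom.ev (π.obj E)).app F)))) ∧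
      -- the explicit construction of `π E`, where `E` is the ind-object of the system `V`
      ∀ (I : Type u) [SmallCategory I] [IsFiltered I] (V : I ⥤ Ban R .arch),
        HasKernel (Ban.indFreeDesc V) ∧
        ∀ (T : Type u) [SmallCategory T] [IsFiltered T] (K : T ⥤ Ban R .arch)
          (j : (Ind.lim T).obj K ⟶ Ban.indFree .arch V) (hj : j ≫ Ban.indFreeDesc V = 0),
          IsLimit (KernelFork.ofι j hj) →
          -- `E` is the cokernel of `P(ker κ) ⟶ P(E)` in the Archimedean category
          (∃ h : (Ban.indFreeDesc K ≫ j) ≫ Ban.indFreeDesc V = 0,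
            Nonempty (IsColimit (CokernelCofork.ofπ (Ban.indFreeDesc V) h))) ∧
          -- `P(ker κ) ⟶ P(E)` induces a unique map in the non-Archimedean category
          ∃ d : Ban.indFree .nonArch K ⟶ Ban.indFree .nonArch V,
            (∀ d' : Ban.indFree .nonArch K ⟶ Ban.indFree .nonArch V,
              Ban.indFreeCompare K ≫ (Ban.indIncl R).map d' =
                (Ban.indFreeDesc K ≫ j) ≫ Ban.indFreeCompare V ↔ d' = d) ∧
            -- and `π E` is its cokernel
            ∃ q : Ban.indFree .nonArch V ⟶ π.obj ((Ind.lim I).obj V),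
              Ban.indFreeCompare V ≫ (Ban.indIncl R).map q =
                Ban.indFreeDesc V ≫ adj.unit.app ((Ind.lim I).obj V) ∧
              ∃ h : d ≫ q = 0, Nonempty (IsColimit (CokernelCofork.ofπ q h)) := by
  obtain ⟨c₁⟩ := Ban.nonempty_monoidalClosed (R := R) (k := .arch)
  obtain ⟨c₂⟩ := Ban.nonempty_monoidalClosed (R := R) (k := .nonArch)
  obtain ⟨π, adj, hπ, hadj⟩ := Ind.exists_braided_leftAdjoint (Ban.incl R) Ban.isUniversalArrow_ε
    fun _ _ => Ban.isUniversalArrow_tensor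
  refine ⟨⟨c₁⟩, ⟨c₂⟩, π, adj, hπ, Ban.homEquiv_δ adj hadj, Ban.homEquiv_η adj hadj, ?_, ?_⟩
  · intro _ _ E F
    exact isIso_curry_ihom adj E F
  · intro I _ _ V
    refine ⟨inferInstance, fun T _ _ K j hj hK => ⟨?_, ?_⟩⟩
    · exact Ban.nonempty_isColimit_indFreeDesc V K j hj hK
    · exact Ban.exists_presentation_reflection V K j hj hK adj
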